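/- **Setting.** Let $(\Omega,d)$ be a metric space with its Borel $\sigma$-algebra, $p\ge 1$, and let $(X,Y)\sim\nu$ with $X\in[0,1]^p$ (Euclidean norm $\|\cdot\|$), $Y\in\Omega$; $\nu_X$ is the law of $X$, and the conditional law of $Y$ given $X=x$ is given by a probability kernel. Put $M(x,\omega)=\mathbb E[d^2(Y,\omega)\mid X=x]$ and let $m_x$ be a minimizer of $M(x,\cdot)$ over $\Omega$ (conditional Fréchet mean). Let $(X_i,Y_i)_{1\le i\le n}$, $n\ge1$, be i.i.d. from $\nu$. For $h>0$ and a kernel $K$, $\hat m^{nw}_x$ is a (jointly measurable) minimizer over $\omega\in\Omega$ of $\frac1n\sum_i h^{-p}K(\|X_i-x\|/h)\,d^2(Y_i,\omega)$. For $1\le k\le n$, $\hat m^{kn}_x$ is a (jointly measurable) minimizer of $\sum_{i\in N_k(x)}d^2(Y_i,\omega)$, where $N_k(x)$ is a set of indices of $k$ nearest neighbours of $x$ among $X_1,\dots,X_n$, ties being broken by any rule depending on the $X_i$ and $x$ only. For $\mathcal B\subset\Omega$ let $\gamma_2(\mathcal B,d)=\inf\sup_{\omega\in\mathcal B}\sum_{j\ge0}2^{j/2}\operatorname{diam}A_j(\omega)$,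 the infimum being over sequences of successively finer partitions $(\mathcal A_j)_{j\ge0}$ of $\mathcal B$ with $\mathcal A_0=\{\mathcal B\}$ and $\#\mathcal A_j\le2^{2^j}$ for $j\ge1$, with $A_j(\omega)$ the block of $\mathcal A_j$ containing $\omega$. **Assumptions.** There are $\alpha\in[1,2)$, $\kappa>\frac2{2-\alpha}$, $\beta\in(0,1]$ and constants $C_{Vlo},C_{Ent},C_{Mom},C_{Len},C_{Int},C_{SmD},C_{Bom}\in[1,\infty)$ such that, for all $x,x_1,x_2\in[0,1]^p$: * (A1) $C_{Vlo}^{-1}d^2(\omega,m_x)\le M(x,\omega)-M(x,m_x)$ for all $\omega\in\Omega$. * (A2) $\gamma_2(\mathcal B,d)\le C_{Ent}\max(\operatorname{diam}\mathcal B,(\operatorname{diam}\mathcal B)^\alpha)$ for all $\mathcal B\subset\Omega$. * (A3) $\mathbb E[d^\kappa(Y,m_x)\mid X=x]^{1/\kappa}\le C_{Mom}$. * (A4) $K$ is nonincreasing on $[0,1]$, positive on $[0,1)$, nonnegative at $1$, and $0$ outside $[0,1]$. * (B5) $x\mapsto m_x$ is continuous on $[0,1]^p$ and $d(m_{x_1},m_{x_2})\le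 C_{Len}$; there is a probability measure $\mu$ on $\Omega$ with $\int d^2(y,m_0)\,\mu(dy)\le C_{Int}$ such that $Y$ given $X=x$ has a $\mu$-density $\rho(\cdot|x)$, and there is $L\ge0$ with $\int L^2d\mu\le C_{SmD}^2$ and $|\rho(y|x_1)-\rho(y|x_2)|\le L(y)\|x_1-x_2\|^\beta$ for $\mu$-almost all $y$. * (B6) With $H(\omega_1,\omega_2)=\{\int(d(y,\omega_1)+d(y,\omega_2))^2\mu(dy)\}^{1/2}$, the estimator $\hat m$ under consideration satisfies $\mathbb E[H(\hat m_x,m_x)^\kappa\mid X_1,\dots,X_n]^{1/\kappa}\le C_{Bom}$ almost surely. **Theorem.** There is a constant $c_{\alpha,\kappa}$, depending on $\alpha,\kappa$ only, such that the following holds. *Nadaraya–Watson.* There is a constant $c'$ depending only on $\alpha,\kappa,p,K$ such that for all $n\ge1$, $h>0$ $$\int\mathbb E\{d^2(\hat m^{nw}_x,m_x)\}\nu_X(dx)\le c_{\alpha,\kappa}(C_{Vlo}C_{SmD}C_{Bom})^{\frac2{2-\alpha}}h^{2\beta}+c'A\,\frac{e^{-1}}{nh^p}+c'(C_{Vlo}C_{Mom}C_{Ent})^{\frac2{2-\alpha}}\frac1{nh^p},$$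 with $A=(C_{Vlo}C_{Bom})^{2/(2-\alpha)}$ for every choice of the minimizer, and with $A=(C_{Vlo}C_{Mom}C_{Len})^{2/(2-\alpha)}$ if moreover, whenever all weights $K(\|X_i-x\|/h)$ vanish (so that every point is a minimizer), $\hat m^{nw}_x$ is chosen as a minimizer of $\sum_{i=1}^nd^2(Y_i,\cdot)$. Consequently, if $a\,n^{-1/(2\beta+p)}\le h\le b\,n^{-1/(2\beta+p)}$ with $0<a\le b$, then for every choice of the minimizer $\int\mathbb E\{d^2(\hat m^{nw}_x,m_x)\}\nu_X(dx)\le c\,n^{-2\beta/(2\beta+p)}$, with $c$ not depending on $n$ (it depends only on $a,b,\alpha,\kappa,\beta,p,K$ and the constants of the assumptions). *Nearest neighbours.* If $p\ge3$, there is $c'$ depending on $p$ only such that for all $1\le k\le n$ $$\int\mathbb E\{d^2(\hat m^{kn}_x,m_x)\}\nu_X(dx)\le c_{\alpha,\kappa}(C_{Vlo}C_{SmD}C_{Bom})^{\frac2{2-\alpha}}\frac{c'}{\lfloor n/k\rfloor^{2\beta/p}}+c_{\alpha,\kappa}(C_{Vlo}C_{Mom}C_{Ent})^{\frac2{2-\alpha}}k^{-1}.$$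 If $p<3$, the same bound holds provided that there are $\xi_0>0$ and a measurable $g\ge0$ with $\nu_X(\{u:\|u-x\|\le\xi\})>g(x)\xi^p$ for all $x\in[0,1]^p$, $0<\xi\le\xi_0$, and $\int g(x)^{-2/p}\nu_X(dx)\le G<\infty$; then $c'$ depends on $p,\xi_0,G$ only. In both cases, if $a\,n^{2\beta/(2\beta+p)}\le k\le b\,n^{2\beta/(2\beta+p)}$ with $0<a\le b$, then $\int\mathbb E\{d^2(\hat m^{kn}_x,m_x)\}\nu_X(dx)\le c\,n^{-2\beta/(2\beta+p)}$, with $c$ not depending on $n$ (it depends only on $a,b,\alpha,\kappa,\beta,p$, the constants of the assumptions and, for $p<3$, on $\xi_0,G$). -/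

import Mathlib

open MeasureTheory ProbabilityTheory
open scoped ENNReal

universe u

namespace FrechetReg

/-- `p`-dimensional Euclidean space (with the Euclidean norm). -/
abbrev Euc (p : ℕ) : Type := EuclideanSpace ℝ (Fin p)

/-- The unit cube `[0,1]^p`. -/
def cube (p : ℕ) : Set (Euc p) := {x | ∀ i, x i ∈ Set.Icc (0 : ℝ) 1}

section Entropy

/-- An admissible sequence of partitions of `T`. A partition is given by the equivalence relation
whose classes are its blocks: the first one has one block, each one refines its predecessor,
and the `k`-th one has at most `2 ^ 2 ^ k` blocks. -/
structure IsAdmissible {T : Type*} (A : ℕ → Setoid T) : Prop where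
  zero : A 0 = ⊤
  refines : ∀ k, A (k + 1) ≤ A k
  card_le : ∀ k, 1 ≤ k → ENat.card (Quotient (A k)) ≤ ((2 ^ 2 ^ k : ℕ) : ℕ∞)

/-- Talagrand's `γ₂` of the subset `B`, with values in `[0,∞]`. -/
noncomputable def gamma2 {Ω : Type*} [PseudoEMetricSpace Ω] (B : Set Ω) : ℝ≥0∞ :=
  ⨅ (A : ℕ → Setoid B) (_ : IsAdmissible A),
    ⨆ ω : B, ∑' k : ℕ, (2 : ℝ≥0∞) ^ ((k : ℝ) / 2) * Metric.ediam {ω' : B | (A k) ω' ω}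

end Entropy

/-- The smoothness exponent and the constants that occur in the assumptions. -/
structure Params where
  (β Vlo Ent Mom Len Int SmD Bom : ℝ)
  β_pos : 0 < β
  β_le : β ≤ 1
  one_le_Vlo : 1 ≤ Vlo
  one_le_Ent : 1 ≤ Ent
  one_le_Mom : 1 ≤ Mom
  one_le_Len : 1 ≤ Len
  one_le_Int : 1 ≤ Int
  one_le_SmD : 1 ≤ SmD
  one_le_Bom : 1 ≤ Bom

/-- The data of the regression problem: the law `νX` of `X`, carried by the cube; the conditional
law `η x` of `Y` given `X = x`; a reference probability measure `μ` on the response space; and a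
function `m`, which the assumptions below make the conditional Fréchet mean. -/
structure Setting (p : ℕ) (Ω : Type u) [MetricSpace Ω] [MeasurableSpace Ω] where
  νX : Measure (Euc p)
  η : Kernel (Euc p) Ω
  μ : Measure Ω
  m : Euc p → Ω
  prob_νX : IsProbabilityMeasure νX
  markov_η : IsMarkovKernel η
  prob_μ : IsProbabilityMeasure μ
  νX_cube : ∀ᵐ x ∂νX, x ∈ cube p

namespace Setting

attribute [instance] Setting.prob_νX Setting.markov_η Setting.prob_μ

variable {p : ℕ} {Ω : Type u} [MetricSpace Ω] [MeasurableSpace Ω] (S : Setting p Ω)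

/-- The joint law of `(X, Y)`. -/
noncomputable def ν : Measure (Euc p × Ω) := S.νX ⊗ₘ S.η

/-- The law of the i.i.d. sample `(X₁, Y₁), …, (Xₙ, Yₙ)`. -/
noncomputable def sampleLaw (n : ℕ) : Measure (Fin n → Euc p × Ω) := Measure.pi fun _ => S.ν

/-- `M(x, ω) = E[d²(Y, ω) | X = x]`. -/
noncomputable def M (x : Euc p) (ω : Ω) : ℝ := ∫ y, dist y ω ^ 2 ∂(S.η x)

/-- `m x` minimizes `M(x, ·)`, for every `x` in the cube. -/
def IsFrechetMean : Prop := ∀ x ∈ cube p, IsMinOn (S.M x) Set.univ (S.m x)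

/-- Variance inequality. -/
def VarIneq (C : Params) : Prop :=
  ∀ x ∈ cube p, ∀ ω, C.Vlo⁻¹ * dist ω (S.m x) ^ 2 ≤ S.M x ω - S.M x (S.m x)

/-- Conditional Fréchet moment of order `κ`. -/
def Moment (κ : ℝ) (C : Params) : Prop :=
  ∀ x ∈ cube p, (∫⁻ y, edist y (S.m x) ^ κ ∂(S.η x)) ^ (1 / κ) ≤ ENNReal.ofReal C.Mom

/-- Continuity and boundedness of the regression function, square integrability of the reference
measure, and Hölder continuity in `x` of the density `ρ y x` of `Y` at `y` given `X = x`. -/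
def HolderSmoothDensity (C : Params) : Prop :=
  ContinuousOn S.m (cube p) ∧
  (∀ x₁ ∈ cube p, ∀ x₂ ∈ cube p, dist (S.m x₁) (S.m x₂) ≤ C.Len) ∧
  ∫⁻ y, edist y (S.m 0) ^ 2 ∂S.μ ≤ ENNReal.ofReal C.Int ∧
  ∃ (ρ : Ω → Euc p → ℝ) (L : Ω → ℝ),
    (∀ x ∈ cube p, Measurable (fun y => ρ y x) ∧ (∀ y, 0 ≤ ρ y x) ∧
      S.η x = S.μ.withDensity (fun y => ENNReal.ofReal (ρ y x))) ∧
    AEMeasurable L S.μ ∧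
    (∀ᵐ y ∂S.μ, 0 ≤ L y ∧ ∀ x₁ ∈ cube p, ∀ x₂ ∈ cube p,
      |ρ y x₁ - ρ y x₂| ≤ L y * ‖x₁ - x₂‖ ^ C.β) ∧
    ∫⁻ y, ENNReal.ofReal (L y) ^ 2 ∂S.μ ≤ ENNReal.ofReal (C.SmD ^ 2)

/-- `H(ω₁, ω₂) = (∫ (d(y, ω₁) + d(y, ω₂))² μ(dy))^{1/2}`. -/
noncomputable def H (ω₁ ω₂ : Ω) : ℝ≥0∞ :=
  (∫⁻ y, (edist y ω₁ + edist y ω₂) ^ 2 ∂S.μ) ^ (1 / 2 : ℝ)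

/-- Bias moment condition for an estimator `mhat`, a function of the sample and of the point `x`.
Given `X₁ = xs 1, …, Xₙ = xs n`, the responses are independent with laws `η (xs i)`, so that the
inner integral is the conditional expectation given the `Xᵢ`. -/
def BiasMoment (κ : ℝ) (C : Params) {n : ℕ} (mhat : (Fin n → Euc p × Ω) → Euc p → Ω) : Prop :=
  ∀ x ∈ cube p, ∀ᵐ xs ∂(Measure.pi fun _ : Fin n => S.νX),
    (∫⁻ ys, S.H (mhat (fun i => (xs i, ys i)) x) (S.m x) ^ κ
        ∂(Measure.pi fun i => S.η (xs i))) ^ (1 / κ) ≤ ENNReal.ofReal C.Bom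

/-- The integrated mean squared error `∫ E[d²(mhat_x, m_x)] νX(dx)`. -/
noncomputable def risk {n : ℕ} (mhat : (Fin n → Euc p × Ω) → Euc p → Ω) : ℝ≥0∞ :=
  ∫⁻ x, ∫⁻ z, edist (mhat z x) (S.m x) ^ 2 ∂(S.sampleLaw n) ∂S.νX

/-- The radius-`ξ` balls have mass more than `g(x) ξ^p` for `ξ ≤ ξ₀`, and
`∫ g^{-2/p} dνX ≤ G < ∞` (with `1 / 0 = ∞`). -/
def BallMass (ξ₀ G : ℝ) : Prop :=
  ∃ g : Euc p → ℝ, Measurable g ∧ (∀ x, 0 ≤ g x) ∧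
    (∀ x ∈ cube p, ∀ ξ : ℝ, 0 < ξ → ξ ≤ ξ₀ →
      ENNReal.ofReal (g x * ξ ^ p) < S.νX (Metric.closedBall x ξ)) ∧
    ∫⁻ x, (ENNReal.ofReal (g x) ^ (2 / (p : ℝ)))⁻¹ ∂S.νX ≤ ENNReal.ofReal G

end Setting

/-- Entropy condition: a property of the response space alone. -/
def Entropy (Ω : Type u) [MetricSpace Ω] (α : ℝ) (C : Params) : Prop :=
  ∀ B : Set Ω, gamma2 B ≤ ENNReal.ofReal C.Ent * max (Metric.ediam B) (Metric.ediam B ^ α)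

/-- All assumptions on the regression problem that do not involve an estimator. -/
structure Assumptions {p : ℕ} {Ω : Type u} [MetricSpace Ω] [MeasurableSpace Ω]
    (S : Setting p Ω) (α κ : ℝ) (C : Params) : Prop where
  isFrechetMean : S.IsFrechetMean
  varIneq : S.VarIneq C
  entropy : Entropy Ω α C
  moment : S.Moment κ C
  holder : S.HolderSmoothDensity C

section Estimators

/-- A kernel positive on `[0,1)`, nonincreasing on `[0,1]` (hence highest at `0`) and zero outside
`[0,1]`. The value at `1` may be zero, as for the Epanechnikov kernel. -/
structure IsSmoothingKernel (K : ℝ → ℝ) : Prop where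
  pos : ∀ u, 0 ≤ u → u < 1 → 0 < K u
  nonneg_one : 0 ≤ K 1
  antitone : AntitoneOn K (Set.Icc 0 1)
  zero_outside : ∀ u, u ∉ Set.Icc (0 : ℝ) 1 → K u = 0

variable {p : ℕ} {Ω : Type u} [MetricSpace Ω] {n : ℕ}

/-- The rescaled kernel `K_h(t) = h^{-p} K(t / h)`. -/
noncomputable def scaledKernel (p : ℕ) (K : ℝ → ℝ) (h t : ℝ) : ℝ := (h ^ p)⁻¹ * K (t / h)

/-- The Nadaraya–Watson criterion at `x`. -/
noncomputable def nwCriterion (K : ℝ → ℝ) (h : ℝ) (z : Fin n → Euc p × Ω) (x : Euc p) (ω : Ω) : ℝ :=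
  (1 / (n : ℝ)) * ∑ i, scaledKernel p K h ‖(z i).1 - x‖ * dist (z i).2 ω ^ 2

/-- `T` consists of `k` nearest neighbours of `x` among `xs 1, …, xs n`. -/
def IsNearest (k : ℕ) (xs : Fin n → Euc p) (x : Euc p) (T : Finset (Fin n)) : Prop :=
  T.card = k ∧ ∀ i ∈ T, ∀ j ∉ T, ‖xs i - x‖ ≤ ‖xs j - x‖

/-- The nearest neighbour criterion for the index set `T`. -/
noncomputable def knnCriterion (T : Finset (Fin n)) (z : Fin n → Euc p × Ω) (ω : Ω) : ℝ :=
  ∑ i ∈ T, dist (z i).2 ω ^ 2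

variable [MeasurableSpace Ω]

/-- `mhat` is a (measurable) Nadaraya–Watson Fréchet estimator: at each point it almost surely
minimizes the criterion. -/
def IsNW (S : Setting p Ω) (K : ℝ → ℝ) (h : ℝ) (mhat : (Fin n → Euc p × Ω) → Euc p → Ω) : Prop :=
  Measurable (fun q : (Fin n → Euc p × Ω) × Euc p => mhat q.1 q.2) ∧
  ∀ x ∈ cube p, ∀ᵐ z ∂(S.sampleLaw n), IsMinOn (nwCriterion K h z x) Set.univ (mhat z x)

/-- Where all kernel weights vanish (the criterion is then constant and any point minimizes it),
`mhat` is the Fréchet mean of all observed responses. -/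
def EmptyWindowRule (S : Setting p Ω) (K : ℝ → ℝ) (h : ℝ)
    (mhat : (Fin n → Euc p × Ω) → Euc p → Ω) : Prop :=
  ∀ x ∈ cube p, ∀ᵐ z ∂(S.sampleLaw n), (∀ i, scaledKernel p K h ‖(z i).1 - x‖ = 0) →
    IsMinOn (fun ω => ∑ i, dist (z i).2 ω ^ 2) Set.univ (mhat z x)

/-- `mhat` is a (measurable) `k`-nearest-neighbour Fréchet estimator. Ties between equidistant
points may be broken by any rule `N` that looks at the `Xᵢ` and at `x` only. -/
def IsKNN (S : Setting p Ω) (k : ℕ) (mhat : (Fin n → Euc p × Ω) → Euc p → Ω) : Prop :=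
  Measurable (fun q : (Fin n → Euc p × Ω) × Euc p => mhat q.1 q.2) ∧
  ∃ N : (Fin n → Euc p) → Euc p → Finset (Fin n), (∀ xs x, IsNearest k xs x (N xs x)) ∧
    ∀ x ∈ cube p, ∀ᵐ z ∂(S.sampleLaw n),
      IsMinOn (knnCriterion (N (fun i => (z i).1) x) z) Set.univ (mhat z x)

end Estimators

end FrechetReg

/-! Condition on the covariates. Both estimators then minimize `∑ w i * d²(Y i, ·)` with normalized
weights that depend on the covariates only, and the responses are independent. Write `q = ∑ w i ^
2`, let `r` bound the weighted mean of `‖X i - x‖ ^ (2β)`, and let `D` be the distance from the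
minimizer `F` to `m x`. `Setting.conditional_risk_le` bounds the conditional mean of `D²` by a
multiple of `(Vlo SmD Bom)^(2/(2-α)) r + (Vlo Mom Ent)^(2/(2-α)) q`, a bias and a variance term.

The variance inequality gives `Vlo⁻¹ D² ≤ Δ x`, where `Δ z` is the increment of `M z` from `m x` to
`F`. Split `Δ x` into the weighted mean of `Δ x - Δ (X i)` and that of `Δ (X i)`; since `F`
minimizes the empirical criterion, the latter is at most the absolute value of the centered
empirical increment (`deviation`). One of the two parts is at least `D² / (2 Vlo)`. If it is the
first, Cauchy–Schwarz applied to the Hölder density (`Setting.bias_le`) bounds it by `D` times `H`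
times a power of the covariate distances; one factor `D` cancels and the moment bound on `H`
finishes.

If it is the second, peel: split the values of `D` into dyadic shells above a critical radius
proportional to `√q`. A shell is reached only if the deviation is large somewhere on a ball around
`m x`. Symmetrization and generic chaining (`lintegral_centeredSup_rpow_le`) bound its `κ`-th
moment, Markov's inequality gives the probability, and the sum over shells is geometric exactly
because `κ > 2/(2-α)` (`WeightedSample.lintegral_sq_le_of_deviation`). The envelope is controlled
only on balls of radius comparable to `Mom`; a farther minimizer forces a large fluctuation of the
weighted sum of distances, handled by its variance.

For Nadaraya–Watson, `r = h^(2β)` and `q` is at most a multiple of `1/(1+N)`, where `N` counts the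
sample points in the grid cell of `x`. By exchangeability the mean of `1/(1+N)` is at most the
number of cells divided by `n+1` (`lintegral_inv_one_add_cellCount_le`), with no assumption on the
law of `X`. For nearest neighbours, `q = 1/k`, and `r` is compared with the nearest points of `k`
disjoint blocks of length `⌊n/k⌋` (`IsNearest.sum_rpow_le`). The moments of the nearest distance
come from the same cell count when `p ≥ 3`, and from the ball-mass condition otherwise. -/

namespace FrechetReg

/-! ### Sub-Gaussian bounds for sign sums and generic chaining. -/

section Rademacher

/-- The sign encoded by a Boolean. -/
def sgn (b : Bool) : ℝ := if b then 1 else -1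

variable {ι : Type*} [Fintype ι] [DecidableEq ι]

/-- The sum over sign patterns factorizes over the coordinates; each factor is `2 cosh (t a i)`, at
most `2 exp (t² a i² / 2)`. -/
lemma sum_exp_rademacher_le (a : ι → ℝ) (t : ℝ) :
    ∑ ε : ι → Bool, Real.exp (t * ∑ i, sgn (ε i) * a i) ≤
      2 ^ Fintype.card ι * Real.exp (t ^ 2 * (∑ i, a i ^ 2) / 2) := by
  have h1 : ∑ ε : ι → Bool, Real.exp (t * ∑ i, sgn (ε i) * a i)
      = ∏ i, ∑ b : Bool, Real.exp (t * (sgn b * a i)) := by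
    rw [Finset.prod_univ_sum, Fintype.piFinset_univ]
    refine Finset.sum_congr rfl fun ε _ => ?_
    rw [← Real.exp_sum, Finset.mul_sum]
  have h2 : ∀ i, ∑ b : Bool, Real.exp (t * (sgn b * a i)) ≤
      2 * Real.exp (t ^ 2 * a i ^ 2 / 2) := by
    intro i
    have := Real.cosh_le_exp_half_sq (t * a i)
    rw [Real.cosh_eq] at this
    have e : (t * a i) ^ 2 / 2 = t ^ 2 * a i ^ 2 / 2 := by ring
    rw [e] at this
    simp [sgn]
    linarith
  calc _ = _ := h1
    _ ≤ ∏ i, (2 * Real.exp (t ^ 2 * a i ^ 2 / 2)) :=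
        Finset.prod_le_prod (fun i _ => by positivity) fun i _ => h2 i
    _ = _ := by
        rw [Finset.prod_mul_distrib, Finset.prod_const, ← Real.exp_sum, Finset.card_univ,
          ← Finset.sum_div, Finset.mul_sum]

lemma sum_exp_abs_rademacher_le (a : ι → ℝ) (ha : ∑ i, a i ^ 2 ≤ 1) (t : ℝ) :
    ∑ ε : ι → Bool, Real.exp (t * |∑ i, sgn (ε i) * a i|) ≤
      2 * 2 ^ Fintype.card ι * Real.exp (t ^ 2 / 2) := by
  have h1 := sum_exp_rademacher_le a t
  have h2 := sum_exp_rademacher_le a (-t)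
  have h3 : ∀ ε : ι → Bool, Real.exp (t * |∑ i, sgn (ε i) * a i|) ≤
      Real.exp (t * ∑ i, sgn (ε i) * a i) + Real.exp (-t * ∑ i, sgn (ε i) * a i) := by
    intro ε
    rcases abs_cases (∑ i, sgn (ε i) * a i) with h | h <;> rw [h.1]
    · linarith [Real.exp_pos (-t * ∑ i, sgn (ε i) * a i)]
    · rw [mul_neg, ← neg_mul]
      linarith [Real.exp_pos (t * ∑ i, sgn (ε i) * a i)]
  have h4 : Real.exp (t ^ 2 * (∑ i, a i ^ 2) / 2) ≤ Real.exp (t ^ 2 / 2) := by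
    apply Real.exp_le_exp.2
    nlinarith [sq_nonneg t]
  calc _ ≤ _ := Finset.sum_le_sum fun ε _ => h3 ε
    _ ≤ _ := by
      rw [Finset.sum_add_distrib]
      rw [neg_sq] at h2
      have : (0:ℝ) ≤ 2 ^ Fintype.card ι := by positivity
      nlinarith

/-- Exponential bound for the part above `3` of the rescaled `s`-th power. -/
lemma rpow_le_of_three_lt {s y : ℝ} (hs : 0 < s) (hy : 3 < y) (k : ℕ) :
    y ^ s ≤ s ^ s * Real.exp 3 * (Real.exp (2 * 2 ^ k * y) * Real.exp (-(6 * 2 ^ k))) := by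
  have h0 : y / s ≤ Real.exp (y / s) := by linarith [Real.add_one_le_exp (y / s)]
  have h1 : y ^ s ≤ s ^ s * Real.exp y := by
    have : y = s * (y / s) := by field_simp
    calc y ^ s = (s * (y / s)) ^ s := by rw [← this]
      _ = s ^ s * (y / s) ^ s := Real.mul_rpow hs.le (by positivity)
      _ ≤ s ^ s * (Real.exp (y / s)) ^ s := by gcongr
      _ = s ^ s * Real.exp y := by
        rw [← Real.exp_mul]; congr 2; field_simp
  refine h1.trans ?_
  rw [mul_assoc]
  gcongr
  rw [← Real.exp_add, ← Real.exp_add]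
  apply Real.exp_le_exp.2
  -- The remaining inequality of exponents is `0 ≤ (2 * 2 ^ k - 1) * (y - 3)`.
  have : (1 : ℝ) ≤ 2 ^ k := one_le_pow₀ (by norm_num)
  nlinarith

/-- The union bound over blocks is affordable: the `k`-th term is `(4 e⁻⁴)^(2^k)`, and `4 e⁻⁴ ≤
1/2`. -/
lemma tsum_card_mul_exp_le :
    ∑' k : ℕ, ((2 ^ 2 ^ (k + 1) : ℕ) : ℝ≥0∞) * ENNReal.ofReal (Real.exp (-(4 * 2 ^ k))) ≤ 1 := by
  have h : ∀ k : ℕ, ((2 ^ 2 ^ (k + 1) : ℕ) : ℝ≥0∞) * ENNReal.ofReal (Real.exp (-(4 * 2 ^ k)))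
      ≤ (2⁻¹ : ℝ≥0∞) ^ (k + 1) := by
    intro k
    have e1 : ((2 ^ 2 ^ (k + 1) : ℕ) : ℝ≥0∞) = ENNReal.ofReal (4 ^ 2 ^ k) := by
      rw [pow_succ', pow_mul]
      rw [ENNReal.ofReal_pow (by norm_num)]
      norm_num
    have e2 : (2⁻¹ : ℝ≥0∞) ^ (k + 1) = ENNReal.ofReal ((1 / 2) ^ (k + 1)) := by
      rw [ENNReal.ofReal_pow (by norm_num), one_div, ENNReal.ofReal_inv_of_pos (by norm_num)]
      norm_num
    rw [e1, e2, ← ENNReal.ofReal_mul (by positivity)]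
    apply ENNReal.ofReal_le_ofReal
    have e3 : Real.exp (-(4 * 2 ^ k)) = Real.exp (-4) ^ 2 ^ k := by
      rw [← Real.exp_nat_mul]; congr 1; push_cast; ring
    rw [e3, ← mul_pow]
    have h4 : 4 * Real.exp (-4) ≤ 1 / 2 := by
      have h8 : (8 : ℝ) ≤ Real.exp 4 := by
        have : (2:ℝ) ≤ Real.exp 1 := by linarith [Real.add_one_le_exp (1:ℝ)]
        calc (8:ℝ) ≤ 2 ^ 4 := by norm_num
          _ ≤ Real.exp 1 ^ 4 := by gcongr
          _ = Real.exp 4 := by rw [← Real.exp_nat_mul]; norm_num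
      rw [Real.exp_neg]
      have : (Real.exp 4)⁻¹ ≤ 8⁻¹ := by gcongr
      linarith
    calc (4 * Real.exp (-4)) ^ 2 ^ k ≤ (1 / 2) ^ 2 ^ k := by gcongr
      _ ≤ (1 / 2) ^ (k + 1) := by
        apply pow_le_pow_of_le_one (by norm_num) (by norm_num)
        exact Nat.lt_two_pow_self
  refine (ENNReal.tsum_le_tsum h).trans ?_
  rw [ENNReal.tsum_geometric_add_one]
  norm_num

section Chaining

variable {T : Type*} [PseudoMetricSpace T]

/-- The chosen point of the block of `ω` in the `k`-th partition. -/
noncomputable def blockRep (A : ℕ → Setoid T) (k : ℕ) (ω : T) : T := (Quotient.mk (A k) ω).out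

omit [PseudoMetricSpace T] in
lemma blockRep_rel (A : ℕ → Setoid T) (k : ℕ) (ω : T) : (A k) (blockRep A k ω) ω :=
  Quotient.mk_out (s := A k) ω

omit [PseudoMetricSpace T] in
lemma blockRep_congr (A : ℕ → Setoid T) (k : ℕ) {ω ω' : T} (h : (A k) ω ω') :
    blockRep A k ω = blockRep A k ω' := by
  unfold blockRep
  rw [Quotient.sound (s := A k) h]

/-- The Rademacher process with coefficients `v`. -/
def radProc (v : T → ι → ℝ) (ε : ι → Bool) (ω : T) : ℝ := ∑ i, sgn (ε i) * v ω i

omit [DecidableEq ι] in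
-- A crude Lipschitz bound, losing a factor `card ι`. It makes the end of a chain negligible and
-- shows that links of length zero have zero increment.
lemma radProc_sub_abs_le {v : T → ι → ℝ} {τ : ℝ} (hτ : 0 ≤ τ)
    (hv : ∀ ω ω', ∑ i, (v ω i - v ω' i) ^ 2 ≤ (τ * dist ω ω') ^ 2) (ε : ι → Bool) (ω ω' : T) :
    |radProc v ε ω - radProc v ε ω'| ≤ Fintype.card ι * (τ * dist ω ω') := by
  have h1 : radProc v ε ω - radProc v ε ω' = ∑ i, sgn (ε i) * (v ω i - v ω' i) := by
    simp [radProc, mul_sub]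
  rw [h1]
  refine (Finset.abs_sum_le_sum_abs _ _).trans ?_
  have h2 : ∀ i ∈ Finset.univ, |sgn (ε i) * (v ω i - v ω' i)| ≤ τ * dist ω ω' := by
    intro i _
    have h3 : |sgn (ε i)| = 1 := by unfold sgn; split_ifs <;> simp
    rw [abs_mul, h3, one_mul]
    refine abs_le_of_sq_le_sq ?_ (by positivity)
    exact (Finset.single_le_sum (f := fun i => (v ω i - v ω' i) ^ 2) (fun i _ => sq_nonneg _)
      (Finset.mem_univ i)).trans (hv ω ω')
  refine (Finset.sum_le_card_nsmul _ _ _ h2).trans ?_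
  simp

/-- The normalized increment of the chain that ends in the block `c`. -/
noncomputable def link (A : ℕ → Setoid T) (v : T → ι → ℝ) (τ : ℝ) (ε : ι → Bool) (k : ℕ)
    (c : Quotient (A (k + 1))) : ℝ :=
  |radProc v ε c.out - radProc v ε (blockRep A k c.out)| /
    (τ * dist c.out (blockRep A k c.out) * 2 ^ ((k : ℝ) / 2))

/-- A link divided by its length is a sign sum with coefficients of norm at most one. The
exponential moment at parameter `2 * 2^(k/2)` costs `exp (2 * 2^k)`, and the threshold `3` gains
`exp (-(6 * 2^k))`; the net decay beats the number of blocks. -/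
lemma sum_link_tail_le {A : ℕ → Setoid T} {v : T → ι → ℝ} {τ : ℝ}
    (hv : ∀ ω ω', ∑ i, (v ω i - v ω' i) ^ 2 ≤ (τ * dist ω ω') ^ 2) {s : ℝ} (hs : 0 < s)
    (k : ℕ) (c : Quotient (A (k + 1))) :
    ∑ ε : ι → Bool, (if 3 < link A v τ ε k c then ENNReal.ofReal (link A v τ ε k c) ^ s else 0) ≤
      ENNReal.ofReal (2 * 2 ^ Fintype.card ι * (s ^ s * Real.exp 3)) *
        ENNReal.ofReal (Real.exp (-(4 * 2 ^ k))) := by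
  set o := c.out
  set o' := blockRep A k c.out
  set ℓ := τ * dist o o' with hℓ
  have h2k : (0 : ℝ) < 2 ^ ((k : ℝ) / 2) := by positivity
  have h2k2 : ((2 : ℝ) ^ ((k : ℝ) / 2)) ^ 2 = 2 ^ k := by
    rw [← Real.rpow_natCast, ← Real.rpow_mul (by norm_num)]
    rw [← Real.rpow_natCast]; congr 1; push_cast; ring
  -- The sign of `τ` is not assumed here, hence the absolute value. If `ℓ = 0`, division by zero
  -- makes all coefficients zero, which is harmless.
  set a : ι → ℝ := fun i => (v o i - v o' i) / |ℓ| with ha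
  have ha1 : ∑ i, a i ^ 2 ≤ 1 := by
    simp only [ha, div_pow, sq_abs]
    rw [← Finset.sum_div]
    exact div_le_one_of_le₀ (hv o o') (sq_nonneg _)
  have hlink : ∀ ε, |link A v τ ε k c| = |∑ i, sgn (ε i) * a i| / 2 ^ ((k : ℝ) / 2) := by
    intro ε
    have h1 : radProc v ε o - radProc v ε o' = ∑ i, sgn (ε i) * (v o i - v o' i) := by
      simp [radProc, mul_sub]
    have h2 : ∑ i, sgn (ε i) * a i = (∑ i, sgn (ε i) * (v o i - v o' i)) / |ℓ| := by
      rw [Finset.sum_div]; exact Finset.sum_congr rfl fun i _ => by simp [ha, mul_div_assoc]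
    unfold link
    rw [h2]
    change |(|radProc v ε o - radProc v ε o'|) / (ℓ * _)| = _
    rw [h1, abs_div, abs_div, abs_mul, abs_abs, abs_abs, abs_of_pos h2k, div_div]
  have hterm : ∀ ε, (if 3 < link A v τ ε k c then ENNReal.ofReal (link A v τ ε k c) ^ s else 0) ≤
      ENNReal.ofReal (s ^ s * Real.exp 3 * (Real.exp (2 * 2 ^ ((k : ℝ) / 2) *
        |∑ i, sgn (ε i) * a i|) * Real.exp (-(6 * 2 ^ k)))) := by
    intro ε
    split_ifs with h
    · have h0 : 0 < link A v τ ε k c := by linarith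
      rw [ENNReal.ofReal_rpow_of_pos h0]
      apply ENNReal.ofReal_le_ofReal
      refine (rpow_le_of_three_lt hs h k).trans (le_of_eq ?_)
      congr 3
      have := hlink ε
      rw [abs_of_pos h0] at this
      rw [this, ← h2k2]
      field_simp
    · exact zero_le
  refine (Finset.sum_le_sum fun ε _ => hterm ε).trans ?_
  rw [← ENNReal.ofReal_sum_of_nonneg (fun _ _ => by positivity), ← ENNReal.ofReal_mul
      (by positivity)]
  apply ENNReal.ofReal_le_ofReal
  rw [← Finset.mul_sum, ← Finset.sum_mul]
  have h5 := sum_exp_abs_rademacher_le a ha1 (2 * 2 ^ ((k : ℝ) / 2))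
  have h6 : (2 * (2:ℝ) ^ ((k : ℝ) / 2)) ^ 2 / 2 = 2 * 2 ^ k := by
    rw [mul_pow, h2k2]; ring
  rw [h6] at h5
  have h7 : Real.exp (2 * 2 ^ k) * Real.exp (-(6 * 2 ^ k)) = Real.exp (-(4 * 2 ^ k)) := by
    rw [← Real.exp_add]; congr 1; ring
  calc _ ≤ s ^ s * Real.exp 3 * (2 * 2 ^ Fintype.card ι * Real.exp (2 * 2 ^ k) *
        Real.exp (-(6 * 2 ^ k))) := by gcongr
    _ = _ := by rw [mul_assoc (2 * 2 ^ Fintype.card ι : ℝ), h7]; ring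

/-- The supremum of the normalized increments. -/
noncomputable def linkSup (A : ℕ → Setoid T) (v : T → ι → ℝ) (τ : ℝ) (ε : ι → Bool) : ℝ≥0∞ :=
  ⨆ (k : ℕ) (c : Quotient (A (k + 1))), ENNReal.ofReal (link A v τ ε k c)

/-- Links up to `3` contribute at most `3 ^ s` to the power of the supremum; larger ones are summed
over all levels and blocks, and the exponential tails absorb this. -/
lemma sum_linkSup_rpow_le {A : ℕ → Setoid T} (hA : IsAdmissible A) {v : T → ι → ℝ} {τ : ℝ}
    (hv : ∀ ω ω', ∑ i, (v ω i - v ω' i) ^ 2 ≤ (τ * dist ω ω') ^ 2) {s : ℝ} (hs : 0 < s) :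
    ∑ ε : ι → Bool, linkSup A v τ ε ^ s ≤
      2 ^ Fintype.card ι * ENNReal.ofReal (3 ^ s + 2 * (s ^ s * Real.exp 3)) := by
  set W : (ι → Bool) → (k : ℕ) → Quotient (A (k + 1)) → ℝ≥0∞ := fun ε k c =>
    if 3 < link A v τ ε k c then ENNReal.ofReal (link A v τ ε k c) ^ s else 0 with hW
  have h1 : ∀ ε, linkSup A v τ ε ^ s ≤ ENNReal.ofReal (3 ^ s) + ∑' k, ∑' c, W ε k c := by
    intro ε
    rw [← ENNReal.le_rpow_inv_iff hs]
    refine iSup₂_le fun k c => ?_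
    rw [ENNReal.le_rpow_inv_iff hs]
    by_cases h : 3 < link A v τ ε k c
    · refine le_trans ?_ le_add_self
      refine le_trans ?_ (ENNReal.le_tsum k)
      refine le_trans ?_ (ENNReal.le_tsum c)
      simp [hW, h]
    · refine le_trans ?_ le_self_add
      rw [← ENNReal.ofReal_rpow_of_pos (by norm_num)]
      gcongr
      linarith
  refine (Finset.sum_le_sum fun ε _ => h1 ε).trans ?_
  rw [Finset.sum_add_distrib, ← Summable.tsum_finsetSum (fun _ _ => ENNReal.summable)]
  have h2 : ∀ k : ℕ, ∑ ε : ι → Bool, ∑' c, W ε k c ≤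
      ENNReal.ofReal (2 * 2 ^ Fintype.card ι * (s ^ s * Real.exp 3)) *
       (((2 ^ 2 ^ (k + 1) : ℕ) : ℝ≥0∞) * ENNReal.ofReal (Real.exp (-(4 * 2 ^ k)))) := by
    intro k
    rw [← Summable.tsum_finsetSum (fun _ _ => ENNReal.summable)]
    refine (ENNReal.tsum_le_tsum fun c => sum_link_tail_le hv hs k c).trans ?_
    rw [ENNReal.tsum_const, mul_left_comm]
    gcongr
    have := hA.card_le (k + 1) (by omega)
    have h3 : ((ENat.card (Quotient (A (k + 1))) : ℕ∞) : ℝ≥0∞) ≤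
      (((2 ^ 2 ^ (k + 1) : ℕ) : ℕ∞) : ℝ≥0∞) := by exact_mod_cast this
    simpa using h3
  have h4 : ∑' k, ∑ ε : ι → Bool, ∑' c, W ε k c ≤
      ENNReal.ofReal (2 * 2 ^ Fintype.card ι * (s ^ s * Real.exp 3)) := by
    refine (ENNReal.tsum_le_tsum h2).trans ?_
    rw [ENNReal.tsum_mul_left]
    exact mul_le_of_le_one_right' tsum_card_mul_exp_le
  refine (add_le_add_right h4 _).trans (le_of_eq ?_)
  rw [Finset.sum_const, Finset.card_univ, Fintype.card_fun, Fintype.card_bool, nsmul_eq_mul]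
  have e2 : ((2 : ℝ≥0∞) ^ Fintype.card ι) = ENNReal.ofReal (2 ^ Fintype.card ι) := by
    rw [ENNReal.ofReal_pow (by norm_num)]; norm_num
  push_cast
  rw [e2, ← ENNReal.ofReal_mul (by positivity), ← ENNReal.ofReal_add (by positivity)
      (by positivity),
    ← ENNReal.ofReal_mul (by positivity)]
  congr 1; ring

omit [DecidableEq ι] in
-- Telescope along the representatives of the blocks of `ω`. The `k`-th increment is at most
-- `linkSup` times `τ 2^(k/2) diam (A k)`, and the remainder after `K` steps vanishes because the
-- diameters are summable.
lemma radProc_sub_blockRep_le {A : ℕ → Setoid T} (hA : IsAdmissible A) {v : T → ι → ℝ} {τ G : ℝ}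
    (hτ : 0 ≤ τ) (hv : ∀ ω ω', ∑ i, (v ω i - v ω' i) ^ 2 ≤ (τ * dist ω ω') ^ 2) (ε : ι → Bool)
    {ω : T} (hG : ∑' k : ℕ, (2 : ℝ≥0∞) ^ ((k : ℝ) / 2) * Metric.ediam {ω' : T | (A k) ω' ω} ≤
      ENNReal.ofReal G) :
    ENNReal.ofReal |radProc v ε ω - radProc v ε (blockRep A 0 ω)| ≤
      linkSup A v τ ε * (ENNReal.ofReal τ * ENNReal.ofReal G) := by
  set D : ℕ → ℝ≥0∞ := fun k => Metric.ediam {ω' : T | (A k) ω' ω} with hD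
  have hstep : ∀ k : ℕ, ENNReal.ofReal |radProc v ε (blockRep A (k + 1) ω) -
      radProc v ε (blockRep A k ω)| ≤
      linkSup A v τ ε * (ENNReal.ofReal τ * ((2 : ℝ≥0∞) ^ ((k : ℝ) / 2) * D k)) := by
    intro k
    set c : Quotient (A (k + 1)) := Quotient.mk _ ω with hc
    have hco : c.out = blockRep A (k + 1) ω := rfl
    have hrel : (A k) (blockRep A (k + 1) ω) ω := hA.refines k (blockRep_rel A (k + 1) ω)
    have hco' : blockRep A k c.out = blockRep A k ω := by
      rw [hco]; exact blockRep_congr A k hrel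
    set ℓ := dist (blockRep A (k + 1) ω) (blockRep A k ω) with hℓ
    have hℓD : ENNReal.ofReal ℓ ≤ D k := by
      rw [hℓ, ← edist_dist]
      exact Metric.edist_le_ediam_of_mem hrel (blockRep_rel A k ω)
    have h1 : |radProc v ε (blockRep A (k + 1) ω) - radProc v ε (blockRep A k ω)| ≤
        link A v τ ε k c * (τ * (2 ^ ((k : ℝ) / 2) * ℓ)) := by
      unfold link
      rw [hco', hco, ← hℓ]
      by_cases h0 : τ * ℓ = 0
      -- For a link of length zero the quotient `link` is `0` by convention, so the increment itself
      -- has to vanish.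
      · have := radProc_sub_abs_le hτ hv ε (blockRep A (k + 1) ω) (blockRep A k ω)
        rw [← hℓ, h0, mul_zero] at this
        refine this.trans (le_of_eq ?_)
        rw [h0]; simp
      · have : (2 : ℝ) ^ ((k : ℝ) / 2) ≠ 0 := by positivity
        refine le_of_eq ?_
        obtain ⟨h0, h0'⟩ := mul_ne_zero_iff.1 h0
        field_simp
    have hl0 : 0 ≤ link A v τ ε k c := by unfold link; positivity
    refine (ENNReal.ofReal_le_ofReal h1).trans ?_
    rw [ENNReal.ofReal_mul hl0, ENNReal.ofReal_mul hτ, ENNReal.ofReal_mul (by positivity),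
      ← ENNReal.ofReal_rpow_of_pos (by norm_num)]
    rw [ENNReal.ofReal_ofNat]
    gcongr
    exact le_iSup₂ (f := fun k c => ENNReal.ofReal (link A v τ ε k c)) k c
  have hK : ∀ K : ℕ, ENNReal.ofReal |radProc v ε ω - radProc v ε (blockRep A 0 ω)| ≤
      linkSup A v τ ε * (ENNReal.ofReal τ * ENNReal.ofReal G) +
        ENNReal.ofReal (Fintype.card ι * τ) * D K := by
    intro K
    have h1 : |radProc v ε ω - radProc v ε (blockRep A 0 ω)| ≤
        ∑ k ∈ Finset.range K, |radProc v ε (blockRep A (k + 1) ω) - radProc v ε (blockRep A k ω)| +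
        |radProc v ε ω - radProc v ε (blockRep A K ω)| := by
      have h2 := Finset.sum_range_sub (fun k => radProc v ε (blockRep A k ω)) K
      have h3 := Finset.abs_sum_le_sum_abs (fun k => radProc v ε (blockRep A (k + 1) ω) -
        radProc v ε (blockRep A k ω)) (Finset.range K)
      rw [h2] at h3
      have h4 := abs_add_le (radProc v ε ω - radProc v ε (blockRep A K ω))
        (radProc v ε (blockRep A K ω) - radProc v ε (blockRep A 0 ω))
      rw [sub_add_sub_cancel] at h4
      linarith
    refine (ENNReal.ofReal_le_ofReal h1).trans ?_
    rw [ENNReal.ofReal_add (by positivity) (by positivity),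
      ENNReal.ofReal_sum_of_nonneg (fun _ _ => by positivity)]
    gcongr
    · refine (Finset.sum_le_sum fun k _ => hstep k).trans ?_
      rw [← Finset.mul_sum, ← Finset.mul_sum]
      gcongr
      exact (ENNReal.sum_le_tsum _).trans hG
    · refine (ENNReal.ofReal_le_ofReal (radProc_sub_abs_le hτ hv ε _ _)).trans ?_
      rw [← mul_assoc, ENNReal.ofReal_mul (by positivity), ← edist_dist]
      gcongr
      exact Metric.edist_le_ediam_of_mem ((A K).refl ω) (blockRep_rel A K ω)
  have hD0 : Filter.Tendsto D Filter.atTop (nhds 0) := by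
    have h1 : ∑' k, D k ≠ ⊤ := by
      refine ne_top_of_le_ne_top ENNReal.ofReal_ne_top
        (le_trans (ENNReal.tsum_le_tsum fun k => ?_) hG)
      refine le_mul_of_one_le_left' ?_
      calc (1 : ℝ≥0∞) = 1 ^ ((k : ℝ) / 2) := (ENNReal.one_rpow _).symm
        _ ≤ 2 ^ ((k : ℝ) / 2) := ENNReal.rpow_le_rpow (by norm_num) (by positivity)
    exact ENNReal.tendsto_atTop_zero_of_tsum_ne_top h1
  have hlim := (ENNReal.Tendsto.const_mul hD0
    (Or.inr (ENNReal.ofReal_ne_top (r := Fintype.card ι * τ)))).const_add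
      (linkSup A v τ ε * (ENNReal.ofReal τ * ENNReal.ofReal G))
  rw [mul_zero, add_zero] at hlim
  exact ge_of_tendsto' hlim hK

/-- Constant of the moment bound for suprema of Rademacher processes. -/
noncomputable def chainConst (s : ℝ) : ℝ := 2 ^ s * (3 ^ s + 2 * (s ^ s * Real.exp 3))

/-- Generic chaining for Rademacher processes, in moment form. -/
theorem sum_iSup_radProc_rpow_le {A : ℕ → Setoid T} (hA : IsAdmissible A) {v : T → ι → ℝ} {τ G : ℝ}
    (hτ : 0 ≤ τ) (hv : ∀ ω ω', ∑ i, (v ω i - v ω' i) ^ 2 ≤ (τ * dist ω ω') ^ 2)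
    (hG0 : 0 ≤ G) (hG : ∀ ω, ∑' k : ℕ, (2 : ℝ≥0∞) ^ ((k : ℝ) / 2) *
      Metric.ediam {ω' : T | (A k) ω' ω} ≤ ENNReal.ofReal G) {s : ℝ} (hs : 0 < s) (o : T) :
    ∑ ε : ι → Bool, (⨆ ω, ENNReal.ofReal |radProc v ε ω - radProc v ε o|) ^ s ≤
      2 ^ Fintype.card ι * ENNReal.ofReal (chainConst s * (τ * G) ^ s) := by
  have h1 : ∀ ε : ι → Bool, (⨆ ω, ENNReal.ofReal |radProc v ε ω - radProc v ε o|) ^ s ≤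
      linkSup A v τ ε ^ s * ENNReal.ofReal ((2 * (τ * G)) ^ s) := by
    intro ε
    rw [← ENNReal.ofReal_rpow_of_nonneg (by positivity) hs.le,
        ← ENNReal.mul_rpow_of_nonneg _ _ hs.le]
    gcongr
    refine iSup_le fun ω => ?_
    have h2 := radProc_sub_blockRep_le hA hτ hv ε (hG ω)
    have h3 := radProc_sub_blockRep_le hA hτ hv ε (hG o)
    -- The zeroth partition has one block, so both chains start at the same point. Using two chains
    -- is what the factor `2 ^ s` in `chainConst` pays for.
    have h4 : blockRep A 0 ω = blockRep A 0 o := blockRep_congr A 0 (by rw [hA.zero]; trivial)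
    rw [h4] at h2
    have h5 : |radProc v ε ω - radProc v ε o| ≤ |radProc v ε ω - radProc v ε (blockRep A 0 o)| +
        |radProc v ε o - radProc v ε (blockRep A 0 o)| := by
      rw [abs_sub_comm (radProc v ε o)]
      exact abs_sub_le _ _ _
    refine (ENNReal.ofReal_le_ofReal h5).trans ?_
    rw [ENNReal.ofReal_add (by positivity) (by positivity)]
    refine (add_le_add h2 h3).trans (le_of_eq ?_)
    rw [ENNReal.ofReal_mul (by norm_num), ENNReal.ofReal_mul hτ]
    rw [ENNReal.ofReal_ofNat]
    ring
  refine (Finset.sum_le_sum fun ε _ => h1 ε).trans ?_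
  rw [← Finset.sum_mul]
  refine (mul_le_mul_left (sum_linkSup_rpow_le hA hv hs) _).trans (le_of_eq ?_)
  rw [mul_assoc, ← ENNReal.ofReal_mul (by positivity), chainConst,
    Real.mul_rpow (by norm_num) (by positivity)]
  congr 2; ring

end Chaining

end Rademacher

/-- Jensen's inequality for powers on a probability space. -/
lemma lintegral_rpow_le_lintegral_rpow {X : Type*} [MeasurableSpace X] (P : Measure X)
    [IsProbabilityMeasure P] {f : X → ℝ≥0∞} (hf : AEMeasurable f P) {r s : ℝ} (hr : 0 < r)
    (hrs : r ≤ s) : (∫⁻ x, f x ^ r ∂P) ^ (1 / r) ≤ (∫⁻ x, f x ^ s ∂P) ^ (1 / s) := by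
  have := eLpNorm'_le_eLpNorm'_of_exponent_le (μ := P) (f := f) hr hrs hf.aestronglyMeasurable
  simpa [eLpNorm'] using this

lemma rpow_lintegral_le {X : Type*} [MeasurableSpace X] (P : Measure X)
    [IsProbabilityMeasure P] {f : X → ℝ≥0∞} (hf : AEMeasurable f P) {s : ℝ} (hs : 1 ≤ s) :
    (∫⁻ x, f x ∂P) ^ s ≤ ∫⁻ x, f x ^ s ∂P := by
  have h := lintegral_rpow_le_lintegral_rpow P hf one_pos hs
  rw [one_div s, ENNReal.le_rpow_inv_iff (by linarith)] at h
  simpa using h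

/-! ### Symmetrization of centered empirical sums. -/

section Swap

variable {ι : Type*} {Ω : Type*}

/-- Exchange the coordinates of two samples where the sign is negative. -/
def swapBy (ε : ι → Bool) (z : (ι → Ω) × (ι → Ω)) : (ι → Ω) × (ι → Ω) :=
  (fun i => if ε i then z.1 i else z.2 i, fun i => if ε i then z.2 i else z.1 i)

/-- Seen as one sample of pairs instead of a pair of samples, the map acts on each coordinate
separately, as the identity or as the swap of a product of two equal laws. -/
lemma measurePreserving_swapBy [Fintype ι] [MeasurableSpace Ω] (P : ι → Measure Ω)
    [∀ i, IsProbabilityMeasure (P i)] (ε : ι → Bool) :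
    MeasurePreserving (swapBy ε) ((Measure.pi P).prod (Measure.pi P))
      ((Measure.pi P).prod (Measure.pi P)) := by
  have h1 := measurePreserving_arrowProdEquivProdArrow Ω Ω ι P P
  have h2 : MeasurePreserving (fun (z : ι → Ω × Ω) i => if ε i then z i else (z i).swap)
      (Measure.pi fun i => (P i).prod (P i)) (Measure.pi fun i => (P i).prod (P i)) := by
    refine measurePreserving_pi _ _ (f := fun i (z : Ω × Ω) => if ε i then z else z.swap)
      fun i => ?_
    cases ε i
    · simpa using Measure.measurePreserving_swap (μ := P i) (ν := P i)
    · simp only [if_true]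
      exact MeasurePreserving.id _
  have h3 := (h1.comp h2).comp (h1.symm _)
  convert! h3 using 1
  funext z
  simp only [swapBy, Function.comp, MeasurableEquiv.arrowProdEquivProdArrow,
    Equiv.arrowProdEquivProdArrow]
  ext i
  · cases h : ε i <;> simp [h, MeasurableEquiv.symm]
  · cases h : ε i <;> simp [h, MeasurableEquiv.symm]

end Swap

section Symmetrization

variable {ι : Type*} [Fintype ι] [DecidableEq ι] {Ω : Type u} [MetricSpace Ω]

/-- Supremum over `B` of the difference of the empirical sums of two samples. -/
noncomputable def pairSup (f : ι → Ω → Ω → ℝ) (B : Set Ω) (z : (ι → Ω) × (ι → Ω)) : ℝ≥0∞ :=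
  ⨆ ω : B, ENNReal.ofReal |∑ i, (f i (z.1 i) ω - f i (z.2 i) ω)|

/-- Supremum over `B` of the centered empirical sum. -/
noncomputable def centeredSup [MeasurableSpace Ω] (P : ι → Measure Ω) (f : ι → Ω → Ω → ℝ)
    (B : Set Ω) (ys : ι → Ω) : ℝ≥0∞ :=
  ⨆ ω : B, ENNReal.ofReal |∑ i, (f i (ys i) ω - ∫ y, f i y ω ∂(P i))|

omit [DecidableEq ι] [MetricSpace Ω] in
lemma pairSup_swapBy (f : ι → Ω → Ω → ℝ) (B : Set Ω) (ε : ι → Bool) (z : (ι → Ω) × (ι → Ω)) :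
    pairSup f B (swapBy ε z) =
      ⨆ ω : B, ENNReal.ofReal |∑ i, sgn (ε i) * (f i (z.1 i) ω - f i (z.2 i) ω)| := by
  unfold pairSup
  refine iSup_congr fun ω => ?_
  congr 2
  refine Finset.sum_congr rfl fun i _ => ?_
  cases h : ε i <;> simp [swapBy, h, sgn]

/-- With both samples fixed, swapping turns the differences into a Rademacher process indexed by
`B`, so chaining applies. Since `f i y o = 0`, the process vanishes at the anchor `o`. -/
lemma sum_pairSup_swapBy_rpow_le {f : ι → Ω → Ω → ℝ} {B : Set Ω} {o : Ω} (ho : o ∈ B)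
    {e : ι → Ω → ℝ}
    (hlip : ∀ i y, ∀ ω ∈ B, ∀ ω' ∈ B, |f i y ω - f i y ω'| ≤ e i y * dist ω ω')
    (hfo : ∀ i y, f i y o = 0) {G : ℝ} (hG0 : 0 ≤ G) (hG : gamma2 B < ENNReal.ofReal G)
    {s : ℝ} (hs : 0 < s) (z : (ι → Ω) × (ι → Ω)) :
    ∑ ε : ι → Bool, pairSup f B (swapBy ε z) ^ s ≤
      2 ^ Fintype.card ι * (ENNReal.ofReal (chainConst s * (2 * G) ^ s) *
        (ENNReal.ofReal (∑ i, e i (z.1 i) ^ 2) ^ (s / 2) +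
          ENNReal.ofReal (∑ i, e i (z.2 i) ^ 2) ^ (s / 2))) := by
  obtain ⟨A, hA⟩ := iInf_lt_iff.1 hG
  obtain ⟨hadm, hA⟩ := iInf_lt_iff.1 hA
  set E₁ := ∑ i, e i (z.1 i) ^ 2 with hE₁
  set E₂ := ∑ i, e i (z.2 i) ^ 2 with hE₂
  have hE₁0 : 0 ≤ E₁ := Finset.sum_nonneg fun _ _ => sq_nonneg _
  have hE₂0 : 0 ≤ E₂ := Finset.sum_nonneg fun _ _ => sq_nonneg _
  -- The Lipschitz constant of the coefficient vector, from `(e + e')² ≤ 2 e² + 2 e'²`.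
  set τ := Real.sqrt (2 * (E₁ + E₂)) with hτ
  set v : B → ι → ℝ := fun ω i => f i (z.1 i) ω - f i (z.2 i) ω with hv
  have hvτ : ∀ ω ω' : B, ∑ i, (v ω i - v ω' i) ^ 2 ≤ (τ * dist ω ω') ^ 2 := by
    intro ω ω'
    rw [mul_pow, hτ, Real.sq_sqrt (by positivity), hE₁, hE₂, ← Finset.sum_add_distrib,
      Finset.mul_sum, Finset.sum_mul]
    refine Finset.sum_le_sum fun i _ => ?_
    have h1 := hlip i (z.1 i) ω ω.2 ω' ω'.2
    have h2 := hlip i (z.2 i) ω ω.2 ω' ω'.2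
    have h3 : |v ω i - v ω' i| ≤ (e i (z.1 i) + e i (z.2 i)) * dist ω ω' := by
      have : v ω i - v ω' i = (f i (z.1 i) ω - f i (z.1 i) ω') -
          (f i (z.2 i) ω - f i (z.2 i) ω') := by
        simp only [hv]; ring
      rw [this, add_mul]
      refine (abs_sub _ _).trans (add_le_add h1 h2)
    calc (v ω i - v ω' i) ^ 2 ≤ ((e i (z.1 i) + e i (z.2 i)) * dist ω ω') ^ 2 := sq_le_sq' (by
          linarith [neg_abs_le (v ω i - v ω' i)]) (by linarith [le_abs_self (v ω i - v ω' i)])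
      _ ≤ _ := by
        rw [mul_pow]
        gcongr
        nlinarith [sq_nonneg (e i (z.1 i) - e i (z.2 i))]
  have hbound : ∀ ω : B, ∑' k : ℕ, (2 : ℝ≥0∞) ^ ((k : ℝ) / 2) *
      Metric.ediam {ω' : B | (A k) ω' ω} ≤ ENNReal.ofReal G :=
    fun ω => (le_iSup (f := fun ω : B => ∑' k : ℕ, (2 : ℝ≥0∞) ^ ((k : ℝ) / 2) *
      Metric.ediam {ω' : B | (A k) ω' ω}) ω).trans hA.le
  have hmain := sum_iSup_radProc_rpow_le hadm (Real.sqrt_nonneg _) hvτ hG0 hbound hs ⟨o, ho⟩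
  have heq : ∀ ε, pairSup f B (swapBy ε z) =
      ⨆ ω, ENNReal.ofReal |radProc v ε ω - radProc v ε ⟨o, ho⟩| := by
    intro ε
    rw [pairSup_swapBy]
    refine iSup_congr fun ω => ?_
    simp [radProc, hv, hfo]
  simp_rw [heq]
  refine hmain.trans ?_
  gcongr
  have hC : 0 ≤ chainConst s := by unfold chainConst; positivity
  rw [ENNReal.ofReal_rpow_of_nonneg hE₁0 (by positivity),
    ENNReal.ofReal_rpow_of_nonneg hE₂0 (by positivity),
    ← ENNReal.ofReal_add (by positivity) (by positivity), ← ENNReal.ofReal_mul (by positivity)]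
  apply ENNReal.ofReal_le_ofReal
  rw [mul_assoc]
  refine mul_le_mul_of_nonneg_left ?_ hC
  -- Passing to the maximum lets the power `s` split into one term for each sample.
  have h5 : τ ≤ 2 * Real.sqrt (max E₁ E₂) := by
    rw [hτ]
    apply Real.sqrt_le_iff.2 ⟨by positivity, ?_⟩
    rw [mul_pow, Real.sq_sqrt (by positivity)]
    linarith [le_max_left E₁ E₂, le_max_right E₁ E₂]
  have h6 : Real.sqrt (max E₁ E₂) ^ s ≤ E₁ ^ (s / 2) + E₂ ^ (s / 2) := by
    rw [Real.sqrt_eq_rpow, ← Real.rpow_mul (by positivity)]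
    have : 1 / 2 * s = s / 2 := by ring
    rw [this]
    rcases max_choice E₁ E₂ with h | h <;> rw [h]
    · linarith [Real.rpow_nonneg hE₂0 (s / 2)]
    · linarith [Real.rpow_nonneg hE₁0 (s / 2)]
  calc (τ * G) ^ s ≤ ((2 * G) * Real.sqrt (max E₁ E₂)) ^ s := by
        apply Real.rpow_le_rpow (by positivity) _ hs.le
        nlinarith
    _ = (2 * G) ^ s * Real.sqrt (max E₁ E₂) ^ s := Real.mul_rpow (by positivity) (by positivity)
    _ ≤ _ := by gcongr

variable [MeasurableSpace Ω]

omit [DecidableEq ι] [MetricSpace Ω] in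
lemma measurable_pairSup {f : ι → Ω → Ω → ℝ} {B : Set Ω} (hB : B.Countable)
    (hfm : ∀ i, ∀ ω ∈ B, Measurable fun y => f i y ω) : Measurable (pairSup f B) := by
  have := hB.to_subtype
  refine Measurable.iSup fun ω => ENNReal.measurable_ofReal.comp (measurable_abs.comp ?_)
  refine Finset.measurable_sum _ fun i _ => ?_
  exact ((hfm i ω ω.2).comp ((measurable_pi_apply i).comp measurable_fst)).sub
    ((hfm i ω ω.2).comp ((measurable_pi_apply i).comp measurable_snd))

omit [DecidableEq ι] [MetricSpace Ω] in
-- The mean is the integral over an independent copy of the sample; the supremum and then the power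
-- move inside that integral, the latter by Jensen.
lemma centeredSup_rpow_le {P : ι → Measure Ω} [∀ i, IsProbabilityMeasure (P i)]
    {f : ι → Ω → Ω → ℝ} {B : Set Ω} (hB : B.Countable)
    (hfm : ∀ i, ∀ ω ∈ B, Measurable fun y => f i y ω)
    (hfi : ∀ i, ∀ ω ∈ B, Integrable (fun y => f i y ω) (P i)) {s : ℝ} (hs : 1 ≤ s) (ys : ι → Ω) :
    centeredSup P f B ys ^ s ≤ ∫⁻ ys', pairSup f B (ys, ys') ^ s ∂(Measure.pi P) := by
  have hm : Measurable fun ys' => pairSup f B (ys, ys') :=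
    (measurable_pairSup hB hfm).comp measurable_prodMk_left
  refine le_trans ?_ (rpow_lintegral_le (Measure.pi P) hm.aemeasurable hs)
  refine ENNReal.rpow_le_rpow ?_ (by linarith)
  refine iSup_le fun ω => ?_
  have hint : ∀ i, Integrable (fun ys' : ι → Ω => f i (ys' i) ω) (Measure.pi P) := fun i =>
    integrable_comp_eval (μ := P) (i := i) (f := fun y => f i y ω) (hfi i ω ω.2)
  have h1 : ∑ i, (f i (ys i) ω - ∫ y, f i y ω ∂(P i)) =
      ∫ ys', ∑ i, (f i (ys i) ω - f i (ys' i) ω) ∂(Measure.pi P) := by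
    rw [integral_finsetSum (f := fun i (ys' : ι → Ω) => f i (ys i) ω - f i (ys' i) ω) Finset.univ
      fun i _ => (integrable_const _).sub (hint i)]
    refine Finset.sum_congr rfl fun i _ => ?_
    rw [integral_sub (integrable_const _) (hint i)]
    rw [integral_comp_eval (μ := P) (i := i) (f := fun y => f i y ω)
        (hfi i ω ω.2).aestronglyMeasurable]
    simp
  rw [h1, ← Real.norm_eq_abs, ofReal_norm]
  refine (enorm_integral_le_lintegral_enorm _).trans (lintegral_mono fun ys' => ?_)
  rw [← ofReal_norm, Real.norm_eq_abs]
  exact le_iSup (f := fun ω : B => ENNReal.ofReal |∑ i, (f i (ys i) ω - f i (ys' i) ω)|) ω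

/-- Moment bound for the supremum of a centered empirical process over a countable set. -/
theorem lintegral_centeredSup_rpow_le {P : ι → Measure Ω} [∀ i, IsProbabilityMeasure (P i)]
    {f : ι → Ω → Ω → ℝ} {B : Set Ω} (hB : B.Countable) {o : Ω} (ho : o ∈ B)
    (hfm : ∀ i, ∀ ω ∈ B, Measurable fun y => f i y ω)
    (hfi : ∀ i, ∀ ω ∈ B, Integrable (fun y => f i y ω) (P i))
    {e : ι → Ω → ℝ} (hem : ∀ i, Measurable (e i))
    (hlip : ∀ i y, ∀ ω ∈ B, ∀ ω' ∈ B, |f i y ω - f i y ω'| ≤ e i y * dist ω ω')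
    (hfo : ∀ i y, f i y o = 0) {G : ℝ} (hG0 : 0 ≤ G) (hG : gamma2 B < ENNReal.ofReal G)
    {s : ℝ} (hs : 1 ≤ s) :
    ∫⁻ ys, centeredSup P f B ys ^ s ∂(Measure.pi P) ≤
      ENNReal.ofReal (2 * (chainConst s * (2 * G) ^ s)) *
        ∫⁻ ys, ENNReal.ofReal (∑ i, e i (ys i) ^ 2) ^ (s / 2) ∂(Measure.pi P) := by
  have hs0 : 0 < s := by linarith
  set Q := Measure.pi P with hQ
  set C := ENNReal.ofReal (chainConst s * (2 * G) ^ s) with hC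
  set g : (ι → Ω) → ℝ≥0∞ := fun ys => ENNReal.ofReal (∑ i, e i (ys i) ^ 2) ^ (s / 2) with hg
  have hgm : Measurable g := by
    refine Measurable.pow_const (ENNReal.measurable_ofReal.comp ?_) _
    exact Finset.measurable_sum _ fun i _ => ((hem i).comp (measurable_pi_apply i)).pow_const 2
  have hSm : Measurable fun z => pairSup f B z ^ s := (measurable_pairSup hB hfm).pow_const s
  have h1 : ∫⁻ ys, centeredSup P f B ys ^ s ∂Q ≤ ∫⁻ z, pairSup f B z ^ s ∂(Q.prod Q) := by
    rw [lintegral_prod _ hSm.aemeasurable]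
    exact lintegral_mono fun ys => centeredSup_rpow_le hB hfm hfi hs ys
  -- Every swap preserves the law, so `2 ^ card ι` copies of the integral equal the sum over all
  -- sign patterns, which is bounded for each pair of samples.
  have h2 : (2 : ℝ≥0∞) ^ Fintype.card ι * ∫⁻ z, pairSup f B z ^ s ∂(Q.prod Q) ≤
      2 ^ Fintype.card ι * (C * (2 * ∫⁻ ys, g ys ∂Q)) := by
    have h3 : ∀ ε : ι → Bool, ∫⁻ z, pairSup f B z ^ s ∂(Q.prod Q) =
        ∫⁻ z, pairSup f B (swapBy ε z) ^ s ∂(Q.prod Q) := fun ε =>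
      ((measurePreserving_swapBy P ε).lintegral_comp hSm).symm
    calc _ = ∑ ε : ι → Bool, ∫⁻ z, pairSup f B (swapBy ε z) ^ s ∂(Q.prod Q) := by
          rw [← Finset.sum_congr rfl fun ε _ => h3 ε]
          simp [Finset.card_univ]
      _ = ∫⁻ z, ∑ ε : ι → Bool, pairSup f B (swapBy ε z) ^ s ∂(Q.prod Q) := by
          rw [lintegral_finsetSum]
          exact fun ε _ => hSm.comp (measurePreserving_swapBy P ε).measurable
      _ ≤ ∫⁻ z, 2 ^ Fintype.card ι * (C * (g z.1 + g z.2)) ∂(Q.prod Q) :=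
          lintegral_mono fun z => sum_pairSup_swapBy_rpow_le ho hlip hfo hG0 hG hs0 z
      _ = _ := by
          rw [lintegral_const_mul _ (by fun_prop), lintegral_const_mul _ (by fun_prop),
            lintegral_add_left (by fun_prop)]
          congr 2
          have e1 : ∫⁻ z, g z.1 ∂(Q.prod Q) = ∫⁻ ys, g ys ∂Q :=
            (measurePreserving_fst (μ := Q) (ν := Q)).lintegral_comp hgm
          have e2 : ∫⁻ z, g z.2 ∂(Q.prod Q) = ∫⁻ ys, g ys ∂Q :=
            (measurePreserving_snd (μ := Q) (ν := Q)).lintegral_comp hgm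
          rw [e1, e2, two_mul]
  refine h1.trans ?_
  have h4 := (ENNReal.mul_le_mul_iff_right (a := (2 : ℝ≥0∞) ^ Fintype.card ι) (by simp)
    (by simp)).1 h2
  refine h4.trans (le_of_eq ?_)
  rw [ENNReal.ofReal_mul (by norm_num), ENNReal.ofReal_ofNat]
  ring

end Symmetrization

/-! ### Moments of the distance under one response law. -/

section SingleMeasure

variable {Ω : Type u} [MetricSpace Ω] [MeasurableSpace Ω] [BorelSpace Ω]
  {P : Measure Ω} [IsProbabilityMeasure P] {a : Ω} {κ r D : ℝ}

lemma lintegral_edist_rpow_le (h : (∫⁻ y, edist y a ^ κ ∂P) ^ (1 / κ) ≤ ENNReal.ofReal D)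
    (hr : 0 < r) (hrκ : r ≤ κ) : ∫⁻ y, edist y a ^ r ∂P ≤ ENNReal.ofReal D ^ r := by
  have h1 := (lintegral_rpow_le_lintegral_rpow P (f := fun y => edist y a)
    (by fun_prop) hr hrκ).trans h
  rwa [one_div, ENNReal.rpow_inv_le_iff hr] at h1

lemma lintegral_edist_sq_le (h : (∫⁻ y, edist y a ^ κ ∂P) ^ (1 / κ) ≤ ENNReal.ofReal D)
    (hκ : 2 ≤ κ) : ∫⁻ y, edist y a ^ 2 ∂P ≤ ENNReal.ofReal D ^ 2 := by
  have := lintegral_edist_rpow_le h two_pos hκ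
  simpa using this

lemma memLp_dist (h : ∫⁻ y, edist y a ^ 2 ∂P < ⊤) (ω : Ω) :
    MemLp (fun y => dist y ω) 2 P := by
  have h1 : MemLp (fun y => dist y a) 2 P := by
    refine ⟨(by fun_prop : Measurable fun y => dist y a).aestronglyMeasurable, ?_⟩
    rw [eLpNorm_lt_top_iff_lintegral_rpow_enorm_lt_top (by norm_num) (by norm_num)]
    convert! h using 3 with y
    rw [← ofReal_norm, Real.norm_of_nonneg dist_nonneg, ← edist_dist]
    simp
  refine (h1.add (memLp_const (dist a ω))).mono
    (by fun_prop : Measurable fun y => dist y ω).aestronglyMeasurable (ae_of_all _ fun y => ?_)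
  simp only [Pi.add_apply, Real.norm_eq_abs]
  rw [abs_of_nonneg dist_nonneg, abs_of_nonneg (by positivity)]
  exact dist_triangle _ _ _

lemma integrable_dist_sq (h : ∫⁻ y, edist y a ^ 2 ∂P < ⊤) (ω : Ω) :
    Integrable (fun y => dist y ω ^ 2) P :=
  (memLp_dist h ω).integrable_sq

/-- Dominated convergence with the bound `(dist y ω₀ + 1)²`. Continuity later carries bounds from a
countable set to its closure. -/
lemma continuous_integral_dist_sq (h : ∫⁻ y, edist y a ^ 2 ∂P < ⊤) :
    Continuous fun ω => ∫ y, dist y ω ^ 2 ∂P := by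
  rw [continuous_iff_continuousAt]
  intro ω₀
  refine continuousAt_of_dominated (bound := fun y => (dist y ω₀ + 1) ^ 2)
    (Filter.Eventually.of_forall fun ω => (by fun_prop : Measurable fun y => dist y ω ^ 2).aestronglyMeasurable) ?_ ?_ ?_
  · filter_upwards [Metric.ball_mem_nhds ω₀ one_pos] with ω hω
    refine ae_of_all _ fun y => ?_
    rw [Real.norm_of_nonneg (by positivity)]
    rw [Metric.mem_ball'] at hω
    have := dist_triangle y ω₀ ω
    gcongr
    linarith
  · exact ((memLp_dist h ω₀).add (memLp_const (1:ℝ))).integrable_sq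
  · exact ae_of_all _ fun y => by fun_prop

omit [MeasurableSpace Ω] [BorelSpace Ω] in
lemma abs_dist_sq_sub_le (y ω ω' : Ω) :
    |dist y ω ^ 2 - dist y ω' ^ 2| ≤ dist ω ω' * (dist y ω + dist y ω') := by
  have h1 : dist y ω ^ 2 - dist y ω' ^ 2 = (dist y ω - dist y ω') * (dist y ω + dist y ω') :=
      by ring
  rw [h1, abs_mul, abs_of_nonneg (by positivity : 0 ≤ dist y ω + dist y ω')]
  gcongr
  rw [dist_comm y, dist_comm y]
  exact abs_dist_sub_le _ _ _

end SingleMeasure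

/-! ### Crude bounds for minimizers of a weighted criterion. -/

section Weighted

variable {ι : Type*} [Fintype ι] {Ω : Type u} [MetricSpace Ω]

/-- Square `|R - d(y i, m)| ≤ d(y i, ω)` and average: with the comparison of the criteria, the
squared distances to `m` cancel and `R² ≤ 2 R ∑ w i d(y i, m)` remains. -/
lemma dist_le_of_criterion_le {w : ι → ℝ} (hw : ∀ i, 0 ≤ w i) (hw1 : ∑ i, w i = 1) {ys : ι → Ω}
    {ω m : Ω} (h : ∑ i, w i * dist (ys i) ω ^ 2 ≤ ∑ i, w i * dist (ys i) m ^ 2) :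
    dist ω m ≤ 2 * ∑ i, w i * dist (ys i) m := by
  set R := dist ω m with hR
  have h1 : ∀ i, w i * R ^ 2 - 2 * R * (w i * dist (ys i) m) + w i * dist (ys i) m ^ 2 ≤
      w i * dist (ys i) ω ^ 2 := by
    intro i
    have h2 : |R - dist (ys i) m| ≤ dist (ys i) ω := by
      rw [abs_le]
      constructor
      · linarith [dist_triangle (ys i) ω m]
      · have := dist_triangle ω (ys i) m
        rw [dist_comm ω (ys i)] at this
        linarith
    have h3 : (R - dist (ys i) m) ^ 2 ≤ dist (ys i) ω ^ 2 := by
      rw [← sq_abs]; gcongr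
    nlinarith [mul_le_mul_of_nonneg_left h3 (hw i)]
  have h4 := Finset.sum_le_sum fun i (_ : i ∈ Finset.univ) => h1 i
  rw [Finset.sum_add_distrib, Finset.sum_sub_distrib, ← Finset.sum_mul, ← Finset.mul_sum, hw1] at h4
  have h5 : R * R ≤ R * (2 * ∑ i, w i * dist (ys i) m) := by nlinarith
  have h6 : 0 ≤ ∑ i, w i * dist (ys i) m :=
    Finset.sum_nonneg fun i _ => mul_nonneg (hw i) dist_nonneg
  rcases (dist_nonneg : 0 ≤ dist ω m).eq_or_lt with h0 | h0
  · rw [hR, ← h0]; linarith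
  · exact le_of_mul_le_mul_left h5 h0

variable [MeasurableSpace Ω]

/-- Responses with laws `P i`, Fréchet means `mi i` and moments of order `κ` at most `Mom`, together
with weights `w`; the means are at distance at most `b` from `m` in the weighted quadratic mean. -/
structure WeightedSample (P : ι → Measure Ω) (w : ι → ℝ) (m : Ω) (mi : ι → Ω) (κ Mom b : ℝ) :
    Prop where
  two_lt : 2 < κ
  w_nonneg : ∀ i, 0 ≤ w i
  w_sum : ∑ i, w i = 1
  one_le_Mom : 1 ≤ Mom
  b_nonneg : 0 ≤ b
  prob : ∀ i, IsProbabilityMeasure (P i)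
  mom : ∀ i, (∫⁻ y, edist y (mi i) ^ κ ∂(P i)) ^ (1 / κ) ≤ ENNReal.ofReal Mom
  sum_w : ∑ i, w i * dist (mi i) m ^ 2 ≤ b ^ 2
  sum_w_sq : ∑ i, w i ^ 2 * dist (mi i) m ^ 2 ≤ b ^ 2 * ∑ i, w i ^ 2

namespace WeightedSample

variable [BorelSpace Ω] {P : ι → Measure Ω} {w : ι → ℝ} {m : Ω} {mi : ι → Ω} {κ Mom b : ℝ}

lemma sq_moment_lt_top (h : WeightedSample P w m mi κ Mom b) (i : ι) :
    ∫⁻ y, edist y (mi i) ^ 2 ∂(P i) < ⊤ := by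
  have := h.prob i
  exact (lintegral_edist_sq_le (h.mom i) h.two_lt.le).trans_lt (by finiteness)

omit [BorelSpace Ω] in
lemma sum_w_dist_le (h : WeightedSample P w m mi κ Mom b) : ∑ i, w i * dist (mi i) m ≤ b := by
  have h1 : (∑ i, w i * dist (mi i) m) ^ 2 ≤ ∑ i, w i * dist (mi i) m ^ 2 := by
    exact (convexOn_pow 2).map_sum_le (t := Finset.univ) (w := w) (p := fun i => dist (mi i) m)
      (fun i _ => h.w_nonneg i) h.w_sum (fun i _ => dist_nonneg)
  exact abs_le_of_sq_le_sq' (h1.trans h.sum_w) h.b_nonneg |>.2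

/-- Crude bound for the mean squared error of a minimizer. -/
lemma lintegral_sq_le (h : WeightedSample P w m mi κ Mom b) {F : (ι → Ω) → Ω}
    (hF : ∀ᵐ ys ∂(Measure.pi P),
      ∑ i, w i * dist (ys i) (F ys) ^ 2 ≤ ∑ i, w i * dist (ys i) m ^ 2) :
    ∫⁻ ys, edist (F ys) m ^ 2 ∂(Measure.pi P) ≤ ENNReal.ofReal (8 * Mom ^ 2 + 8 * b ^ 2) := by
  have hprob := h.prob
  have hMom := h.one_le_Mom
  have hpt : ∀ᵐ ys ∂(Measure.pi P), edist (F ys) m ^ 2 ≤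
      (∑ i, ENNReal.ofReal (8 * w i) * edist (ys i) (mi i) ^ 2) + ENNReal.ofReal (8 * b ^ 2) := by
    filter_upwards [hF] with ys hys
    have h1 := dist_le_of_criterion_le h.w_nonneg h.w_sum hys
    have h2 : (∑ i, w i * dist (ys i) m) ^ 2 ≤ ∑ i, w i * dist (ys i) m ^ 2 :=
      (convexOn_pow 2).map_sum_le (t := Finset.univ) (w := w) (p := fun i => dist (ys i) m)
        (fun i _ => h.w_nonneg i) h.w_sum (fun i _ => dist_nonneg)
    have h3 : ∑ i, w i * dist (ys i) m ^ 2 ≤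
        ∑ i, (2 * (w i * dist (ys i) (mi i) ^ 2) + 2 * (w i * dist (mi i) m ^ 2)) := by
      refine Finset.sum_le_sum fun i _ => ?_
      have h4 := dist_triangle (ys i) (mi i) m
      have h5 : dist (ys i) m ^ 2 ≤ 2 * dist (ys i) (mi i) ^ 2 + 2 * dist (mi i) m ^ 2 := by
        have : dist (ys i) m ^ 2 ≤ (dist (ys i) (mi i) + dist (mi i) m) ^ 2 := by gcongr
        nlinarith [sq_nonneg (dist (ys i) (mi i) - dist (mi i) m)]
      nlinarith [mul_le_mul_of_nonneg_left h5 (h.w_nonneg i)]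
    rw [Finset.sum_add_distrib, ← Finset.mul_sum, ← Finset.mul_sum] at h3
    have h6 : dist (F ys) m ^ 2 ≤ (∑ i, 8 * w i * dist (ys i) (mi i) ^ 2) + 8 * b ^ 2 := by
      have h7 : dist (F ys) m ^ 2 ≤ (2 * ∑ i, w i * dist (ys i) m) ^ 2 := by gcongr
      have h8 : ∑ i, 8 * w i * dist (ys i) (mi i) ^ 2 = 8 * ∑ i, w i * dist (ys i) (mi i) ^ 2 := by
        rw [Finset.mul_sum]; exact Finset.sum_congr rfl fun i _ => by ring
      have := h.sum_w
      nlinarith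
    rw [edist_dist, ← ENNReal.ofReal_pow dist_nonneg]
    refine (ENNReal.ofReal_le_ofReal h6).trans ?_
    have hw := h.w_nonneg
    rw [ENNReal.ofReal_add (Finset.sum_nonneg fun i _ => mul_nonneg (by linarith [hw i])
        (sq_nonneg _))
      (by positivity),
      ENNReal.ofReal_sum_of_nonneg fun i _ => mul_nonneg (by linarith [hw i]) (sq_nonneg _)]
    gcongr with i
    rw [ENNReal.ofReal_mul (by linarith [hw i]), edist_dist, ENNReal.ofReal_pow dist_nonneg]
  refine (lintegral_mono_ae hpt).trans ?_
  rw [lintegral_add_right _ measurable_const, lintegral_const, measure_univ, mul_one,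
    lintegral_finsetSum _ fun i _ => by fun_prop]
  have h9 : ∀ i, ∫⁻ ys, ENNReal.ofReal (8 * w i) * edist (ys i) (mi i) ^ 2 ∂(Measure.pi P) ≤
      ENNReal.ofReal (8 * w i * Mom ^ 2) := by
    intro i
    rw [lintegral_const_mul _ (by fun_prop)]
    rw [ENNReal.ofReal_mul (p := 8 * w i) (by linarith [h.w_nonneg i]),
      ENNReal.ofReal_pow (by linarith)]
    gcongr
    rw [(measurePreserving_eval P i).lintegral_comp (f := fun y => edist y (mi i) ^ 2)
        (by fun_prop)]
    exact lintegral_edist_sq_le (h.mom i) h.two_lt.le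
  rw [ENNReal.ofReal_add (by positivity) (by positivity)]
  gcongr
  refine (Finset.sum_le_sum fun i _ => h9 i).trans ?_
  rw [← ENNReal.ofReal_sum_of_nonneg fun i _ => mul_nonneg (by linarith [h.w_nonneg i])
      (sq_nonneg _)]
  apply le_of_eq
  congr 1
  rw [← Finset.sum_mul, ← Finset.mul_sum, h.w_sum, mul_one]

/-- The weighted sum of the centered distances to the Fréchet means. -/
noncomputable def centeredDist (P : ι → Measure Ω) (w : ι → ℝ) (mi : ι → Ω) (ys : ι → Ω) : ℝ :=
  ∑ i, w i * dist (ys i) (mi i) - ∑ i, w i * ∫ y, dist y (mi i) ∂(P i)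

lemma measurable_centeredDist : Measurable (centeredDist P w mi) := by
  unfold centeredDist
  fun_prop

lemma integral_dist_le (h : WeightedSample P w m mi κ Mom b) (i : ι) :
    ∫ y, dist y (mi i) ∂(P i) ≤ Mom := by
  have := h.prob i
  have h1 := lintegral_edist_rpow_le (h.mom i) one_pos (by linarith [h.two_lt])
  simp only [ENNReal.rpow_one] at h1
  rw [integral_eq_lintegral_of_nonneg_ae (ae_of_all _ fun y => dist_nonneg)
    (by fun_prop : Measurable fun y => dist y (mi i)).aestronglyMeasurable]
  refine ENNReal.toReal_le_of_le_ofReal (by linarith [h.one_le_Mom]) ?_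
  simpa [edist_dist] using h1

/-- The integral is the variance of a sum of independent terms, the `i`-th of variance at most `w i
^ 2 * Mom ^ 2`. -/
lemma lintegral_centeredDist_sq_le (h : WeightedSample P w m mi κ Mom b) :
    ∫⁻ ys, ENNReal.ofReal (centeredDist P w mi ys ^ 2) ∂(Measure.pi P) ≤
      ENNReal.ofReal (Mom ^ 2 * ∑ i, w i ^ 2) := by
  have hprob := h.prob
  have hL : ∀ i, MemLp (fun y => w i * dist y (mi i)) 2 (P i) := fun i =>
    (memLp_dist (h.sq_moment_lt_top i) (mi i)).const_mul (w i)
  have hv := variance_sum_pi (μ := P) (X := fun i y => w i * dist y (mi i)) hL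
  have hS : MemLp (∑ i, fun ys : ι → Ω => w i * dist (ys i) (mi i)) 2 (Measure.pi P) :=
    memLp_finsetSum' _ fun i _ => (hL i).comp_measurePreserving (measurePreserving_eval P i)
  have hE : (Measure.pi P)[∑ i, fun ys : ι → Ω => w i * dist (ys i) (mi i)] =
      ∑ i, w i * ∫ y, dist y (mi i) ∂(P i) := by
    simp only [Finset.sum_apply]
    rw [integral_finsetSum (f := fun i (ys : ι → Ω) => w i * dist (ys i) (mi i)) Finset.univ
      fun i _ => ((hL i).comp_measurePreserving
      (measurePreserving_eval P i)).integrable (by norm_num)]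
    refine Finset.sum_congr rfl fun i _ => ?_
    rw [integral_comp_eval (μ := P) (i := i) (f := fun y => w i * dist y (mi i))
      (hL i).aestronglyMeasurable, integral_const_mul]
  have h1 := evariance_eq_lintegral_ofReal (∑ i, fun ys : ι → Ω => w i * dist (ys i) (mi i))
      (Measure.pi P)
  rw [← hS.ofReal_variance_eq, hv, hE] at h1
  simp only [Finset.sum_apply] at h1
  unfold centeredDist
  rw [← h1]
  apply ENNReal.ofReal_le_ofReal
  rw [Finset.mul_sum]
  refine Finset.sum_le_sum fun i _ => ?_
  refine (variance_le_expectation_sq (hL i).aestronglyMeasurable).trans ?_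
  simp only [Pi.pow_apply, mul_pow]
  rw [integral_const_mul, mul_comm]
  gcongr
  rw [integral_eq_lintegral_of_nonneg_ae (ae_of_all _ fun y => by positivity)
    (by fun_prop : Measurable fun y => dist y (mi i) ^ 2).aestronglyMeasurable]
  refine ENNReal.toReal_le_of_le_ofReal (by positivity) ?_
  have h2 := lintegral_edist_sq_le (h.mom i) h.two_lt.le
  rw [← ENNReal.ofReal_pow (by linarith [h.one_le_Mom])] at h2
  refine le_trans (le_of_eq ?_) h2
  refine lintegral_congr fun y => ?_
  rw [edist_dist, ENNReal.ofReal_pow dist_nonneg]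

/-- A minimizer that is far from `m` is controlled by `centeredDist`. -/
lemma dist_le_centeredDist (h : WeightedSample P w m mi κ Mom b) (hb : b ≤ Mom) {ys : ι → Ω} {ω : Ω}
    (hω : ∑ i, w i * dist (ys i) ω ^ 2 ≤ ∑ i, w i * dist (ys i) m ^ 2) (hfar : 8 * Mom ≤ dist ω m) :
    dist ω m ^ 2 ≤ 16 * centeredDist P w mi ys ^ 2 := by
  have h1 := dist_le_of_criterion_le h.w_nonneg h.w_sum hω
  have h2 : ∑ i, w i * dist (ys i) m ≤ ∑ i, (w i * dist (ys i) (mi i) + w i * dist (mi i) m) := by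
    refine Finset.sum_le_sum fun i _ => ?_
    nlinarith [mul_le_mul_of_nonneg_left (dist_triangle (ys i) (mi i) m) (h.w_nonneg i)]
  have h3 : ∑ i, w i * ∫ y, dist y (mi i) ∂(P i) ≤ Mom := by
    calc _ ≤ ∑ i, w i * Mom := Finset.sum_le_sum fun i _ =>
          mul_le_mul_of_nonneg_left (h.integral_dist_le i) (h.w_nonneg i)
      _ = Mom := by rw [← Finset.sum_mul, h.w_sum, one_mul]
  rw [Finset.sum_add_distrib] at h2
  have h4 := h.sum_w_dist_le
  -- The means and `b` contribute at most `4 * Mom` to the bound for the distance, and `4 * Mom` is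
  -- at most half that distance by `hfar`.
  have h5 : dist ω m ≤ 4 * centeredDist P w mi ys := by
    unfold centeredDist; linarith
  calc dist ω m ^ 2 ≤ (4 * centeredDist P w mi ys) ^ 2 := by gcongr
    _ = _ := by ring

end WeightedSample

end Weighted

/-! ### Large deviations of the criterion on a ball around `m`. -/

section Deviation

variable {ι : Type*} [Fintype ι] [DecidableEq ι] {Ω : Type u} [MetricSpace Ω]

/-- Contribution of a response to the centered criterion. -/
noncomputable def devTerm (w : ι → ℝ) (m : Ω) (i : ι) (y ω : Ω) : ℝ :=
  w i * (dist y ω ^ 2 - dist y m ^ 2)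

/-- The centered increment of the empirical criterion between `m` and `ω`. -/
noncomputable def deviation [MeasurableSpace Ω] (P : ι → Measure Ω) (w : ι → ℝ) (m : Ω)
    (ys : ι → Ω) (ω : Ω) : ℝ :=
  ∑ i, (devTerm w m i (ys i) ω - ∫ y, devTerm w m i y ω ∂(P i))

omit [Fintype ι] [DecidableEq ι] in
-- The difference of squares factors, and both distances from `y` are at most `dist y m + r`. This
-- is the Lipschitz envelope used for chaining.
lemma abs_devTerm_sub_le {w : ι → ℝ} (hw : ∀ i, 0 ≤ w i) {m : Ω} {r : ℝ} {B : Set Ω}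
    (hB : B ⊆ Metric.ball m r) (i : ι) (y : Ω) :
    ∀ ω ∈ B, ∀ ω' ∈ B, |devTerm w m i y ω - devTerm w m i y ω'| ≤
      (2 * (w i * (dist y m + r))) * dist ω ω' := by
  intro ω hω ω' hω'
  have h1 : devTerm w m i y ω - devTerm w m i y ω' = w i * (dist y ω ^ 2 - dist y ω' ^ 2) := by
    unfold devTerm; ring
  rw [h1, abs_mul, abs_of_nonneg (hw i)]
  have h2 := abs_dist_sq_sub_le y ω ω'
  have h3 := Metric.mem_ball'.1 (hB hω)
  have h4 := Metric.mem_ball'.1 (hB hω')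
  have h5 : dist y ω + dist y ω' ≤ 2 * (dist y m + r) := by
    linarith [dist_triangle y m ω, dist_triangle y m ω']
  calc w i * |dist y ω ^ 2 - dist y ω' ^ 2| ≤ w i * (dist ω ω' * (2 * (dist y m + r))) := by
        refine mul_le_mul_of_nonneg_left (h2.trans ?_) (hw i)
        gcongr
    _ = _ := by ring

/-- Countability makes suprema measurable; `m` is inserted as the anchor at which `devTerm`
vanishes. -/
lemma exists_countable_dense_ball [SecondCountableTopology Ω] (m : Ω) {r : ℝ} (hr : 0 < r) :
    ∃ B : Set Ω, B.Countable ∧ m ∈ B ∧ B ⊆ Metric.ball m r ∧ Metric.ball m r ⊆ closure B := by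
  obtain ⟨D, hD, hDd⟩ := TopologicalSpace.exists_countable_dense Ω
  refine ⟨insert m (D ∩ Metric.ball m r), (hD.mono Set.inter_subset_left).insert m,
    Set.mem_insert _ _, Set.insert_subset (Metric.mem_ball_self hr) Set.inter_subset_right, ?_⟩
  refine (hDd.open_subset_closure_inter Metric.isOpen_ball).trans (closure_mono ?_)
  rw [Set.inter_comm]
  exact Set.subset_insert _ _

lemma gamma2_lt_of_subset_ball {α Ent : ℝ} (hα : 1 ≤ α) (hα' : α ≤ 2) (hEnt : 1 ≤ Ent)
    (hE : ∀ B : Set Ω, gamma2 B ≤ ENNReal.ofReal Ent * max (Metric.ediam B) (Metric.ediam B ^ α))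
    {m : Ω} {δ : ℝ} (hδ : 0 < δ) {B : Set Ω} (hB : B ⊆ Metric.ball m (2 * δ)) :
    gamma2 B < ENNReal.ofReal (32 * Ent * max δ (δ ^ α)) := by
  have hd : Metric.ediam B ≤ ENNReal.ofReal (4 * δ) := by
    refine Metric.ediam_le fun x hx y hy => ?_
    rw [edist_dist]
    apply ENNReal.ofReal_le_ofReal
    have h1 := Metric.mem_ball.1 (hB hx)
    have h2 := Metric.mem_ball'.1 (hB hy)
    linarith [dist_triangle x m y]
  -- The factor `16` covers both `4` and `4 ^ α`. The final `32` doubles it to get a strict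
  -- inequality, which allows an admissible sequence to be picked from the infimum.
  have h1 : max (Metric.ediam B) (Metric.ediam B ^ α) ≤ ENNReal.ofReal (16 * max δ (δ ^ α)) := by
    refine max_le (hd.trans (ENNReal.ofReal_le_ofReal ?_)) ?_
    · linarith [le_max_left δ (δ ^ α)]
    · refine (ENNReal.rpow_le_rpow hd (by linarith)).trans ?_
      rw [ENNReal.ofReal_rpow_of_pos (by positivity)]
      apply ENNReal.ofReal_le_ofReal
      rw [Real.mul_rpow (by norm_num) hδ.le]
      have : (4 : ℝ) ^ α ≤ 16 := by
        calc (4 : ℝ) ^ α ≤ 4 ^ (2 : ℝ) := Real.rpow_le_rpow_of_exponent_le (by norm_num) hα'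
          _ = 16 := by norm_num
      gcongr
      exact le_max_right _ _
  refine (hE B).trans_lt ((mul_le_mul_right h1 _).trans_lt ?_)
  rw [← ENNReal.ofReal_mul (by linarith)]
  apply (ENNReal.ofReal_lt_ofReal_iff _).2
  · have : 0 < max δ (δ ^ α) := lt_max_of_lt_left hδ
    nlinarith [mul_pos (by linarith : 0 < Ent) this]
  · have : 0 < max δ (δ ^ α) := lt_max_of_lt_left hδ
    positivity

variable [MeasurableSpace Ω] [BorelSpace Ω]

namespace WeightedSample

variable {P : ι → Measure Ω} {w : ι → ℝ} {m : Ω} {mi : ι → Ω} {κ Mom b : ℝ}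

omit [DecidableEq ι] in
lemma integrable_devTerm (h : WeightedSample P w m mi κ Mom b) (i : ι) (ω : Ω) :
    Integrable (fun y => devTerm w m i y ω) (P i) := by
  have := h.prob i
  exact ((integrable_dist_sq (h.sq_moment_lt_top i) ω).sub
    (integrable_dist_sq (h.sq_moment_lt_top i) m)).const_mul (w i)

omit [DecidableEq ι] in
lemma continuous_deviation (h : WeightedSample P w m mi κ Mom b) (ys : ι → Ω) :
    Continuous (deviation P w m ys) := by
  refine continuous_finsetSum _ fun i _ => ?_
  have := h.prob i
  have h1 : (fun ω => ∫ y, devTerm w m i y ω ∂(P i)) =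
      fun ω => w i * (∫ y, dist y ω ^ 2 ∂(P i) - ∫ y, dist y m ^ 2 ∂(P i)) := by
    funext ω
    unfold devTerm
    rw [integral_const_mul, integral_sub (integrable_dist_sq (h.sq_moment_lt_top i) ω)
    (integrable_dist_sq (h.sq_moment_lt_top i) m)]
  refine Continuous.sub ?_ ?_
  · unfold devTerm; fun_prop
  · rw [h1]
    exact continuous_const.mul ((continuous_integral_dist_sq (h.sq_moment_lt_top i)).sub
      continuous_const)

omit [DecidableEq ι] in
-- The deviation is continuous in `ω`, so a bound on `B` persists on its closure.
lemma ofReal_abs_deviation_le (h : WeightedSample P w m mi κ Mom b) {B : Set Ω} (ys : ι → Ω)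
    {ω : Ω} (hω : ω ∈ closure B) :
    ENNReal.ofReal |deviation P w m ys ω| ≤ centeredSup P (devTerm w m) B ys := by
  have hc : Continuous fun ω => ENNReal.ofReal |deviation P w m ys ω| :=
    ENNReal.continuous_ofReal.comp (h.continuous_deviation ys).abs
  have hcl : IsClosed {ω | ENNReal.ofReal |deviation P w m ys ω| ≤
      centeredSup P (devTerm w m) B ys} := isClosed_le hc continuous_const
  refine (closure_minimal (fun ω' hω' => ?_) hcl) hω
  exact le_iSup (f := fun ω : B => ENNReal.ofReal
    |∑ i, (devTerm w m i (ys i) ω - ∫ y, devTerm w m i y ω ∂(P i))|) ⟨ω', hω'⟩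

omit [DecidableEq ι] [MetricSpace Ω] [BorelSpace Ω] in
lemma sum_sq_pos {w : ι → ℝ} (hw : ∑ i, w i = 1) : 0 < ∑ i, w i ^ 2 := by
  refine (Finset.sum_nonneg fun i _ => sq_nonneg (w i)).lt_of_ne fun h0 => ?_
  have h1 := (Finset.sum_eq_zero_iff_of_nonneg fun i _ => sq_nonneg (w i)).1 h0.symm
  have : ∑ i, w i = 0 := Finset.sum_eq_zero fun i hi => by simpa using h1 i hi
  linarith

omit [DecidableEq ι] [MetricSpace Ω] [BorelSpace Ω] in
lemma sum_sq_le_one {w : ι → ℝ} (hw0 : ∀ i, 0 ≤ w i) (hw : ∑ i, w i = 1) : ∑ i, w i ^ 2 ≤ 1 := by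
  rw [← hw]
  refine Finset.sum_le_sum fun i _ => ?_
  have := Finset.single_le_sum (fun i _ => hw0 i) (Finset.mem_univ i)
  rw [hw] at this
  nlinarith [hw0 i]

omit [DecidableEq ι] in
-- After dividing by `q = ∑ w i ^ 2` the squared weights are themselves weights of sum one, so
-- Jensen at the power `κ / 2` reduces the sum to `κ`-th moments of single responses. `sum_w_sq` and
-- `b ≤ Mom` absorb the displacement of the means.
lemma lintegral_envelope_rpow_le (h : WeightedSample P w m mi κ Mom b) (hb : b ≤ Mom) {r L : ℝ}
    (hr : 0 ≤ r) (hL : 1 ≤ L) (hrL : r ≤ L * Mom) :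
    ∫⁻ ys, ENNReal.ofReal (∑ i, (2 * (w i * (dist (ys i) m + r))) ^ 2) ^ (κ / 2) ∂(Measure.pi P) ≤
      ENNReal.ofReal (3 * (6 * L * Mom * Real.sqrt (∑ i, w i ^ 2)) ^ κ) := by
  have hprob := h.prob
  have hκ := h.two_lt
  have hMom := h.one_le_Mom
  have hb0 := h.b_nonneg
  set q := ∑ i, w i ^ 2 with hq
  have hq0 : 0 < q := sum_sq_pos h.w_sum
  have hpt : ∀ ys : ι → Ω, ENNReal.ofReal (∑ i, (2 * (w i * (dist (ys i) m + r))) ^ 2) ^ (κ / 2) ≤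
      ENNReal.ofReal ((6 * Real.sqrt q) ^ κ) * (∑ i, ENNReal.ofReal (w i ^ 2 / q) *
        edist (ys i) (mi i) ^ κ + ENNReal.ofReal (2 * (L * Mom) ^ κ)) := by
    intro ys
    set A := ∑ i, (w i ^ 2 / q) * dist (ys i) (mi i) ^ 2 with hA
    have hA0 : 0 ≤ A := Finset.sum_nonneg fun i _ => by positivity
    have h1 : ∑ i, (2 * (w i * (dist (ys i) m + r))) ^ 2 ≤ 12 * q * (A + b ^ 2 + r ^ 2) := by
      have h2 : ∀ i ∈ Finset.univ, (2 * (w i * (dist (ys i) m + r))) ^ 2 ≤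
          12 * (w i ^ 2 * dist (ys i) (mi i) ^ 2) + 12 * (w i ^ 2 * dist (mi i) m ^ 2) +
            12 * r ^ 2 * w i ^ 2 := by
        intro i _
        have h3 : (dist (ys i) m + r) ^ 2 ≤ (dist (ys i) (mi i) + dist (mi i) m + r) ^ 2 := by
          gcongr
          exact dist_triangle _ _ _
        have h4 : (dist (ys i) m + r) ^ 2 ≤
            3 * dist (ys i) (mi i) ^ 2 + 3 * dist (mi i) m ^ 2 + 3 * r ^ 2 := by
          nlinarith [sq_nonneg (dist (ys i) (mi i) - dist (mi i) m),
            sq_nonneg (dist (ys i) (mi i) - r), sq_nonneg (dist (mi i) m - r)]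
        nlinarith [mul_le_mul_of_nonneg_left h4 (sq_nonneg (w i))]
      refine (Finset.sum_le_sum h2).trans ?_
      rw [Finset.sum_add_distrib, Finset.sum_add_distrib, ← Finset.mul_sum, ← Finset.mul_sum,
        ← Finset.mul_sum, ← hq]
      have h5 : ∑ i, w i ^ 2 * dist (ys i) (mi i) ^ 2 = q * A := by
        rw [hA, Finset.mul_sum]
        refine Finset.sum_congr rfl fun i _ => ?_
        field_simp
      have := h.sum_w_sq
      rw [h5]
      rw [← hq] at this
      nlinarith
    have hS0 : 0 ≤ ∑ i, (2 * (w i * (dist (ys i) m + r))) ^ 2 :=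
      Finset.sum_nonneg fun i _ => sq_nonneg _
    have hX : (A + b ^ 2 + r ^ 2) ≤ 3 * max A ((L * Mom) ^ 2) := by
      have h6 : b ^ 2 ≤ (L * Mom) ^ 2 := by
        gcongr
        nlinarith
      have h7 : r ^ 2 ≤ (L * Mom) ^ 2 := by gcongr
      linarith [le_max_left A ((L * Mom) ^ 2), le_max_right A ((L * Mom) ^ 2)]
    have hA' : A ^ (κ / 2) ≤ ∑ i, (w i ^ 2 / q) * dist (ys i) (mi i) ^ κ := by
      have := Real.rpow_arith_mean_le_arith_mean_rpow Finset.univ (fun i => w i ^ 2 / q)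
        (fun i => dist (ys i) (mi i) ^ 2) (fun i _ => by positivity)
        (by rw [← Finset.sum_div, ← hq, div_self hq0.ne']) (fun i _ => by positivity)
        (p := κ / 2) (by linarith)
      refine this.trans (le_of_eq (Finset.sum_congr rfl fun i _ => ?_))
      rw [← Real.rpow_natCast (dist (ys i) (mi i)) 2, ← Real.rpow_mul dist_nonneg]
      congr 2
      push_cast; ring
    have hLM : ((L * Mom) ^ 2) ^ (κ / 2) = (L * Mom) ^ κ := by
      rw [← Real.rpow_natCast, ← Real.rpow_mul (by positivity)]
      congr 1; push_cast; ring
    -- The factor `2` leaves room; with the `(L * Mom) ^ κ` coming from the moments of the responses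
    -- it makes the `3` of the conclusion.
    have hmax : (max A ((L * Mom) ^ 2)) ^ (κ / 2) ≤
        ∑ i, (w i ^ 2 / q) * dist (ys i) (mi i) ^ κ + 2 * (L * Mom) ^ κ := by
      have h8 : 0 ≤ ∑ i, (w i ^ 2 / q) * dist (ys i) (mi i) ^ κ :=
        Finset.sum_nonneg fun i _ => by positivity
      have h9 : 0 ≤ (L * Mom) ^ κ := by positivity
      rcases max_choice A ((L * Mom) ^ 2) with h | h <;> rw [h]
      · linarith
      · rw [hLM]; linarith
    have h36 : (36 * q) ^ (κ / 2) = (6 * Real.sqrt q) ^ κ := by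
      have : 36 * q = (6 * Real.sqrt q) ^ 2 := by
        rw [mul_pow, Real.sq_sqrt hq0.le]; norm_num
      rw [this, ← Real.rpow_natCast, ← Real.rpow_mul (by positivity)]
      congr 1; push_cast; ring
    rw [ENNReal.ofReal_rpow_of_nonneg hS0 (by linarith)]
    have h10 : (∑ i, (2 * (w i * (dist (ys i) m + r))) ^ 2) ^ (κ / 2) ≤ (6 * Real.sqrt q) ^ κ *
        (∑ i, (w i ^ 2 / q) * dist (ys i) (mi i) ^ κ + 2 * (L * Mom) ^ κ) := by
      calc _ ≤ ((36 * q) * max A ((L * Mom) ^ 2)) ^ (κ / 2) := by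
            apply Real.rpow_le_rpow hS0 _ (by linarith)
            nlinarith
        _ = (36 * q) ^ (κ / 2) * (max A ((L * Mom) ^ 2)) ^ (κ / 2) :=
            Real.mul_rpow (by positivity) (le_max_of_le_left hA0)
        _ ≤ _ := by
            rw [h36]
            gcongr
    refine (ENNReal.ofReal_le_ofReal h10).trans (le_of_eq ?_)
    rw [ENNReal.ofReal_mul (by positivity), ENNReal.ofReal_add
      (Finset.sum_nonneg fun i _ => by positivity) (by positivity),
      ENNReal.ofReal_sum_of_nonneg fun i _ => by positivity]
    congr 2
    refine Finset.sum_congr rfl fun i _ => ?_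
    rw [ENNReal.ofReal_mul (by positivity), edist_dist,
      ENNReal.ofReal_rpow_of_nonneg dist_nonneg (by linarith)]
  refine (lintegral_mono hpt).trans ?_
  have hm : ∀ i, Measurable fun ys : ι → Ω => edist (ys i) (mi i) ^ κ := fun i =>
    (by fun_prop : Measurable fun ys : ι → Ω => edist (ys i) (mi i)).pow_const κ
  rw [lintegral_const_mul _ (by fun_prop), lintegral_add_right _ measurable_const, lintegral_const,
    measure_univ, mul_one, lintegral_finsetSum _ fun i _ => by fun_prop]
  have h9 : ∀ i, ∫⁻ ys, ENNReal.ofReal (w i ^ 2 / q) * edist (ys i) (mi i) ^ κ ∂(Measure.pi P) ≤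
      ENNReal.ofReal (w i ^ 2 / q * Mom ^ κ) := by
    intro i
    rw [lintegral_const_mul _ (hm i), ENNReal.ofReal_mul (by positivity)]
    gcongr
    rw [(measurePreserving_eval P i).lintegral_comp (f := fun y => edist y (mi i) ^ κ)
      ((by fun_prop : Measurable fun y => edist y (mi i)).pow_const κ)]
    refine (lintegral_edist_rpow_le (h.mom i) (by linarith) le_rfl).trans (le_of_eq ?_)
    rw [ENNReal.ofReal_rpow_of_nonneg (by linarith) (by linarith)]
  have h10 : ∑ i, ∫⁻ ys, ENNReal.ofReal (w i ^ 2 / q) * edist (ys i) (mi i) ^ κ ∂(Measure.pi P) ≤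
      ENNReal.ofReal ((L * Mom) ^ κ) := by
    refine (Finset.sum_le_sum fun i _ => h9 i).trans ?_
    rw [← ENNReal.ofReal_sum_of_nonneg fun i _ => by positivity]
    apply ENNReal.ofReal_le_ofReal
    rw [← Finset.sum_mul, ← Finset.sum_div, ← hq, div_self hq0.ne', one_mul]
    apply Real.rpow_le_rpow (by linarith) _ (by linarith)
    nlinarith
  refine (mul_le_mul_right (add_le_add_left h10 _) _).trans ?_
  rw [← ENNReal.ofReal_add (by positivity) (by positivity), ← ENNReal.ofReal_mul (by positivity)]
  apply ENNReal.ofReal_le_ofReal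
  apply le_of_eq
  have : 6 * L * Mom * Real.sqrt q = (6 * Real.sqrt q) * (L * Mom) := by ring
  rw [this, Real.mul_rpow (x := 6 * Real.sqrt q) (y := L * Mom) (by positivity) (by positivity)]
  ring

/-- The probability that the deviation is large somewhere on a ball around `m`. -/
lemma measure_centeredSup_ge_le (h : WeightedSample P w m mi κ Mom b) (hb : b ≤ Mom)
    {α Ent V : ℝ} (hα : 1 ≤ α) (hα' : α ≤ 2) (hEnt : 1 ≤ Ent) (hV : 1 ≤ V)
    (hE : ∀ B : Set Ω, gamma2 B ≤ ENNReal.ofReal Ent * max (Metric.ediam B) (Metric.ediam B ^ α))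
    {δ : ℝ} (hδ : 0 < δ) (hδM : δ ≤ 8 * Mom) {B : Set Ω} (hBc : B.Countable) (hmB : m ∈ B)
    (hB : B ⊆ Metric.ball m (2 * δ)) :
    Measure.pi P {ys | ENNReal.ofReal (δ ^ 2 / (2 * V)) ≤ centeredSup P (devTerm w m) B ys} ≤
      ENNReal.ofReal (6 * chainConst κ * (12288 * (V * Mom * Ent * Real.sqrt (∑ i, w i ^ 2) *
        (max δ (δ ^ α) / δ ^ 2))) ^ κ) := by
  have hprob := h.prob
  have hκ := h.two_lt
  have hMom := h.one_le_Mom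
  set q := ∑ i, w i ^ 2 with hq
  have hq0 : 0 < q := sum_sq_pos h.w_sum
  have hmax : 0 < max δ (δ ^ α) := lt_max_of_lt_left hδ
  set G := 32 * Ent * max δ (δ ^ α) with hG
  have hchain : 0 ≤ chainConst κ := by unfold chainConst; positivity
  have hfm : ∀ i, ∀ ω ∈ B, Measurable fun y => devTerm w m i y ω := by
    intro i ω _; unfold devTerm; fun_prop
  have h1 := lintegral_centeredSup_rpow_le (P := P) hBc hmB hfm
    (fun i ω _ => h.integrable_devTerm i ω) (e := fun i y => 2 * (w i * (dist y m + 2 * δ)))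
    (fun i => by fun_prop) (fun i y => abs_devTerm_sub_le h.w_nonneg hB i y)
    (fun i y => by simp [devTerm]) (G := G) (by positivity)
    (gamma2_lt_of_subset_ball hα hα' hEnt hE hδ hB) (s := κ) (by linarith)
  -- `L = 16` because the ball has radius `2 * δ ≤ 16 * Mom`.
  have h2 := h.lintegral_envelope_rpow_le hb (r := 2 * δ) (L := 16) (by positivity) (by norm_num)
    (by linarith)
  have h3 := h1.trans (mul_le_mul_right h2 _)
  rw [← ENNReal.ofReal_mul (by positivity)] at h3
  have hmeas : Measurable (centeredSup P (devTerm w m) B) := by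
    have := hBc.to_subtype
    refine Measurable.iSup fun ω => ENNReal.measurable_ofReal.comp (measurable_abs.comp ?_)
    refine Finset.measurable_sum _ fun i _ => Measurable.sub ?_ measurable_const
    exact (hfm i ω ω.2).comp (measurable_pi_apply i)
  -- Markov's inequality for the `κ`-th power.
  have h4 := mul_meas_ge_le_lintegral₀ (μ := Measure.pi P) (hmeas.pow_const κ).aemeasurable
    (ENNReal.ofReal (δ ^ 2 / (2 * V)) ^ κ)
  have h5 : {ys | ENNReal.ofReal (δ ^ 2 / (2 * V)) ≤ centeredSup P (devTerm w m) B ys} ⊆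
    {ys | ENNReal.ofReal (δ ^ 2 / (2 * V)) ^ κ ≤ centeredSup P (devTerm w m) B ys ^ κ} := by
    intro ys hys
    exact ENNReal.rpow_le_rpow hys (by linarith)
  have hpos : 0 < δ ^ 2 / (2 * V) := by positivity
  have h6 := (mul_le_mul_right (measure_mono h5) _).trans (h4.trans h3)
  rw [ENNReal.ofReal_rpow_of_pos hpos] at h6
  have hpos' : 0 < (δ ^ 2 / (2 * V)) ^ κ := by positivity
  rw [mul_comm, ← ENNReal.le_div_iff_mul_le (Or.inl (by positivity)) (Or.inl (by finiteness)),
    ← ENNReal.ofReal_div_of_pos hpos'] at h6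
  refine h6.trans (ENNReal.ofReal_le_ofReal (le_of_eq ?_))
  rw [div_eq_iff hpos'.ne', mul_assoc (6 * chainConst κ), ← Real.mul_rpow (by positivity) hpos.le]
  -- `12288 = 2 * (2 * 32) * (6 * 16)`: the threshold, the entropy bound and the envelope.
  have : 12288 * (V * Mom * Ent * Real.sqrt q * (max δ (δ ^ α) / δ ^ 2)) * (δ ^ 2 / (2 * V)) =
      (2 * G) * (6 * 16 * Mom * Real.sqrt q) := by
    rw [hG]; field_simp; ring
  rw [this, Real.mul_rpow (x := 2 * G) (by positivity) (by positivity)]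
  ring

end WeightedSample

end Deviation

/-! ### Peeling over dyadic shells. -/

/-- The critical radius `T^(1/(2-α)) √q` is chosen so that `T √q δ^(α-2) ≤ 1` there, and each
doubling of `δ` gains `2^(-(2-α))`. In the linear regime of the maximum the gain is `2⁻¹`, which is
at least as good since `α ≥ 1`. -/
lemma peeling_ratio_le {α T q : ℝ} (hα : 1 ≤ α) (hα' : α < 2) (hT : 1 ≤ T) (hq : 0 < q)
    (hq1 : q ≤ 1)
    (j : ℕ) {δ : ℝ} (hδ : δ = 2 ^ j * (T ^ (1 / (2 - α)) * Real.sqrt q)) :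
    T * Real.sqrt q * (max δ (δ ^ α) / δ ^ 2) ≤ (2 ^ (-(2 - α))) ^ j := by
  have hα2 : 0 < 2 - α := by linarith
  have hs : 0 < Real.sqrt q := Real.sqrt_pos.2 hq
  have hs1 : Real.sqrt q ≤ 1 := Real.sqrt_le_one.2 hq1
  have hT0 : 0 < T := by linarith
  have hTp : 0 < T ^ (1 / (2 - α)) := by positivity
  have hδ0 : 0 < δ := by rw [hδ]; positivity
  have e1 : ((2 : ℝ) ^ (-(2 - α))) ^ j = ((2 : ℝ) ^ j) ^ (α - 2) := by
    rw [← Real.rpow_natCast, ← Real.rpow_natCast, ← Real.rpow_mul (by norm_num),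
      ← Real.rpow_mul (by norm_num)]
    congr 1; ring
  have h1j : (1 : ℝ) ≤ 2 ^ j := one_le_pow₀ (by norm_num)
  rcases max_choice δ (δ ^ α) with hm | hm <;> rw [hm]
  · have h1 : T ≤ T ^ (1 / (2 - α)) := by
      conv_lhs => rw [← Real.rpow_one T]
      apply Real.rpow_le_rpow_of_exponent_le hT
      rw [le_div_iff₀ hα2]; linarith
    have h2 : T * Real.sqrt q * (δ / δ ^ 2) = T / T ^ (1 / (2 - α)) * ((2 : ℝ) ^ j) ^ (-1 : ℝ) := by
      rw [Real.rpow_neg_one, hδ]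
      field_simp
    rw [h2, e1]
    calc _ ≤ 1 * ((2 : ℝ) ^ j) ^ (-1 : ℝ) := by
          gcongr
          exact (div_le_one hTp).2 h1
      _ ≤ _ := by
          rw [one_mul]
          exact Real.rpow_le_rpow_of_exponent_le h1j (by linarith)
  · have h2 : δ ^ α / δ ^ 2 = δ ^ (α - 2) := by
      rw [Real.rpow_sub hδ0]; norm_num
    have h3 : δ ^ (α - 2) = ((2 : ℝ) ^ j) ^ (α - 2) * (T⁻¹ * Real.sqrt q ^ (α - 2)) := by
      rw [hδ, Real.mul_rpow (by positivity) (by positivity), Real.mul_rpow (by positivity)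
        (by positivity), ← Real.rpow_mul hT0.le]
      congr 2
      rw [← Real.rpow_neg_one]
      congr 1
      field_simp
      ring
    have h4 : Real.sqrt q * Real.sqrt q ^ (α - 2) ≤ 1 := by
      rw [show Real.sqrt q * Real.sqrt q ^ (α - 2) = Real.sqrt q ^ (1 + (α - 2)) by
        rw [Real.rpow_add hs, Real.rpow_one]]
      exact Real.rpow_le_one hs.le hs1 (by linarith)
    rw [h2, h3, e1]
    calc _ = (T * T⁻¹) * ((2 : ℝ) ^ j) ^ (α - 2) * (Real.sqrt q * Real.sqrt q ^ (α - 2)) := by ring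
      _ ≤ 1 * ((2 : ℝ) ^ j) ^ (α - 2) * 1 := by
          rw [mul_inv_cancel₀ hT0.ne']
          gcongr
      _ = _ := by ring

/-- Ratio of the geometric series over the shells. -/
noncomputable def peelRatio (α κ : ℝ) : ℝ := 2 ^ (2 - (2 - α) * κ)

/-- Constant of the variance bound. -/
noncomputable def peelConst (α κ : ℝ) : ℝ :=
  17 + 24 * chainConst κ * 12288 ^ κ * (1 - peelRatio α κ)⁻¹

/-- Passing to the next shell multiplies the squared radius by `4` and the bound for the probability
by `2^(-(2-α)κ)`; the assumed lower bound on `κ` says that the product is below one. -/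
lemma peelRatio_lt_one {α κ : ℝ} (hα : α < 2) (hκ : 2 / (2 - α) < κ) : peelRatio α κ < 1 := by
  rw [div_lt_iff₀ (by linarith)] at hκ
  exact Real.rpow_lt_one_of_one_lt_of_neg (by norm_num) (by linarith)

lemma peelConst_ge {α κ : ℝ} (hα : α < 2) (hκ0 : 0 < κ) (hκ : 2 / (2 - α) < κ) :
    17 ≤ peelConst α κ := by
  have := peelRatio_lt_one hα hκ
  have h1 : 0 ≤ chainConst κ := by unfold chainConst; positivity
  have h2 : 0 ≤ (1 - peelRatio α κ)⁻¹ := inv_nonneg.2 (by linarith)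
  unfold peelConst
  have : 0 ≤ 24 * chainConst κ * 12288 ^ κ * (1 - peelRatio α κ)⁻¹ := by positivity
  linarith

section

variable {ι : Type*} [Fintype ι] [DecidableEq ι] {Ω : Type u} [MetricSpace Ω]
  [MeasurableSpace Ω] [BorelSpace Ω] [SecondCountableTopology Ω]

/-- Mean squared error of a minimizer whose squared distance to `m` is dominated either by `Hb` or
by the deviation. -/
theorem WeightedSample.lintegral_sq_le_of_deviation {P : ι → Measure Ω} {w : ι → ℝ} {m : Ω}
    {mi : ι → Ω} {κ Mom b : ℝ} (h : WeightedSample P w m mi κ Mom b) (hb : b ≤ Mom)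
    {α Ent V : ℝ} (hα : 1 ≤ α) (hα' : α < 2) (hκα : 2 / (2 - α) < κ) (hEnt : 1 ≤ Ent) (hV : 1 ≤ V)
    (hE : ∀ B : Set Ω, gamma2 B ≤ ENNReal.ofReal Ent * max (Metric.ediam B) (Metric.ediam B ^ α))
    {F : (ι → Ω) → Ω} (hF : ∀ᵐ ys ∂(Measure.pi P),
      ∑ i, w i * dist (ys i) (F ys) ^ 2 ≤ ∑ i, w i * dist (ys i) m ^ 2)
    {Hb : (ι → Ω) → ℝ≥0∞} (hdev : ∀ᵐ ys ∂(Measure.pi P),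
      edist (F ys) m ^ 2 ≤ Hb ys ∨ dist (F ys) m ^ 2 ≤ 2 * V * |deviation P w m ys (F ys)|) :
    ∫⁻ ys, edist (F ys) m ^ 2 ∂(Measure.pi P) ≤ ∫⁻ ys, Hb ys ∂(Measure.pi P) +
      ENNReal.ofReal (peelConst α κ * (V * Mom * Ent) ^ (2 / (2 - α)) * ∑ i, w i ^ 2) := by
  have hprob := h.prob
  have hκ := h.two_lt
  have hMom := h.one_le_Mom
  set q := ∑ i, w i ^ 2 with hq
  have hq0 : 0 < q := sum_sq_pos h.w_sum
  have hq1 : q ≤ 1 := sum_sq_le_one h.w_nonneg h.w_sum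
  set T := V * Mom * Ent with hT
  have hVM : 1 ≤ V * Mom := one_le_mul_of_one_le_of_one_le hV hMom
  have hT1 : 1 ≤ T := one_le_mul_of_one_le_of_one_le hVM hEnt
  have hMT : Mom ≤ T := by rw [hT]; nlinarith
  set δ₀ := T ^ (1 / (2 - α)) * Real.sqrt q with hδ₀
  have hδ₀pos : 0 < δ₀ := mul_pos (by positivity) (Real.sqrt_pos.2 hq0)
  have hα2 : 0 < 2 - α := by linarith
  have hδ₀sq : δ₀ ^ 2 = T ^ (2 / (2 - α)) * q := by
    rw [hδ₀, mul_pow, Real.sq_sqrt hq0.le, ← Real.rpow_natCast, ← Real.rpow_mul (by positivity)]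
    congr 2; push_cast; ring
  set δ : ℕ → ℝ := fun j => 2 ^ j * δ₀ with hδ
  have hδpos : ∀ j, 0 < δ j := fun j => by positivity
  have hBex := fun j => exists_countable_dense_ball m (r := 2 * δ j) (by linarith [hδpos j])
  choose B hBc hmB hB hBd using hBex
  set E : ℕ → Set (ι → Ω) := fun j =>
    {ys | ENNReal.ofReal (δ j ^ 2 / (2 * V)) ≤ centeredSup P (devTerm w m) (B j) ys} with hEdef
  have hEmeas : ∀ j, MeasurableSet (E j) := by
    intro j
    have := (hBc j).to_subtype
    refine measurableSet_le measurable_const ?_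
    refine Measurable.iSup fun ω => ENNReal.measurable_ofReal.comp (measurable_abs.comp ?_)
    refine Finset.measurable_sum _ fun i _ => Measurable.sub ?_ measurable_const
    unfold devTerm; fun_prop
  -- Contribution of the `j`-th shell. Shells beyond `8 * Mom` are dropped, because the far region
  -- is treated through `centeredDist`.
  set S : ℕ → (ι → Ω) → ℝ≥0∞ := fun j => if δ j ≤ 8 * Mom then
    (E j).indicator (fun _ => ENNReal.ofReal ((2 * δ j) ^ 2)) else 0 with hS
  have hSmeas : ∀ j, Measurable (S j) := by
    intro j
    simp only [hS]
    split_ifs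
    · exact measurable_const.indicator (hEmeas j)
    · exact measurable_const
  have hpt : ∀ᵐ ys ∂(Measure.pi P), edist (F ys) m ^ 2 ≤ Hb ys +
      ((ENNReal.ofReal (16 * centeredDist P w mi ys ^ 2) + ENNReal.ofReal (δ₀ ^ 2)) +
        ∑' j, S j ys) := by
    filter_upwards [hF, hdev] with ys hys hys'
    rcases hys' with h1 | h1
    · exact h1.trans le_self_add
    refine le_trans ?_ le_add_self
    have hed : edist (F ys) m ^ 2 = ENNReal.ofReal (dist (F ys) m ^ 2) := by
      rw [edist_dist, ENNReal.ofReal_pow dist_nonneg]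
    rw [hed]
    by_cases hfar : 8 * Mom ≤ dist (F ys) m
    · refine le_trans ?_ le_self_add
      refine le_trans ?_ le_self_add
      exact ENNReal.ofReal_le_ofReal (h.dist_le_centeredDist hb hys hfar)
    by_cases hnear : dist (F ys) m ≤ δ₀
    · refine le_trans ?_ le_self_add
      refine le_trans ?_ le_add_self
      apply ENNReal.ofReal_le_ofReal
      gcongr
    push Not at hfar hnear
    refine le_trans ?_ le_add_self
    -- The shell with `δ j ≤ dist (F ys) m < 2 * δ j`.
    obtain ⟨j, hj1, hj2⟩ := exists_nat_pow_near (x := dist (F ys) m / δ₀) (y := 2)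
      ((one_le_div hδ₀pos).2 hnear.le) one_lt_two
    rw [le_div_iff₀ hδ₀pos] at hj1
    rw [div_lt_iff₀ hδ₀pos, pow_succ] at hj2
    refine le_trans ?_ (ENNReal.le_tsum j)
    have hjM : δ j ≤ 8 * Mom := hj1.trans hfar.le
    have hmem : ys ∈ E j := by
      have hball : F ys ∈ Metric.ball m (2 * δ j) := by
        rw [Metric.mem_ball]
        calc _ < _ := hj2
          _ = _ := by simp only [hδ]; ring
      refine le_trans (ENNReal.ofReal_le_ofReal ?_) (h.ofReal_abs_deviation_le ys (hBd j hball))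
      rw [div_le_iff₀ (by linarith), mul_comm]
      refine le_trans ?_ h1
      gcongr
    simp only [hS, if_pos hjM]
    rw [Set.indicator_of_mem hmem]
    apply ENNReal.ofReal_le_ofReal
    gcongr
    calc _ ≤ _ := hj2.le
      _ = _ := by simp only [hδ]; ring
  refine (lintegral_mono_ae hpt).trans ?_
  have hm1 : Measurable fun ys : ι → Ω => ENNReal.ofReal (16 * centeredDist P w mi ys ^ 2) :=
    ENNReal.measurable_ofReal.comp ((measurable_centeredDist.pow_const 2).const_mul 16)
  rw [lintegral_add_right _ (by fun_prop), lintegral_add_right _ (by fun_prop),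
    lintegral_add_right _ measurable_const, lintegral_const, measure_univ, mul_one,
    lintegral_tsum fun j => (hSmeas j).aemeasurable]
  gcongr
  have b1 : ∫⁻ ys, ENNReal.ofReal (16 * centeredDist P w mi ys ^ 2) ∂(Measure.pi P) ≤
      ENNReal.ofReal (16 * (T ^ (2 / (2 - α)) * q)) := by
    simp_rw [ENNReal.ofReal_mul (by norm_num : (0:ℝ) ≤ 16)]
    rw [lintegral_const_mul' _ _ (by finiteness)]
    gcongr
    refine h.lintegral_centeredDist_sq_le.trans (ENNReal.ofReal_le_ofReal ?_)
    rw [← hq]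
    gcongr
    -- The exponent `2 / (2 - α)` is at least `2` because `α ≥ 1`, and `T ≥ 1`.
    calc Mom ^ 2 ≤ T ^ 2 := by gcongr
      _ = T ^ (2 : ℝ) := by norm_num
      _ ≤ T ^ (2 / (2 - α)) := by
        apply Real.rpow_le_rpow_of_exponent_le hT1
        rw [le_div_iff₀ hα2]; linarith
  have hθ := peelRatio_lt_one hα' hκα
  have hθ0 : 0 ≤ peelRatio α κ := by unfold peelRatio; positivity
  have hchain : 0 ≤ chainConst κ := by unfold chainConst; positivity
  have b2 : ∀ j, ∫⁻ ys, S j ys ∂(Measure.pi P) ≤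
      ENNReal.ofReal (24 * chainConst κ * 12288 ^ κ * (T ^ (2 / (2 - α)) * q) *
        peelRatio α κ ^ j) := by
    intro j
    simp only [hS]
    split_ifs with hj
    swap
    · simp
    rw [lintegral_indicator (hEmeas j), setLIntegral_const]
    have h1 := h.measure_centeredSup_ge_le hb hα hα'.le hEnt hV hE (hδpos j) hj (hBc j) (hmB j)
        (hB j)
    rw [← hq, ← hT] at h1
    refine (mul_le_mul_right h1 _).trans ?_
    rw [← ENNReal.ofReal_mul (by positivity)]
    apply ENNReal.ofReal_le_ofReal
    have h2 := peeling_ratio_le hα hα' hT1 hq0 hq1 j (δ := δ j) rfl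
    have hmax : 0 < max (δ j) (δ j ^ α) := lt_max_of_lt_left (hδpos j)
    have h3 : (12288 * (T * Real.sqrt q * (max (δ j) (δ j ^ α) / δ j ^ 2))) ^ κ ≤
        12288 ^ κ * ((2 ^ (-(2 - α))) ^ j) ^ κ := by
      rw [← Real.mul_rpow (by norm_num) (by positivity)]
      apply Real.rpow_le_rpow (by positivity) _ (by linarith)
      gcongr
    -- The growth of the squared radius against the decay of the probability.
    have h4 : (4 : ℝ) ^ j * ((2 ^ (-(2 - α))) ^ j) ^ κ = peelRatio α κ ^ j := by
      have : (4 : ℝ) ^ j = ((2 : ℝ) ^ (2 : ℝ)) ^ j := by norm_num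
      rw [this, peelRatio, ← Real.rpow_natCast, ← Real.rpow_natCast, ← Real.rpow_natCast,
        ← Real.rpow_mul (by positivity), ← Real.rpow_mul (by positivity),
        ← Real.rpow_mul (by positivity), ← Real.rpow_mul (by positivity),
        ← Real.rpow_add (by positivity)]
      congr 1; ring
    calc (2 * δ j) ^ 2 * (6 * chainConst κ *
          (12288 * (T * Real.sqrt q * (max (δ j) (δ j ^ α) / δ j ^ 2))) ^ κ)
        ≤ (2 * δ j) ^ 2 * (6 * chainConst κ * (12288 ^ κ * ((2 ^ (-(2 - α))) ^ j) ^ κ)) := by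
          gcongr
      _ = 24 * chainConst κ * 12288 ^ κ * δ₀ ^ 2 * (4 ^ j * ((2 ^ (-(2 - α))) ^ j) ^ κ) := by
          simp only [hδ]
          rw [show (4 : ℝ) ^ j = (2 ^ j) ^ 2 by rw [← pow_mul, mul_comm, pow_mul]; norm_num]
          ring
      _ = _ := by rw [h4, hδ₀sq]
  have hTq : 0 ≤ T ^ (2 / (2 - α)) * q := by positivity
  have b3 : ∑' j, ∫⁻ ys, S j ys ∂(Measure.pi P) ≤
      ENNReal.ofReal (24 * chainConst κ * 12288 ^ κ * (T ^ (2 / (2 - α)) * q) *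
        (1 - peelRatio α κ)⁻¹) := by
    refine (ENNReal.tsum_le_tsum b2).trans ?_
    rw [← ENNReal.ofReal_tsum_of_nonneg (fun j => by positivity)
      ((summable_geometric_of_lt_one hθ0 hθ).mul_left _), tsum_mul_left,
      tsum_geometric_of_lt_one hθ0 hθ]
  refine (add_le_add (add_le_add_left b1 _) b3).trans ?_
  have hinv : 0 ≤ (1 - peelRatio α κ)⁻¹ := inv_nonneg.2 (by linarith)
  -- The far region contributes `16`, the ball of radius `δ₀` contributes `1`, and the shells
  -- contribute the geometric series: together `peelConst`.
  rw [hδ₀sq, ← ENNReal.ofReal_add (by positivity) hTq, ← ENNReal.ofReal_add (by positivity)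
    (by positivity)]
  apply ENNReal.ofReal_le_ofReal
  apply le_of_eq
  unfold peelConst
  ring

end

/-! ### Separability from finite entropy. -/

section Separable

variable {Ω : Type u} [MetricSpace Ω]

/-- Take one point from each of the finitely many blocks at every level; finiteness of the chaining
sum forces the diameters of the blocks around any point to tend to zero. -/
lemma exists_countable_dense_of_gamma2_lt_top {B : Set Ω} (hB : gamma2 B < ⊤) :
    ∃ D : Set Ω, D.Countable ∧ B ⊆ closure D := by
  obtain ⟨A, hA⟩ := iInf_lt_iff.1 hB
  obtain ⟨hadm, hA⟩ := iInf_lt_iff.1 hA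
  have hcount : ∀ k, Countable (Quotient (A (k + 1))) := by
    intro k
    have h1 := (hadm.card_le (k + 1) (by omega)).trans_lt (ENat.natCast_lt_top _)
    have : Finite (Quotient (A (k + 1))) := by
      rwa [← ENat.card_lt_top]
    infer_instance
  refine ⟨⋃ k, Set.range fun c : Quotient (A (k + 1)) => ((c.out : B) : Ω),
    Set.countable_iUnion fun k => Set.countable_range _, fun ω hω => ?_⟩
  set D : ℕ → ℝ≥0∞ := fun k => Metric.ediam {ω' : B | (A k) ω' ⟨ω, hω⟩} with hD
  have hfin : ∑' k : ℕ, (2 : ℝ≥0∞) ^ ((k : ℝ) / 2) * D k < ⊤ :=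
    (le_iSup (f := fun ω : B => ∑' k : ℕ, (2 : ℝ≥0∞) ^ ((k : ℝ) / 2) *
      Metric.ediam {ω' : B | (A k) ω' ω}) ⟨ω, hω⟩).trans_lt hA
  have h1 : ∑' k, D k ≠ ⊤ := by
    refine ne_top_of_le_ne_top hfin.ne (ENNReal.tsum_le_tsum fun k => ?_)
    refine le_mul_of_one_le_left' ?_
    calc (1 : ℝ≥0∞) = 1 ^ ((k : ℝ) / 2) := (ENNReal.one_rpow _).symm
      _ ≤ 2 ^ ((k : ℝ) / 2) := ENNReal.rpow_le_rpow (by norm_num) (by positivity)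
  have h2 := ENNReal.tendsto_atTop_zero_of_tsum_ne_top h1
  rw [EMetric.mem_closure_iff]
  intro ε hε
  obtain ⟨K, hK⟩ := Filter.eventually_atTop.1 (h2.eventually (gt_mem_nhds hε))
  refine ⟨_, Set.mem_iUnion.2 ⟨K, Set.mem_range_self (Quotient.mk _ ⟨ω, hω⟩)⟩, ?_⟩
  have h3 := hK (K + 1) (by omega)
  refine lt_of_le_of_lt ?_ h3
  change edist (⟨ω, hω⟩ : B) _ ≤ _
  exact Metric.edist_le_ediam_of_mem ((A (K + 1)).refl _) (Quotient.mk_out (s := A (K + 1)) _)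

/-- The entropy condition makes the response space separable. -/
lemma Entropy.secondCountableTopology {α : ℝ} {C : Params} (hE : Entropy Ω α C) (hα : 0 ≤ α) :
    SecondCountableTopology Ω := by
  rcases isEmpty_or_nonempty Ω with he | ⟨⟨o⟩⟩
  · infer_instance
  have h1 : ∀ N : ℕ, ∃ D : Set Ω, D.Countable ∧ Metric.ball o N ⊆ closure D := by
    intro N
    apply exists_countable_dense_of_gamma2_lt_top
    refine (hE _).trans_lt ?_
    have : Metric.ediam (Metric.ball o (N : ℝ)) ≠ ⊤ := Metric.isBounded_ball.ediam_ne_top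
    have h3 : Metric.ediam (Metric.ball o (N : ℝ)) ^ α ≠ ⊤ := ENNReal.rpow_ne_top_of_nonneg hα this
    exact ENNReal.mul_lt_top ENNReal.ofReal_lt_top (max_lt this.lt_top h3.lt_top)
  choose D hD hDc using h1
  have : TopologicalSpace.SeparableSpace Ω := by
    refine ⟨⋃ N, D N, Set.countable_iUnion hD, fun ω => ?_⟩
    obtain ⟨N, hN⟩ := exists_nat_gt (dist ω o)
    exact closure_mono (Set.subset_iUnion D N) (hDc N hN)
  exact UniformSpace.secondCountable_of_separable Ω

end Separable

/-! ### Conditioning the sample on its covariates. -/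

section Disintegration

variable {X Y : Type*} [MeasurableSpace X] [MeasurableSpace Y] {n : ℕ}

/-- The law of independent responses given the covariates. -/
noncomputable def responseKernel (η : Kernel X Y) [IsMarkovKernel η] (n : ℕ) :
    Kernel (Fin n → X) (Fin n → Y) where
  toFun xs := Measure.pi fun i => η (xs i)
  measurable' := by
    refine Measurable.measure_of_isPiSystem_of_isProbabilityMeasure generateFrom_pi.symm
      isPiSystem_pi ?_
    rintro _ ⟨s, hs, rfl⟩
    simp only [Measure.pi_pi]
    exact Finset.measurable_prod _ fun i _ =>
      (Kernel.measurable_coe η (hs i (Set.mem_univ i))).comp (measurable_pi_apply i)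

instance (η : Kernel X Y) [IsMarkovKernel η] : IsMarkovKernel (responseKernel η n) :=
  ⟨fun xs => by change IsProbabilityMeasure (Measure.pi _); infer_instance⟩

/-- The sample built from covariates and responses. -/
def zipSample (q : (Fin n → X) × (Fin n → Y)) : Fin n → X × Y := fun i => (q.1 i, q.2 i)

lemma measurable_zipSample : Measurable (zipSample : (Fin n → X) × (Fin n → Y) → _) := by
  unfold zipSample
  fun_prop

/-- It suffices to compare boxes. There the conditional probability is a product of functions of
distinct, independent covariates, so its integral factorizes. -/
lemma pi_compProd_eq_map (ν : Measure X) [IsProbabilityMeasure ν] (η : Kernel X Y)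
    [IsMarkovKernel η] : Measure.pi (fun _ : Fin n => ν ⊗ₘ η) =
      ((Measure.pi fun _ : Fin n => ν) ⊗ₘ responseKernel η n).map zipSample := by
  refine Measure.pi_eq fun s hs => ?_
  have hs' : MeasurableSet (Set.pi Set.univ s) := MeasurableSet.univ_pi hs
  rw [Measure.map_apply measurable_zipSample hs',
    Measure.compProd_apply (measurable_zipSample hs')]
  have h1 : ∀ xs : Fin n → X, responseKernel η n xs (Prod.mk xs ⁻¹'
      (zipSample ⁻¹' Set.pi Set.univ s)) =
      ∏ i, η (xs i) (Prod.mk (xs i) ⁻¹' s i) := by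
    intro xs
    have : Prod.mk xs ⁻¹' (zipSample ⁻¹' Set.pi Set.univ s) =
        Set.pi Set.univ fun i => Prod.mk (xs i) ⁻¹' s i := by
      ext ys; simp [zipSample]
    rw [this]
    exact Measure.pi_pi _ _
  simp_rw [h1]
  have hm : ∀ i, Measurable fun x => η x (Prod.mk x ⁻¹' s i) := fun i =>
    Kernel.measurable_kernel_prodMk_left (hs i)
  have h2 := lintegral_prod_eq_prod_lintegral_of_indepFun (μ := Measure.pi fun _ : Fin n => ν)
    Finset.univ (fun i (xs : Fin n → X) => η (xs i) (Prod.mk (xs i) ⁻¹' s i))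
    (iIndepFun_pi (X := fun i x => η x (Prod.mk x ⁻¹' s i)) fun i => (hm i).aemeasurable)
    (fun i => (hm i).comp (measurable_pi_apply i))
  rw [h2]
  refine Finset.prod_congr rfl fun i _ => ?_
  rw [Measure.compProd_apply (hs i)]
  exact (measurePreserving_eval (fun _ : Fin n => ν) i).lintegral_comp (hm i)

end Disintegration

namespace Setting

variable {p : ℕ} {Ω : Type u} [MetricSpace Ω] [MeasurableSpace Ω] (S : Setting p Ω) {n : ℕ}

lemma lintegral_sampleLaw {f : (Fin n → Euc p × Ω) → ℝ≥0∞} (hf : Measurable f) :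
    ∫⁻ z, f z ∂(S.sampleLaw n) = ∫⁻ xs, ∫⁻ ys, f (fun i => (xs i, ys i))
      ∂(Measure.pi fun i => S.η (xs i)) ∂(Measure.pi fun _ : Fin n => S.νX) := by
  unfold sampleLaw ν
  rw [pi_compProd_eq_map, lintegral_map hf measurable_zipSample,
    Measure.lintegral_compProd (f := fun q => f (zipSample q)) (hf.comp measurable_zipSample)]
  rfl

lemma ae_ae_of_ae_sampleLaw {q : (Fin n → Euc p × Ω) → Prop} (hq : ∀ᵐ z ∂(S.sampleLaw n), q z) :
    ∀ᵐ xs ∂(Measure.pi fun _ : Fin n => S.νX), ∀ᵐ ys ∂(Measure.pi fun i => S.η (xs i)),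
      q (fun i => (xs i, ys i)) := by
  unfold sampleLaw ν at hq
  rw [pi_compProd_eq_map] at hq
  exact Measure.ae_ae_of_ae_compProd (ae_of_ae_map measurable_zipSample.aemeasurable hq)

lemma ae_forall_mem_cube : ∀ᵐ xs ∂(Measure.pi fun _ : Fin n => S.νX), ∀ i, xs i ∈ cube p := by
  rw [ae_all_iff]
  intro i
  exact (measurePreserving_eval (fun _ : Fin n => S.νX) i).quasiMeasurePreserving.ae S.νX_cube

end Setting

/-! ### The bias, and the conditional risk given the covariates. -/

namespace Setting

variable {p : ℕ} {Ω : Type u} [MetricSpace Ω] [MeasurableSpace Ω] [BorelSpace Ω] (S : Setting p Ω)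

omit [BorelSpace Ω] in
-- Integrate the triangle inequality through `y` against the probability measure `μ`.
lemma edist_le_H (ω₁ ω₂ : Ω) : edist ω₁ ω₂ ≤ S.H ω₁ ω₂ := by
  unfold H
  rw [one_div, ENNReal.le_rpow_inv_iff two_pos]
  calc edist ω₁ ω₂ ^ (2 : ℝ) = ∫⁻ _, edist ω₁ ω₂ ^ 2 ∂S.μ := by simp
    _ ≤ _ := by
      refine lintegral_mono fun y => ?_
      gcongr
      exact edist_triangle_left _ _ _

omit [BorelSpace Ω] in
lemma lintegral_edist_sq_rpow_le_H (ω₁ ω₂ : Ω) :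
    (∫⁻ y, edist y ω₂ ^ 2 ∂S.μ) ^ (1 / 2 : ℝ) ≤ S.H ω₁ ω₂ := by
  unfold H
  gcongr with y
  exact le_add_self

lemma H_le_two_mul {ω₁ ω₂ : Ω} {B : ℝ≥0∞} (h₁ : ∫⁻ y, edist y ω₁ ^ 2 ∂S.μ ≤ B ^ 2)
    (h₂ : ∫⁻ y, edist y ω₂ ^ 2 ∂S.μ ≤ B ^ 2) : S.H ω₁ ω₂ ≤ 2 * B := by
  unfold H
  rw [one_div, ENNReal.rpow_inv_le_iff two_pos]
  have h3 : ∀ y, (edist y ω₁ + edist y ω₂) ^ 2 ≤ 2 * edist y ω₁ ^ 2 + 2 * edist y ω₂ ^ 2 := by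
    intro y
    have := ENNReal.rpow_add_le_mul_rpow_add_rpow (edist y ω₁) (edist y ω₂) (p := 2) (by norm_num)
    norm_num at this
    rw [mul_add] at this
    exact this
  calc _ ≤ ∫⁻ y, (2 * edist y ω₁ ^ 2 + 2 * edist y ω₂ ^ 2) ∂S.μ := lintegral_mono h3
    _ = 2 * ∫⁻ y, edist y ω₁ ^ 2 ∂S.μ + 2 * ∫⁻ y, edist y ω₂ ^ 2 ∂S.μ := by
      rw [lintegral_add_left (by fun_prop), lintegral_const_mul _ (by fun_prop),
        lintegral_const_mul _ (by fun_prop)]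
    _ ≤ 2 * B ^ 2 + 2 * B ^ 2 := by gcongr
    _ = (2 * B) ^ (2 : ℝ) := by
      simp only [ENNReal.rpow_ofNat]
      ring

lemma measurable_H [SecondCountableTopology Ω] (ω₂ : Ω) : Measurable fun ω => S.H ω ω₂ := by
  unfold H
  refine Measurable.pow_const ?_ _
  refine Measurable.lintegral_prod_right' (f := fun q : Ω × Ω =>
      (edist q.2 q.1 + edist q.2 ω₂) ^ 2) ?_
  fun_prop

variable {S} {α κ : ℝ} {C : Params}

lemma sq_moment_lt_top (hA : Assumptions S α κ C) (hκ : 2 ≤ κ) {x : Euc p} (hx : x ∈ cube p) :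
    ∫⁻ y, edist y (S.m x) ^ 2 ∂(S.η x) < ⊤ :=
  (lintegral_edist_sq_le (hA.moment x hx) hκ).trans_lt (by finiteness)

lemma M_sub_eq (hA : Assumptions S α κ C) (hκ : 2 ≤ κ) {x : Euc p} (hx : x ∈ cube p) (ω ω' : Ω) :
    S.M x ω - S.M x ω' = ∫ y, (dist y ω ^ 2 - dist y ω' ^ 2) ∂(S.η x) :=
  (integral_sub (integrable_dist_sq (sq_moment_lt_top hA hκ hx) ω)
    (integrable_dist_sq (sq_moment_lt_top hA hκ hx) ω')).symm

/-- Hölder continuity of the increments of `M` in `x`. -/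
lemma bias_le (hA : Assumptions S α κ C) (hκ : 2 ≤ κ) {x x' : Euc p} (hx : x ∈ cube p)
    (hx' : x' ∈ cube p) (ω ω' : Ω) :
    ENNReal.ofReal |(S.M x ω - S.M x ω') - (S.M x' ω - S.M x' ω')| ≤
      edist ω ω' * S.H ω ω' * ENNReal.ofReal (C.SmD * ‖x - x'‖ ^ C.β) := by
  obtain ⟨-, -, -, ρ, L, hρ, hLm, hL, hL2⟩ := hA.holder
  set g : Ω → ℝ := fun y => dist y ω ^ 2 - dist y ω' ^ 2 with hg
  -- With both increments written as `μ`-integrals of the same `g`, their difference falls on the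
  -- density, where the Hölder condition applies.
  have hrep : ∀ {z : Euc p}, z ∈ cube p →
      Integrable (fun y => ρ y z * g y) S.μ ∧ S.M z ω - S.M z ω' = ∫ y, ρ y z * g y ∂S.μ := by
    intro z hz
    obtain ⟨hm, h0, hd⟩ := hρ z hz
    have hgi : Integrable g (S.η z) := (integrable_dist_sq (sq_moment_lt_top hA hκ hz) ω).sub
      (integrable_dist_sq (sq_moment_lt_top hA hκ hz) ω')
    have hmm : Measurable fun y => ENNReal.ofReal (ρ y z) := ENNReal.measurable_ofReal.comp hm
    constructor
    · rw [hd, integrable_withDensity_iff_integrable_smul' hmm (by simp)] at hgi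
      simpa [ENNReal.toReal_ofReal (h0 _)] using hgi
    · rw [M_sub_eq hA hκ hz, hd, integral_withDensity_eq_integral_toReal_smul hmm (by simp)]
      simp [ENNReal.toReal_ofReal (h0 _), hg]
  obtain ⟨hi, he⟩ := hrep hx
  obtain ⟨hi', he'⟩ := hrep hx'
  rw [he, he', ← integral_sub hi hi', ← Real.norm_eq_abs, ofReal_norm]
  refine (enorm_integral_le_lintegral_enorm _).trans ?_
  have hpt : ∀ᵐ y ∂S.μ, ‖ρ y x * g y - ρ y x' * g y‖ₑ ≤
      (edist ω ω' * ENNReal.ofReal (‖x - x'‖ ^ C.β)) *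
        (ENNReal.ofReal (L y) * (edist y ω + edist y ω')) := by
    filter_upwards [hL] with y hy
    have h1 : ‖ρ y x * g y - ρ y x' * g y‖ ≤ (dist ω ω' * ‖x - x'‖ ^ C.β) *
        (L y * (dist y ω + dist y ω')) := by
      rw [← sub_mul, norm_mul, Real.norm_eq_abs, Real.norm_eq_abs]
      calc _ ≤ (L y * ‖x - x'‖ ^ C.β) * (dist ω ω' * (dist y ω + dist y ω')) :=
            mul_le_mul (hy.2 x hx x' hx') (abs_dist_sq_sub_le y ω ω') (abs_nonneg _)
              (mul_nonneg hy.1 (by positivity))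
        _ = _ := by ring
    rw [← ofReal_norm]
    refine (ENNReal.ofReal_le_ofReal h1).trans (le_of_eq ?_)
    rw [ENNReal.ofReal_mul (by positivity), ENNReal.ofReal_mul dist_nonneg, ENNReal.ofReal_mul hy.1,
      ENNReal.ofReal_add dist_nonneg dist_nonneg, ← edist_dist, ← edist_dist, ← edist_dist]
  refine (lintegral_mono_ae hpt).trans ?_
  have hLm' : AEMeasurable (fun y => ENNReal.ofReal (L y)) S.μ := hLm.ennreal_ofReal
  have hLm'' : AEMeasurable (fun y => ENNReal.ofReal (L y) * (edist y ω + edist y ω')) S.μ :=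
    hLm'.mul (by fun_prop)
  rw [lintegral_const_mul'' _ hLm'']
  -- Cauchy–Schwarz separates `L` from the sum of distances, whose `L²(μ)` norm is `H`.
  have hCS := ENNReal.lintegral_mul_le_Lp_mul_Lq S.μ (p := 2) (q := 2)
      Real.HolderConjugate.two_two hLm'
    (g := fun y => edist y ω + edist y ω') (by fun_prop)
  simp only [Pi.mul_apply, ENNReal.rpow_ofNat] at hCS
  have hSmD := C.one_le_SmD
  have h3 : (∫⁻ y, ENNReal.ofReal (L y) ^ 2 ∂S.μ) ^ (1 / 2 : ℝ) ≤ ENNReal.ofReal C.SmD := by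
    rw [one_div, ENNReal.rpow_inv_le_iff two_pos]
    refine hL2.trans (le_of_eq ?_)
    rw [ENNReal.ofReal_pow (by linarith)]
    simp
  have h4 := hCS.trans (mul_le_mul_left h3 _)
  change _ ≤ ENNReal.ofReal C.SmD * S.H ω ω' at h4
  refine (mul_le_mul_right h4 _).trans (le_of_eq ?_)
  rw [ENNReal.ofReal_mul (by linarith)]
  ring

omit [BorelSpace Ω] in
-- `H (mhat, m x)` dominates the `L²(μ)` norm of the distance to `m x`, which does not involve the
-- sample; the bias moment condition therefore bounds that norm.
lemma lintegral_edist_sq_le_Bom (hκ : 2 ≤ κ) {n : ℕ} {mhat : (Fin n → Euc p × Ω) → Euc p → Ω}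
    (hb : S.BiasMoment κ C mhat) {x : Euc p} (hx : x ∈ cube p) :
    ∫⁻ y, edist y (S.m x) ^ 2 ∂S.μ ≤ ENNReal.ofReal C.Bom ^ 2 := by
  obtain ⟨xs, hxs⟩ := (hb x hx).exists
  have hκ0 : κ ≠ 0 := by linarith
  set c := (∫⁻ y, edist y (S.m x) ^ 2 ∂S.μ) ^ (1 / 2 : ℝ) with hc
  have h1 : c ≤ ENNReal.ofReal C.Bom := by
    refine le_trans ?_ hxs
    calc c = (∫⁻ ys : Fin n → Ω, c ^ κ ∂(Measure.pi fun i => S.η (xs i))) ^ (1 / κ) := by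
          rw [lintegral_const, measure_univ, mul_one, ← ENNReal.rpow_mul, mul_one_div_cancel hκ0,
            ENNReal.rpow_one]
      _ ≤ _ := by
          gcongr with ys
          exact S.lintegral_edist_sq_rpow_le_H _ _
  rw [hc, one_div, ENNReal.rpow_inv_le_iff two_pos] at h1
  simpa using h1

/-- Hölder continuity of the conditional Fréchet mean. -/
lemma dist_m_le (hA : Assumptions S α κ C) (hκ : 2 ≤ κ)
    (hμ : ∀ x ∈ cube p, ∫⁻ y, edist y (S.m x) ^ 2 ∂S.μ ≤ ENNReal.ofReal C.Bom ^ 2)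
    {x x' : Euc p} (hx : x ∈ cube p) (hx' : x' ∈ cube p) :
    dist (S.m x') (S.m x) ≤ C.Vlo * C.SmD * C.Bom * ‖x' - x‖ ^ C.β := by
  set d := dist (S.m x') (S.m x) with hd
  have hV := C.one_le_Vlo
  have hS := C.one_le_SmD
  have hB := C.one_le_Bom
  rcases (dist_nonneg : 0 ≤ dist (S.m x') (S.m x)).eq_or_lt with h0 | h0
  · rw [hd, ← h0]; positivity
  rw [← hd] at h0
  have h1 := hA.varIneq x hx (S.m x')
  have h2 := hA.varIneq x' hx' (S.m x)
  rw [dist_comm (S.m x)] at h2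
  have h3 := bias_le hA hκ hx hx' (S.m x') (S.m x)
  have h4 := S.H_le_two_mul (hμ x' hx') (hμ x hx)
  have h5 := h3.trans (mul_le_mul_left (mul_le_mul_right h4 _) _)
  rw [edist_dist, ← hd] at h5
  have e2 : (2 : ℝ≥0∞) * ENNReal.ofReal C.Bom = ENNReal.ofReal (2 * C.Bom) := by
    rw [ENNReal.ofReal_mul (by norm_num)]; norm_num
  rw [e2, ← ENNReal.ofReal_mul h0.le, ← ENNReal.ofReal_mul (by positivity),
    ENNReal.ofReal_le_ofReal_iff (by positivity)] at h5
  have h6 := (le_abs_self _).trans h5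
  rw [norm_sub_rev x x'] at h6
  -- Adding the variance inequalities at `x` and at `x'` leaves exactly the mixed increment bounded
  -- by `bias_le`.
  have h7 : 2 * (C.Vlo⁻¹ * d ^ 2) ≤ d * (2 * C.Bom) * (C.SmD * ‖x' - x‖ ^ C.β) := by linarith
  have h8 : d * (C.Vlo⁻¹ * d) ≤ d * (C.Bom * C.SmD * ‖x' - x‖ ^ C.β) := by linarith
  have h9 := le_of_mul_le_mul_left h8 h0
  rw [inv_mul_le_iff₀ (by linarith)] at h9
  linarith

/-- The conditional mean squared error given the covariates. -/
theorem conditional_risk_le (hA : Assumptions S α κ C) (hα : 1 ≤ α) (hα' : α < 2)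
    (hκ : 2 < κ) (hκα : 2 / (2 - α) < κ)
    (hμ : ∀ x ∈ cube p, ∫⁻ y, edist y (S.m x) ^ 2 ∂S.μ ≤ ENNReal.ofReal C.Bom ^ 2)
    {x : Euc p} (hx : x ∈ cube p) {n : ℕ} {xs : Fin n → Euc p} (hxs : ∀ i, xs i ∈ cube p)
    {w : Fin n → ℝ} (hw : ∀ i, 0 ≤ w i) (hw1 : ∑ i, w i = 1) {r : ℝ} (hr : 0 ≤ r)
    (hr1 : ∑ i, w i * ‖xs i - x‖ ^ (2 * C.β) ≤ r)
    (hr2 : ∑ i, w i ^ 2 * ‖xs i - x‖ ^ (2 * C.β) ≤ r * ∑ i, w i ^ 2)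
    {F : (Fin n → Ω) → Ω} (hFm : Measurable F)
    (hF : ∀ᵐ ys ∂(Measure.pi fun i => S.η (xs i)),
      ∑ i, w i * dist (ys i) (F ys) ^ 2 ≤ ∑ i, w i * dist (ys i) (S.m x) ^ 2)
    (hH : (∫⁻ ys, S.H (F ys) (S.m x) ^ κ ∂(Measure.pi fun i => S.η (xs i))) ^ (1 / κ) ≤
      ENNReal.ofReal C.Bom) :
    ∫⁻ ys, edist (F ys) (S.m x) ^ 2 ∂(Measure.pi fun i => S.η (xs i)) ≤
      ENNReal.ofReal (peelConst α κ * (C.Vlo * C.SmD * C.Bom) ^ (2 / (2 - α)) * r +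
        peelConst α κ * (C.Vlo * C.Mom * C.Ent) ^ (2 / (2 - α)) * ∑ i, w i ^ 2) := by
  have : SecondCountableTopology Ω := hA.entropy.secondCountableTopology (by linarith)
  have hV := C.one_le_Vlo
  have hS := C.one_le_SmD
  have hB := C.one_le_Bom
  have hM := C.one_le_Mom
  have hE := C.one_le_Ent
  have hpc := peelConst_ge hα' (by linarith) hκα
  set W := C.Vlo * C.SmD * C.Bom with hW
  have hVS : 1 ≤ C.Vlo * C.SmD := one_le_mul_of_one_le_of_one_le hV hS
  have hW1 : 1 ≤ W := one_le_mul_of_one_le_of_one_le hVS hB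
  have hWpow : W ^ 2 ≤ W ^ (2 / (2 - α)) := by
    calc W ^ 2 = W ^ (2 : ℝ) := by norm_num
      _ ≤ _ := by
        apply Real.rpow_le_rpow_of_exponent_le hW1
        rw [le_div_iff₀ (by linarith)]; linarith
  have hq0 : 0 ≤ ∑ i, w i ^ 2 := Finset.sum_nonneg fun i _ => sq_nonneg _
  set P : Fin n → Measure Ω := fun i => S.η (xs i) with hP
  -- By the Hölder bound for `m`, this controls the weighted quadratic mean of the distances from `m
  -- (xs i)` to `m x`.
  set b := W * Real.sqrt r with hbdef
  have hb2 : b ^ 2 = W ^ 2 * r := by rw [hbdef, mul_pow, Real.sq_sqrt hr]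
  have hdm : ∀ i, dist (S.m (xs i)) (S.m x) ^ 2 ≤ W ^ 2 * ‖xs i - x‖ ^ (2 * C.β) := by
    intro i
    have h1 := dist_m_le hA hκ.le hμ hx (hxs i)
    calc _ ≤ (W * ‖xs i - x‖ ^ C.β) ^ 2 := by gcongr
      _ = _ := by
        rw [mul_pow, ← Real.rpow_natCast (‖xs i - x‖ ^ C.β), ← Real.rpow_mul (norm_nonneg _)]
        congr 2; push_cast; ring
  have hsample : WeightedSample P w (S.m x) (fun i => S.m (xs i)) κ C.Mom b := by
    refine ⟨hκ, hw, hw1, hM, by positivity, fun i => inferInstance, fun i => hA.moment _ (hxs i),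
        ?_, ?_⟩
    · rw [hb2]
      calc _ ≤ ∑ i, w i * (W ^ 2 * ‖xs i - x‖ ^ (2 * C.β)) :=
            Finset.sum_le_sum fun i _ => mul_le_mul_of_nonneg_left (hdm i) (hw i)
        _ = W ^ 2 * ∑ i, w i * ‖xs i - x‖ ^ (2 * C.β) := by
            rw [Finset.mul_sum]; exact Finset.sum_congr rfl fun i _ => by ring
        _ ≤ _ := by gcongr
    · rw [hb2]
      calc _ ≤ ∑ i, w i ^ 2 * (W ^ 2 * ‖xs i - x‖ ^ (2 * C.β)) :=
            Finset.sum_le_sum fun i _ => mul_le_mul_of_nonneg_left (hdm i) (sq_nonneg _)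
        _ = W ^ 2 * ∑ i, w i ^ 2 * ‖xs i - x‖ ^ (2 * C.β) := by
            rw [Finset.mul_sum]; exact Finset.sum_congr rfl fun i _ => by ring
        _ ≤ W ^ 2 * (r * ∑ i, w i ^ 2) := by gcongr
        _ = _ := by ring
  have hT0 : 0 ≤ (C.Vlo * C.Mom * C.Ent) ^ (2 / (2 - α)) := by positivity
  -- If the spread of the means already exceeds the noise, the crude bound `8 Mom² + 8 b² ≤ 16 b²`
  -- fits into the bias term.
  by_cases hbM : C.Mom ≤ b
  · refine (hsample.lintegral_sq_le hF).trans (ENNReal.ofReal_le_ofReal ?_)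
    have h1 : 8 * C.Mom ^ 2 + 8 * b ^ 2 ≤ 16 * (W ^ 2 * r) := by
      have : C.Mom ^ 2 ≤ b ^ 2 := by gcongr
      rw [← hb2]; linarith
    have h2 : 16 * (W ^ 2 * r) ≤ peelConst α κ * W ^ (2 / (2 - α)) * r := by
      rw [mul_assoc]
      gcongr
      linarith
    have h3 : 0 ≤ peelConst α κ * (C.Vlo * C.Mom * C.Ent) ^ (2 / (2 - α)) * ∑ i, w i ^ 2 :=
      mul_nonneg (mul_nonneg (by linarith) hT0) hq0
    linarith
  push Not at hbM
  set s := ∑ i, w i * ‖xs i - x‖ ^ C.β with hs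
  have hs0 : 0 ≤ s := Finset.sum_nonneg fun i _ => mul_nonneg (hw i) (by positivity)
  have hs2 : s ^ 2 ≤ r := by
    have h1 : s ^ 2 ≤ ∑ i, w i * (‖xs i - x‖ ^ C.β) ^ 2 :=
      (convexOn_pow 2).map_sum_le (t := Finset.univ) (w := w) (p := fun i => ‖xs i - x‖ ^ C.β)
        (fun i _ => hw i) hw1 (fun i _ => by simp only [Set.mem_Ici]; positivity)
    refine h1.trans (le_trans (le_of_eq ?_) hr1)
    refine Finset.sum_congr rfl fun i _ => ?_
    rw [← Real.rpow_natCast (‖xs i - x‖ ^ C.β), ← Real.rpow_mul (norm_nonneg _)]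
    congr 2; push_cast; ring
  set Hb : (Fin n → Ω) → ℝ≥0∞ := fun ys =>
    (ENNReal.ofReal (2 * C.Vlo * C.SmD * s) * S.H (F ys) (S.m x)) ^ 2 with hHb
  -- Either the deviation accounts for half of the increment at `x`, or the bias does.
  have hdev : ∀ᵐ ys ∂(Measure.pi P), edist (F ys) (S.m x) ^ 2 ≤ Hb ys ∨
      dist (F ys) (S.m x) ^ 2 ≤ 2 * C.Vlo * |deviation P w (S.m x) ys (F ys)| := by
    filter_upwards [hF] with ys hys
    set D := dist (F ys) (S.m x) with hD
    by_cases hdv : D ^ 2 ≤ 2 * C.Vlo * |deviation P w (S.m x) ys (F ys)|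
    · exact Or.inr hdv
    left
    push Not at hdv
    have hD0 : 0 < D := by
      rcases (dist_nonneg : 0 ≤ dist (F ys) (S.m x)).eq_or_lt with h0 | h0
      · rw [hD, ← h0] at hdv
        have : 0 ≤ 2 * C.Vlo * |deviation P w (S.m x) ys (F ys)| := by positivity
        norm_num at hdv
        linarith
      · exact h0
    set Δ : Euc p → ℝ := fun z => S.M z (F ys) - S.M z (S.m x) with hΔ
    have h1 : C.Vlo⁻¹ * D ^ 2 ≤ Δ x := hA.varIneq x hx (F ys)
    -- Minimality makes the empirical increment nonpositive, so the weighted mean of the `Δ (xs i)`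
    -- is at most the negative of the deviation.
    have h2 : ∑ i, w i * Δ (xs i) ≤ |deviation P w (S.m x) ys (F ys)| := by
      have h3 : deviation P w (S.m x) ys (F ys) = (∑ i, w i * dist (ys i) (F ys) ^ 2 -
          ∑ i, w i * dist (ys i) (S.m x) ^ 2) - ∑ i, w i * Δ (xs i) := by
        simp only [deviation, devTerm]
        rw [← Finset.sum_sub_distrib, ← Finset.sum_sub_distrib]
        refine Finset.sum_congr rfl fun i _ => ?_
        rw [integral_const_mul, ← M_sub_eq hA hκ.le (hxs i)]
        ring
      have := neg_abs_le (deviation P w (S.m x) ys (F ys))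
      linarith
    have h4 : Δ x = ∑ i, w i * (Δ x - Δ (xs i)) + ∑ i, w i * Δ (xs i) := by
      rw [← Finset.sum_add_distrib]
      simp_rw [← mul_add, sub_add_cancel]
      rw [← Finset.sum_mul, hw1, one_mul]
    have h5 : D * (D / (2 * C.Vlo)) ≤ ∑ i, w i * |Δ x - Δ (xs i)| := by
      have h6 : ∑ i, w i * (Δ x - Δ (xs i)) ≤ ∑ i, w i * |Δ x - Δ (xs i)| :=
        Finset.sum_le_sum fun i _ => mul_le_mul_of_nonneg_left (le_abs_self _) (hw i)
      have h7 : |deviation P w (S.m x) ys (F ys)| ≤ D ^ 2 / (2 * C.Vlo) := by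
        rw [le_div_iff₀ (by linarith)]; linarith
      have h8 : C.Vlo⁻¹ * D ^ 2 = D ^ 2 / (2 * C.Vlo) + D * (D / (2 * C.Vlo)) := by
        field_simp; ring
      linarith
    have h9 : ENNReal.ofReal D * ENNReal.ofReal (D / (2 * C.Vlo)) ≤
        ENNReal.ofReal D * (S.H (F ys) (S.m x) * ENNReal.ofReal (C.SmD * s)) := by
      rw [← ENNReal.ofReal_mul hD0.le]
      refine (ENNReal.ofReal_le_ofReal h5).trans ?_
      rw [ENNReal.ofReal_sum_of_nonneg fun i _ => mul_nonneg (hw i) (abs_nonneg _)]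
      have h10 : ∀ i ∈ Finset.univ, ENNReal.ofReal (w i * |Δ x - Δ (xs i)|) ≤
          ENNReal.ofReal D * S.H (F ys) (S.m x) *
            ENNReal.ofReal (C.SmD * (w i * ‖xs i - x‖ ^ C.β)) := by
        intro i _
        rw [ENNReal.ofReal_mul (hw i)]
        refine (mul_le_mul_right (bias_le hA hκ.le hx (hxs i) _ _) _).trans (le_of_eq ?_)
        rw [edist_dist, norm_sub_rev x, show C.SmD * (w i * ‖xs i - x‖ ^ C.β) =
          w i * (C.SmD * ‖xs i - x‖ ^ C.β) by ring, ENNReal.ofReal_mul (hw i)]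
        ring
      refine (Finset.sum_le_sum h10).trans (le_of_eq ?_)
      rw [← Finset.mul_sum, ← ENNReal.ofReal_sum_of_nonneg fun i _ => mul_nonneg (by linarith)
        (mul_nonneg (hw i) (by positivity)), ← Finset.mul_sum, mul_assoc]
    -- Cancelling one factor `D` turns a bound for `D²` into a bound for `D`.
    have h11 := (ENNReal.mul_le_mul_iff_right (by simpa using hD0) (by finiteness)).1 h9
    rw [hHb]
    simp only
    gcongr
    rw [edist_dist, ← hD]
    have e1 : ENNReal.ofReal D = ENNReal.ofReal (2 * C.Vlo) * ENNReal.ofReal (D / (2 * C.Vlo)) := by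
      rw [← ENNReal.ofReal_mul (by linarith)]; congr 1; field_simp
    rw [e1]
    refine (mul_le_mul_right h11 _).trans (le_of_eq ?_)
    rw [show 2 * C.Vlo * C.SmD * s = (2 * C.Vlo) * (C.SmD * s) by ring,
      ENNReal.ofReal_mul (p := 2 * C.Vlo) (by linarith)]
    ring
  have hmain := hsample.lintegral_sq_le_of_deviation hbM.le hα hα' hκα hE hV hA.entropy hF hdev
  have hHbint : ∫⁻ ys, Hb ys ∂(Measure.pi P) ≤ ENNReal.ofReal (4 * (W ^ 2 * r)) := by
    simp only [hHb, mul_pow]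
    rw [lintegral_const_mul' _ _ (by finiteness)]
    have h1 := (lintegral_rpow_le_lintegral_rpow (Measure.pi P) (f := fun ys => S.H (F ys) (S.m x))
      ((S.measurable_H (S.m x)).comp hFm).aemeasurable two_pos hκ.le).trans hH
    rw [one_div, ENNReal.rpow_inv_le_iff two_pos] at h1
    simp only [ENNReal.rpow_ofNat] at h1
    refine (mul_le_mul_right h1 _).trans ?_
    rw [← ENNReal.ofReal_pow (by positivity), ← ENNReal.ofReal_pow (by linarith),
      ← ENNReal.ofReal_mul (by positivity)]
    apply ENNReal.ofReal_le_ofReal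
    calc _ = 4 * (W ^ 2 * s ^ 2) := by rw [hW]; ring
      _ ≤ _ := by gcongr
  refine hmain.trans ((add_le_add_left hHbint _).trans ?_)
  rw [← ENNReal.ofReal_add (by positivity) (mul_nonneg (mul_nonneg (by linarith) hT0) hq0)]
  apply ENNReal.ofReal_le_ofReal
  have h2 : 4 * (W ^ 2 * r) ≤ peelConst α κ * W ^ (2 / (2 - α)) * r := by
    rw [mul_assoc]
    gcongr
    linarith
  linarith

end Setting

/-! ### Counting sample points in cells. -/

section Selection

variable {X : Type*} [MeasurableSpace X] (ν : Measure X) [IsProbabilityMeasure ν]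

/-- Distinct coordinates of an i.i.d. sample are again i.i.d.; this is used for transpositions and
for blocks of indices. -/
lemma measurePreserving_comp_injective {ι ι' : Type*} [Fintype ι] [Fintype ι'] {e : ι' → ι}
    (he : Function.Injective e) :
    MeasurePreserving (fun (z : ι → X) => z ∘ e) (Measure.pi fun _ => ν)
      (Measure.pi fun _ => ν) := by
  refine ⟨by fun_prop, ?_⟩
  have h1 : iIndepFun (fun i (z : ι → X) => z i) (Measure.pi fun _ : ι => ν) :=
    iIndepFun_pi (X := fun _ x => x) fun _ => aemeasurable_id
  have h2 := h1.precomp he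
  rw [iIndepFun_iff_map_fun_eq_pi_map (fun i => (measurable_pi_apply (e i)).aemeasurable)] at h2
  refine h2.trans ?_
  congr 1
  funext i
  exact (measurePreserving_eval (fun _ : ι => ν) (e i)).map_eq

variable {J : Type*} [Fintype J] [DecidableEq J]

/-- The number of points of `z` in the cell of `x`. -/
noncomputable def cellCount (c : X → J) {ι : Type*} [Fintype ι] (z : ι → X) (x : X) : ℝ≥0∞ :=
  ∑ j, if c (z j) = c x then 1 else 0

omit [MeasurableSpace X] in
-- A cell with `N ≥ 1` points contributes `N` terms `1 / N`, so each occupied cell counts once.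
lemma sum_inv_cellCount_le (c : X → J) {ι : Type*} [Fintype ι] (z : ι → X) :
    ∑ i, (cellCount c z (z i))⁻¹ ≤ Fintype.card J := by
  rw [← Finset.sum_fiberwise (g := fun i => c (z i))]
  have h1 : ∀ a ∈ Finset.univ, ∑ i with c (z i) = a, (cellCount c z (z i))⁻¹ ≤ 1 := by
    intro a _
    have h2 : ∀ i ∈ Finset.univ.filter (fun i => c (z i) = a), (cellCount c z (z i))⁻¹ =
        ((Finset.univ.filter (fun i => c (z i) = a)).card : ℝ≥0∞)⁻¹ := by
      intro i hi
      rw [Finset.mem_filter] at hi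
      simp [cellCount, hi.2]
    rw [Finset.sum_congr rfl h2, Finset.sum_const, nsmul_eq_mul]
    exact ENNReal.mul_inv_le_one _
  refine (Finset.sum_le_sum h1).trans ?_
  simp

variable [MeasurableSpace J] [MeasurableSingletonClass J]

lemma measurable_cellCount {c : X → J} (hc : Measurable c) {ι : Type*} [Fintype ι] :
    Measurable fun q : X × (ι → X) => cellCount c q.2 q.1 := by
  unfold cellCount
  refine Finset.measurable_sum _ fun j _ => Measurable.ite ?_ measurable_const measurable_const
  exact measurableSet_eq_fun (hc.comp ((measurable_pi_apply j).comp measurable_snd))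
    (hc.comp measurable_fst)

/-- The mean of the inverse number of points in the cell of an independent point. -/
lemma lintegral_inv_one_add_cellCount_le {c : X → J} (hc : Measurable c) (n : ℕ) :
    ∫⁻ x, ∫⁻ xs, (1 + cellCount c xs x)⁻¹ ∂(Measure.pi fun _ : Fin n => ν) ∂ν ≤
      Fintype.card J * ((n : ℝ≥0∞) + 1)⁻¹ := by
  set Q := Measure.pi fun _ : Fin (n + 1) => ν with hQ
  have hm : ∀ i : Fin (n + 1), Measurable fun z : Fin (n + 1) → X => (cellCount c z (z i))⁻¹ := by
    intro i
    have h0 : Measurable fun z : Fin (n + 1) → X => (z i, z) :=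
      (measurable_pi_apply i).prodMk measurable_id
    exact ((measurable_cellCount hc).comp h0).inv
  -- Exchangeability: transposing `0` and `i` preserves the law and permutes the terms of the count.
  have h1 : ∀ i : Fin (n + 1), ∫⁻ z, (cellCount c z (z i))⁻¹ ∂Q =
      ∫⁻ z, (cellCount c z (z 0))⁻¹ ∂Q := by
    intro i
    have hp := measurePreserving_comp_injective ν (Equiv.swap 0 i).injective
    refine Eq.trans (lintegral_congr fun z => ?_) (hp.lintegral_comp (hm 0))
    have h := Equiv.sum_comp (Equiv.swap 0 i) fun j => if c (z j) = c (z i) then (1 : ℝ≥0∞) else 0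
    simp only [Function.comp, Equiv.swap_apply_left, cellCount]
    rw [h]
  -- The independent point `x` becomes the zeroth of `n + 1` points; the `1 +` counts the point
  -- itself.
  have h2 : ∫⁻ z, (cellCount c z (z 0))⁻¹ ∂Q =
      ∫⁻ x, ∫⁻ xs, (1 + cellCount c xs x)⁻¹ ∂(Measure.pi fun _ : Fin n => ν) ∂ν := by
    have hmm : Measurable fun q : X × (Fin n → X) => (1 + cellCount c q.2 q.1)⁻¹ :=
      ((measurable_cellCount hc).const_add 1).inv
    rw [← lintegral_prod _ hmm.aemeasurable]
    have hp := measurePreserving_piFinSuccAbove (fun _ : Fin (n + 1) => ν) 0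
    rw [← hp.lintegral_comp hmm]
    refine lintegral_congr fun z => ?_
    have hz : MeasurableEquiv.piFinSuccAbove (fun _ : Fin (n + 1) => X) 0 z =
        (z 0, Fin.tail z) := by
      simp [MeasurableEquiv.piFinSuccAbove, Fin.insertNthEquiv]
    rw [hz]
    unfold cellCount
    rw [Fin.sum_univ_succ, if_pos rfl]
    rfl
  have h3 : ((n : ℝ≥0∞) + 1) * ∫⁻ z, (cellCount c z (z 0))⁻¹ ∂Q ≤ Fintype.card J := by
    calc _ = ∑ i : Fin (n + 1), ∫⁻ z, (cellCount c z (z i))⁻¹ ∂Q := by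
          simp_rw [h1]; simp
      _ = ∫⁻ z, ∑ i : Fin (n + 1), (cellCount c z (z i))⁻¹ ∂Q := by
          rw [lintegral_finsetSum _ fun i _ => hm i]
      _ ≤ ∫⁻ _, (Fintype.card J : ℝ≥0∞) ∂Q := lintegral_mono fun z => sum_inv_cellCount_le c z
      _ = _ := by simp
  rw [← h2]
  rw [mul_comm] at h3
  rw [← div_eq_mul_inv]
  exact (ENNReal.le_div_iff_mul_le (Or.inl (by simp)) (Or.inl (by finiteness))).2 h3

end Selection

/-! ### The regular grid on the unit cube. -/

section Cube

variable {p : ℕ}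

/-- The cell of side `1 / (M + 1)` of a point of the cube. -/
noncomputable def cubeCell (M : ℕ) (x : Euc p) : Fin p → Fin (M + 1) :=
  fun i => ⟨min ⌊((M : ℝ) + 1) * x i⌋₊ M, by omega⟩

lemma measurable_cubeCell (M : ℕ) : Measurable (cubeCell M : Euc p → Fin p → Fin (M + 1)) := by
  refine measurable_pi_lambda _ fun i => ?_
  have h1 : Measurable fun x : Euc p => ⌊((M : ℝ) + 1) * x i⌋₊ := by fun_prop
  exact (measurable_from_top (f := fun k : ℕ => (⟨min k M, by omega⟩ : Fin (M + 1)))).comp h1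

lemma norm_sub_le_of_cubeCell_eq {M : ℕ} {x y : Euc p} (hx : x ∈ cube p) (hy : y ∈ cube p)
    (h : cubeCell M x = cubeCell M y) : ‖x - y‖ ≤ Real.sqrt p / (M + 1) := by
  have hM : (0 : ℝ) < (M : ℝ) + 1 := by positivity
  have hloc : ∀ t : ℝ, t ∈ Set.Icc (0 : ℝ) 1 →
      ((min ⌊((M : ℝ) + 1) * t⌋₊ M : ℕ) : ℝ) ≤ ((M : ℝ) + 1) * t ∧
      ((M : ℝ) + 1) * t ≤ ((min ⌊((M : ℝ) + 1) * t⌋₊ M : ℕ) : ℝ) + 1 := by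
    intro t ht
    have h0 : 0 ≤ ((M : ℝ) + 1) * t := mul_nonneg hM.le ht.1
    constructor
    · exact (Nat.cast_le.2 (min_le_left _ _)).trans (Nat.floor_le h0)
    -- When the minimum is `M`, the bound uses `t ≤ 1`; this puts the closing face `t = 1` into the
    -- last cell.
    · rcases min_choice ⌊((M : ℝ) + 1) * t⌋₊ M with h | h <;> rw [h]
      · exact (Nat.lt_floor_add_one _).le
      · nlinarith [ht.2]
  have hcoord : ∀ i, (x i - y i) ^ 2 ≤ (1 / ((M : ℝ) + 1)) ^ 2 := by
    intro i
    have h1 := hloc (x i) (hx i)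
    have h2 := hloc (y i) (hy i)
    have h3 : min ⌊((M : ℝ) + 1) * x i⌋₊ M = min ⌊((M : ℝ) + 1) * y i⌋₊ M := by
      have := congrFun h i
      simpa [cubeCell] using this
    rw [h3] at h1
    apply sq_le_sq'
    · rw [neg_le, ← sub_nonneg]
      have : 0 ≤ (1 - ((M : ℝ) + 1) * (y i - x i)) / ((M : ℝ) + 1) := div_nonneg (by linarith) hM.le
      calc (0:ℝ) ≤ _ := this
        _ = _ := by field_simp; ring
    · rw [← sub_nonneg]
      have : 0 ≤ (1 - ((M : ℝ) + 1) * (x i - y i)) / ((M : ℝ) + 1) := div_nonneg (by linarith) hM.le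
      calc (0:ℝ) ≤ _ := this
        _ = _ := by field_simp
  rw [EuclideanSpace.norm_eq]
  apply Real.sqrt_le_iff.2 ⟨by positivity, ?_⟩
  calc ∑ i, ‖(x - y) i‖ ^ 2 ≤ ∑ _i : Fin p, (1 / ((M : ℝ) + 1)) ^ 2 :=
        Finset.sum_le_sum fun i _ => by
          rw [Real.norm_eq_abs, sq_abs]
          exact hcoord i
    _ = _ := by
        rw [div_pow, div_pow, Real.sq_sqrt (by positivity)]
        simp [div_eq_mul_inv]

lemma norm_sub_le_sqrt {x y : Euc p} (hx : x ∈ cube p) (hy : y ∈ cube p) :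
    ‖x - y‖ ≤ Real.sqrt p := by
  have := norm_sub_le_of_cubeCell_eq (M := 0) hx hy
    (by funext i; apply Fin.ext; simp [cubeCell])
  simpa using this

end Cube

/-! ### From dyadic tails to moments. -/

section Dyadic

/-- Moment bound from a tail bound along dyadic levels. -/
lemma lintegral_rpow_le_of_dyadic_tail {Z : Type*} [MeasurableSpace Z] (Q : Measure Z)
    [IsProbabilityMeasure Q] {f : Z → ℝ≥0∞} (hf : Measurable f) (hfin : ∀ z, f z ≠ ⊤) {ε β c₀ : ℝ}
    (hε : 0 < ε) (hβ : 0 < β) (hβ1 : β ≤ 1) (hc₀ : 0 ≤ c₀)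
    (htail : ∀ j : ℕ, Q {z | ENNReal.ofReal (2 ^ j * ε) < f z} ≤
      ENNReal.ofReal (c₀ * (1 / 8) ^ j)) :
    ∫⁻ z, f z ^ (2 * β) ∂Q ≤ ENNReal.ofReal ((1 + 8 * c₀) * ε ^ (2 * β)) := by
  set E : ℕ → Set Z := fun j => {z | ENNReal.ofReal (2 ^ j * ε) < f z} with hE
  have hEm : ∀ j, MeasurableSet (E j) := fun j => measurableSet_lt measurable_const hf
  set a : ℕ → ℝ≥0∞ := fun j => ENNReal.ofReal ((2 ^ (j + 1) * ε) ^ (2 * β)) with ha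
  have hβ2 : 0 ≤ 2 * β := by linarith
  have hpt : ∀ z, f z ^ (2 * β) ≤ ENNReal.ofReal (ε ^ (2 * β)) +
      ∑' j, (E j).indicator (fun _ => a j) z := by
    intro z
    have hfz := ENNReal.ofReal_toReal (hfin z)
    set t := (f z).toReal with ht
    have ht0 : 0 ≤ t := ENNReal.toReal_nonneg
    rw [← hfz, ENNReal.ofReal_rpow_of_nonneg ht0 hβ2]
    by_cases hle : t ≤ ε
    · refine le_trans ?_ le_self_add
      apply ENNReal.ofReal_le_ofReal
      gcongr
    push Not at hle
    refine le_trans ?_ le_add_self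
    have hex : ∃ j : ℕ, t ≤ 2 ^ (j + 1) * ε := by
      obtain ⟨j, hj⟩ := pow_unbounded_of_one_lt (t / ε) (one_lt_two)
      refine ⟨j, ?_⟩
      rw [div_lt_iff₀ hε] at hj
      refine hj.le.trans ?_
      gcongr
      · norm_num
      · omega
    -- The least such `j` gives the dyadic level of `t`.
    classical
    obtain ⟨j, hj1, hj2⟩ : ∃ j : ℕ, t ≤ 2 ^ (j + 1) * ε ∧ 2 ^ j * ε < t := by
      refine ⟨Nat.find hex, Nat.find_spec hex, ?_⟩
      rcases h0 : Nat.find hex with _ | k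
      · simpa using hle
      · have := Nat.find_min hex (m := k) (by omega)
        push Not at this
        exact this
    refine le_trans ?_ (ENNReal.le_tsum j)
    rw [Set.indicator_of_mem]
    · apply ENNReal.ofReal_le_ofReal
      gcongr
    · change ENNReal.ofReal _ < f z
      rw [← hfz]
      exact (ENNReal.ofReal_lt_ofReal_iff (by linarith)).2 hj2
  refine (lintegral_mono hpt).trans ?_
  rw [lintegral_add_left measurable_const, lintegral_const, measure_univ, mul_one,
    lintegral_tsum fun j => (measurable_const.indicator (hEm j)).aemeasurable]
  have h1 : ∀ j, ∫⁻ z, (E j).indicator (fun _ => a j) z ∂Q ≤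
      ENNReal.ofReal (4 * c₀ * ε ^ (2 * β) * (1 / 2) ^ j) := by
    intro j
    rw [lintegral_indicator (hEm j), setLIntegral_const]
    refine (mul_le_mul_right (htail j) _).trans ?_
    rw [ha, ← ENNReal.ofReal_mul (by positivity)]
    apply ENNReal.ofReal_le_ofReal
    rw [Real.mul_rpow (by positivity) hε.le]
    -- As `β ≤ 1`, a level costs at most a factor `4`; against the tail factor `1 / 8` this leaves
    -- the ratio `1 / 2`.
    have h2 : ((2 : ℝ) ^ (j + 1)) ^ (2 * β) ≤ 4 * 4 ^ j := by
      calc ((2 : ℝ) ^ (j + 1)) ^ (2 * β) ≤ ((2 : ℝ) ^ (j + 1)) ^ (2 : ℝ) :=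
            Real.rpow_le_rpow_of_exponent_le (one_le_pow₀ (by norm_num)) (by linarith)
        _ = 4 * 4 ^ j := by
            rw [Real.rpow_ofNat, ← pow_mul, mul_comm, pow_mul, pow_succ']; norm_num
    calc _ ≤ (4 * 4 ^ j) * ε ^ (2 * β) * (c₀ * (1 / 8) ^ j) := by gcongr
      _ = 4 * c₀ * ε ^ (2 * β) * (4 * (1 / 8)) ^ j := by rw [mul_pow]; ring
      _ = _ := by norm_num
  refine (add_le_add_right (ENNReal.tsum_le_tsum h1) _).trans ?_
  rw [← ENNReal.ofReal_tsum_of_nonneg (fun j => by positivity)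
      (summable_geometric_two.mul_left _), tsum_mul_left, tsum_geometric_two,
      ← ENNReal.ofReal_add (by positivity) (by positivity)]
  apply ENNReal.ofReal_le_ofReal
  apply le_of_eq
  ring

end Dyadic

/-! ### From conditional risk to risk, and two crude conditional bounds. -/

namespace Setting

variable {p : ℕ} {Ω : Type u} [MetricSpace Ω] [MeasurableSpace Ω] [BorelSpace Ω] {S : Setting p Ω}
  {α κ : ℝ} {C : Params} {n : ℕ} {mhat : (Fin n → Euc p × Ω) → Euc p → Ω}

lemma risk_le_lintegral (hm : Measurable fun q : (Fin n → Euc p × Ω) × Euc p => mhat q.1 q.2)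
    {Φ : Euc p → (Fin n → Euc p) → ℝ≥0∞}
    (h : ∀ x ∈ cube p, ∀ᵐ xs ∂(Measure.pi fun _ : Fin n => S.νX),
      ∫⁻ ys, edist (mhat (fun i => (xs i, ys i)) x) (S.m x) ^ 2
        ∂(Measure.pi fun i => S.η (xs i)) ≤ Φ x xs) :
    S.risk mhat ≤ ∫⁻ x, ∫⁻ xs, Φ x xs ∂(Measure.pi fun _ : Fin n => S.νX) ∂S.νX := by
  refine lintegral_mono_ae ?_
  filter_upwards [S.νX_cube] with x hx
  have h1 : Measurable fun z => mhat z x := hm.comp measurable_prodMk_right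
  have h2 : Measurable fun z => edist (mhat z x) (S.m x) ^ 2 :=
    ((by fun_prop : Measurable fun ω => edist ω (S.m x)).comp h1).pow_const 2
  rw [S.lintegral_sampleLaw h2]
  exact lintegral_mono_ae (h x hx)

omit [MetricSpace Ω] [BorelSpace Ω] in
lemma measurable_responses (hm : Measurable fun q : (Fin n → Euc p × Ω) × Euc p => mhat q.1 q.2)
    (xs : Fin n → Euc p) (x : Euc p) :
    Measurable fun ys : Fin n → Ω => mhat (fun i => (xs i, ys i)) x := by
  have h1 : Measurable fun ys : Fin n → Ω => ((fun i => (xs i, ys i) : Fin n → Euc p × Ω), x) := by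
    fun_prop
  exact hm.comp h1

/-- The trivial bound from the bias moment condition. -/
lemma conditional_risk_le_Bom (hκ : 2 ≤ κ) {P : Measure (Fin n → Ω)} [IsProbabilityMeasure P]
    {x : Euc p} {F : (Fin n → Ω) → Ω} (hFm : Measurable F)
    (hH : (∫⁻ ys, S.H (F ys) (S.m x) ^ κ ∂P) ^ (1 / κ) ≤ ENNReal.ofReal C.Bom) :
    ∫⁻ ys, edist (F ys) (S.m x) ^ 2 ∂P ≤ ENNReal.ofReal (C.Bom ^ 2) := by
  have hm : Measurable fun ys => edist (F ys) (S.m x) :=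
    (by fun_prop : Measurable fun ω => edist ω (S.m x)).comp hFm
  have h1 : (∫⁻ ys, edist (F ys) (S.m x) ^ κ ∂P) ^ (1 / κ) ≤ ENNReal.ofReal C.Bom := by
    refine le_trans ?_ hH
    gcongr with ys
    exact S.edist_le_H _ _
  have h2 := (lintegral_rpow_le_lintegral_rpow P hm.aemeasurable two_pos hκ).trans h1
  rw [one_div, ENNReal.rpow_inv_le_iff two_pos] at h2
  rw [ENNReal.ofReal_pow (by linarith [C.one_le_Bom])]
  simpa using h2

/-- Crude bound for the Fréchet mean of all responses. -/
lemma conditional_risk_mean_le (hA : Assumptions S α κ C) (hκ : 2 < κ) (hn : 1 ≤ n)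
    {x : Euc p} (hx : x ∈ cube p) {xs : Fin n → Euc p} (hxs : ∀ i, xs i ∈ cube p)
    {F : (Fin n → Ω) → Ω} (hF : ∀ᵐ ys ∂(Measure.pi fun i => S.η (xs i)),
      ∑ i, dist (ys i) (F ys) ^ 2 ≤ ∑ i, dist (ys i) (S.m x) ^ 2) :
    ∫⁻ ys, edist (F ys) (S.m x) ^ 2 ∂(Measure.pi fun i => S.η (xs i)) ≤
      ENNReal.ofReal (16 * (C.Mom * C.Len) ^ 2) := by
  have hM := C.one_le_Mom
  have hL := C.one_le_Len
  have hn0 : (0 : ℝ) < n := by exact_mod_cast hn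
  have hlen : ∀ i, dist (S.m (xs i)) (S.m x) ^ 2 ≤ C.Len ^ 2 := fun i =>
    pow_le_pow_left₀ dist_nonneg (hA.holder.2.1 _ (hxs i) _ hx) 2
  have hsum : ∑ _i : Fin n, (1 / (n : ℝ)) = 1 := by simp [hn0.ne']
  -- Uniform weights, with `Len` as the bound for the spread of the means.
  have hs : WeightedSample (fun i => S.η (xs i)) (fun _ : Fin n => 1 / (n : ℝ)) (S.m x)
      (fun i => S.m (xs i)) κ C.Mom C.Len := by
    refine ⟨hκ, fun i => by positivity, hsum, hM, by linarith, fun i => inferInstance,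
      fun i => hA.moment _ (hxs i), ?_, ?_⟩
    · calc _ ≤ ∑ _i : Fin n, (1 / (n : ℝ)) * C.Len ^ 2 :=
            Finset.sum_le_sum fun i _ => mul_le_mul_of_nonneg_left (hlen i) (by positivity)
        _ = _ := by rw [← Finset.sum_mul, hsum, one_mul]
    · rw [Finset.mul_sum]
      refine Finset.sum_le_sum fun i _ => ?_
      rw [mul_comm]
      exact mul_le_mul_of_nonneg_right (hlen i) (by positivity)
  refine (hs.lintegral_sq_le (F := F) ?_).trans (ENNReal.ofReal_le_ofReal ?_)
  · filter_upwards [hF] with ys hys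
    rw [← Finset.mul_sum, ← Finset.mul_sum]
    gcongr
  · have h1 : C.Mom ^ 2 ≤ (C.Mom * C.Len) ^ 2 := by
      gcongr; nlinarith
    have h2 : C.Len ^ 2 ≤ (C.Mom * C.Len) ^ 2 := by
      gcongr; nlinarith
    linarith

end Setting

/-! ### The Nadaraya–Watson estimator. -/

section NadarayaWatson

lemma IsSmoothingKernel.le_zero {K : ℝ → ℝ} (hK : IsSmoothingKernel K) (u : ℝ) : K u ≤ K 0 := by
  by_cases hu : u ∈ Set.Icc (0 : ℝ) 1
  · exact hK.antitone ⟨le_rfl, zero_le_one⟩ hu hu.1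
  · rw [hK.zero_outside u hu]
    exact (hK.pos 0 le_rfl one_pos).le

lemma IsSmoothingKernel.nonneg {K : ℝ → ℝ} (hK : IsSmoothingKernel K) (u : ℝ) : 0 ≤ K u := by
  by_cases hu : u ∈ Set.Icc (0 : ℝ) 1
  · rcases hu.2.lt_or_eq with h | h
    · exact (hK.pos u hu.1 h).le
    · rw [h]; exact hK.nonneg_one
  · rw [hK.zero_outside u hu]

/-- Bound for the sum of squares of normalized weights. -/
lemma sum_sq_normalized_le {ι : Type*} [Fintype ι] {v : ι → ℝ} {k₀ k₁ N : ℝ}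
    (hv : ∀ i, 0 ≤ v i) (hv1 : ∀ i, v i ≤ k₁) (hk₀ : 0 < k₀) (hk : k₀ ≤ k₁) (hN : N = 0 ∨ 1 ≤ N)
    (hS : 0 < ∑ i, v i) (hSN : N * k₀ ≤ ∑ i, v i) :
    ∑ i, (v i / ∑ j, v j) ^ 2 ≤ 2 * k₁ / k₀ * (1 + N)⁻¹ := by
  set s := ∑ i, v i with hs
  have hw1 : ∑ i, v i / s = 1 := by rw [← Finset.sum_div, div_self hS.ne']
  have hw0 : ∀ i, 0 ≤ v i / s := fun i => div_nonneg (hv i) hS.le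
  have hle1 : ∑ i, (v i / s) ^ 2 ≤ 1 := WeightedSample.sum_sq_le_one hw0 hw1
  have hle2 : ∑ i, (v i / s) ^ 2 ≤ k₁ / s := by
    calc ∑ i, (v i / s) ^ 2 ≤ ∑ i, (k₁ / s) * (v i / s) := by
          refine Finset.sum_le_sum fun i _ => ?_
          rw [sq]
          exact mul_le_mul_of_nonneg_right (div_le_div_of_nonneg_right (hv1 i) hS.le) (hw0 i)
      _ = k₁ / s := by rw [← Finset.mul_sum, hw1, mul_one]
  have hk1 : 1 ≤ k₁ / k₀ := (one_le_div hk₀).2 hk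
  rcases hN with h | h
  · rw [h]
    refine hle1.trans ?_
    norm_num
    rw [mul_div_assoc]; linarith
  · refine hle2.trans ?_
    rw [← div_eq_mul_inv, div_div, div_le_div_iff₀ hS (by positivity)]
    -- `1 + N ≤ 2 * N` as soon as `N ≥ 1`.
    have : k₀ * (1 + N) ≤ 2 * s := by nlinarith
    nlinarith

variable {p : ℕ} {Ω : Type u} [MetricSpace Ω] [MeasurableSpace Ω] [BorelSpace Ω] {S : Setting p Ω}
  {α κ : ℝ} {C : Params} {n : ℕ}

omit [MeasurableSpace Ω] [BorelSpace Ω] in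
lemma sum_kernel_le_of_isMinOn {K : ℝ → ℝ} {h : ℝ} (hh : 0 < h) (hn : 1 ≤ n) {xs : Fin n → Euc p}
    {ys : Fin n → Ω} {x : Euc p} {ω : Ω}
    (hmin : IsMinOn (nwCriterion K h (fun i => (xs i, ys i)) x) Set.univ ω) (ω' : Ω) :
    ∑ i, K (‖xs i - x‖ / h) * dist (ys i) ω ^ 2 ≤ ∑ i, K (‖xs i - x‖ / h) * dist (ys i) ω' ^ 2 := by
  have h1 := hmin (Set.mem_univ ω')
  simp only [Set.mem_ofPred_eq, nwCriterion, scaledKernel] at h1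
  have hn0 : (0 : ℝ) < n := by exact_mod_cast hn
  have h2 := le_of_mul_le_mul_left h1 (by positivity)
  simp_rw [mul_assoc] at h2
  rw [← Finset.mul_sum, ← Finset.mul_sum] at h2
  exact le_of_mul_le_mul_left h2 (by positivity)

/-- Conditional mean squared error of the Nadaraya–Watson estimator. -/
lemma nw_conditional_le (hA : Assumptions S α κ C) (hα : 1 ≤ α) (hα' : α < 2)
    (hκ : 2 < κ) (hκα : 2 / (2 - α) < κ)
    (hμ : ∀ x ∈ cube p, ∫⁻ y, edist y (S.m x) ^ 2 ∂S.μ ≤ ENNReal.ofReal C.Bom ^ 2)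
    {K : ℝ → ℝ} (hK : IsSmoothingKernel K) {h : ℝ} (hh : 0 < h) {M : ℕ}
    (hM : Real.sqrt p / (M + 1) ≤ h / 2) {x : Euc p} (hx : x ∈ cube p) {xs : Fin n → Euc p}
    (hxs : ∀ i, xs i ∈ cube p) {F : (Fin n → Ω) → Ω} (hFm : Measurable F)
    (hF : ∀ᵐ ys ∂(Measure.pi fun i => S.η (xs i)),
      ∑ i, K (‖xs i - x‖ / h) * dist (ys i) (F ys) ^ 2 ≤
        ∑ i, K (‖xs i - x‖ / h) * dist (ys i) (S.m x) ^ 2)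
    (hH : (∫⁻ ys, S.H (F ys) (S.m x) ^ κ ∂(Measure.pi fun i => S.η (xs i))) ^ (1 / κ) ≤
      ENNReal.ofReal C.Bom) {A : ℝ} (hA0 : 0 ≤ A)
    (hempty : (∀ i, K (‖xs i - x‖ / h) = 0) →
      ∫⁻ ys, edist (F ys) (S.m x) ^ 2 ∂(Measure.pi fun i => S.η (xs i)) ≤ ENNReal.ofReal A) :
    ∫⁻ ys, edist (F ys) (S.m x) ^ 2 ∂(Measure.pi fun i => S.η (xs i)) ≤
      ENNReal.ofReal (peelConst α κ * (C.Vlo * C.SmD * C.Bom) ^ (2 / (2 - α)) * h ^ (2 * C.β)) +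
      ENNReal.ofReal (A + peelConst α κ * (C.Vlo * C.Mom * C.Ent) ^ (2 / (2 - α)) *
        (2 * K 0 / K (1 / 2))) * (1 + cellCount (cubeCell M) xs x)⁻¹ := by
  have hk₀ : 0 < K (1 / 2) := hK.pos _ (by norm_num) (by norm_num)
  have hpc := peelConst_ge hα' (by linarith) hκα
  have hK01 : K (1 / 2) ≤ K 0 := hK.le_zero _
  have hk₁ : 0 < K 0 := hk₀.trans_le hK01
  have hpc0 : 0 < peelConst α κ := by linarith
  have hT0 : 0 ≤ (C.Vlo * C.Mom * C.Ent) ^ (2 / (2 - α)) := by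
    have := C.one_le_Vlo; have := C.one_le_Mom; have := C.one_le_Ent; positivity
  have hW0 : 0 ≤ (C.Vlo * C.SmD * C.Bom) ^ (2 / (2 - α)) := by
    have := C.one_le_Vlo; have := C.one_le_SmD; have := C.one_le_Bom; positivity
  set N : ℕ := (Finset.univ.filter fun i => cubeCell M (xs i) = cubeCell M x).card with hN
  have hcount : cellCount (cubeCell M) xs x = (N : ℝ≥0∞) := by
    simp [cellCount, hN]
  have hinv : (1 + cellCount (cubeCell M) xs x)⁻¹ = ENNReal.ofReal (1 + (N : ℝ))⁻¹ := by
    rw [hcount, ENNReal.ofReal_inv_of_pos (by positivity), ENNReal.ofReal_add zero_le_one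
      (by positivity)]
    simp
  set v : Fin n → ℝ := fun i => K (‖xs i - x‖ / h) with hv
  have hv0 : ∀ i, 0 ≤ v i := fun i => hK.nonneg _
  -- The cells have diameter at most `h / 2`, so every sample point in the cell of `x` has weight at
  -- least `K (1 / 2)`. The value of `K` at `1` plays no role.
  have hcell : ∀ i, cubeCell M (xs i) = cubeCell M x → K (1 / 2) ≤ v i := by
    intro i hi
    have h1 := (norm_sub_le_of_cubeCell_eq (hxs i) hx hi).trans hM
    have h2 : ‖xs i - x‖ / h ≤ 1 / 2 := by rw [div_le_iff₀ hh]; linarith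
    exact hK.antitone ⟨by positivity, by linarith⟩ ⟨by norm_num, by norm_num⟩ h2
  have hSN : N * K (1 / 2) ≤ ∑ i, v i := by
    calc (N : ℝ) * K (1 / 2) = ∑ i with cubeCell M (xs i) = cubeCell M x, K (1 / 2) := by
            rw [Finset.sum_const, nsmul_eq_mul]
      _ ≤ ∑ i with cubeCell M (xs i) = cubeCell M x, v i :=
          Finset.sum_le_sum fun i hi => hcell i (Finset.mem_filter.1 hi).2
      _ ≤ ∑ i, v i := Finset.sum_le_sum_of_subset_of_nonneg (Finset.filter_subset _ _)
          fun i _ _ => hv0 i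
  rw [hinv, ← ENNReal.ofReal_mul (by positivity), ← ENNReal.ofReal_add (by positivity)
      (by positivity)]
  have hbias0 : 0 ≤ peelConst α κ * (C.Vlo * C.SmD * C.Bom) ^ (2 / (2 - α)) * h ^ (2 * C.β) := by
    positivity
  rcases (Finset.sum_nonneg fun i (_ : i ∈ Finset.univ) => hv0 i).eq_or_lt with hS | hS
  -- In an empty window the cell count is zero as well, so the factor `(1 + N)⁻¹` equals one and `A`
  -- is paid in full.
  · have hz : ∀ i, v i = 0 := fun i =>
      (Finset.sum_eq_zero_iff_of_nonneg fun i _ => hv0 i).1 hS.symm i (Finset.mem_univ i)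
    have hN0 : (N : ℝ) = 0 := by
      rw [← hS] at hSN
      have : (0 : ℝ) ≤ N := Nat.cast_nonneg N
      nlinarith
    refine (hempty hz).trans (ENNReal.ofReal_le_ofReal ?_)
    rw [hN0]
    have : 0 ≤ peelConst α κ * (C.Vlo * C.Mom * C.Ent) ^ (2 / (2 - α)) * (2 * K 0 / K (1 / 2)) := by
      positivity
    norm_num
    linarith
  · set w : Fin n → ℝ := fun i => v i / ∑ j, v j with hw
    have hw0 : ∀ i, 0 ≤ w i := fun i => div_nonneg (hv0 i) hS.le
    have hw1 : ∑ i, w i = 1 := by rw [hw, ← Finset.sum_div, div_self hS.ne']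
    have hsupp : ∀ i, w i ≠ 0 → ‖xs i - x‖ ^ (2 * C.β) ≤ h ^ (2 * C.β) := by
      intro i hi
      have h1 : ‖xs i - x‖ / h ∈ Set.Icc (0 : ℝ) 1 := by
        by_contra hc
        exact hi (by simp [hw, hv, hK.zero_outside _ hc])
      have h2 : ‖xs i - x‖ ≤ h := (div_le_one hh).1 h1.2
      exact Real.rpow_le_rpow (norm_nonneg _) h2 (by linarith [C.β_pos])
    have hq := sum_sq_normalized_le (k₁ := K 0) (N := N) hv0 (fun i => hK.le_zero _) hk₀ hK01
      (by rcases Nat.eq_zero_or_pos N with h | h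
          · left; exact_mod_cast h
          · right; exact_mod_cast h) hS hSN
    refine (Setting.conditional_risk_le hA hα hα' hκ hκα hμ hx hxs hw0 hw1 (r := h ^ (2 * C.β))
      (by positivity) ?_ ?_ hFm ?_ hH).trans (ENNReal.ofReal_le_ofReal ?_)
    · calc _ ≤ ∑ i, w i * h ^ (2 * C.β) := by
            refine Finset.sum_le_sum fun i _ => ?_
            by_cases hi : w i = 0
            · simp [hi]
            · exact mul_le_mul_of_nonneg_left (hsupp i hi) (hw0 i)
        _ = _ := by rw [← Finset.sum_mul, hw1, one_mul]
    · rw [Finset.mul_sum]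
      refine Finset.sum_le_sum fun i _ => ?_
      by_cases hi : w i = 0
      · simp [hi]
      · rw [mul_comm]
        exact mul_le_mul_of_nonneg_right (hsupp i hi) (sq_nonneg _)
    · filter_upwards [hF] with ys hys
      simp only [hw, div_mul_eq_mul_div]
      rw [← Finset.sum_div, ← Finset.sum_div]
      exact div_le_div_of_nonneg_right hys hS.le
    · have h3 := mul_le_mul_of_nonneg_left hq
        (by positivity : 0 ≤ peelConst α κ * (C.Vlo * C.Mom * C.Ent) ^ (2 / (2 - α)))
      have h4 : 0 ≤ A * (1 + (N : ℝ))⁻¹ := by positivity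
      rw [add_mul]
      linarith

/-- Risk of the Nadaraya–Watson estimator for a bandwidth below one. -/
lemma nw_risk_le (hA : Assumptions S α κ C) (hα : 1 ≤ α) (hα' : α < 2)
    (hκ : 2 < κ) (hκα : 2 / (2 - α) < κ) {K : ℝ → ℝ} (hK : IsSmoothingKernel K) {h : ℝ}
    (hh : 0 < h) (hh1 : h < 1) (hn : 1 ≤ n) {mhat : (Fin n → Euc p × Ω) → Euc p → Ω}
    (hNW : IsNW S K h mhat) (hB : S.BiasMoment κ C mhat) {A : ℝ} (hA0 : 0 ≤ A)
    (hempty : ∀ x ∈ cube p, ∀ᵐ xs ∂(Measure.pi fun _ : Fin n => S.νX),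
      (∀ i, K (‖xs i - x‖ / h) = 0) →
      ∫⁻ ys, edist (mhat (fun i => (xs i, ys i)) x) (S.m x) ^ 2
        ∂(Measure.pi fun i => S.η (xs i)) ≤ ENNReal.ofReal A) :
    S.risk mhat ≤ ENNReal.ofReal
      (peelConst α κ * (C.Vlo * C.SmD * C.Bom) ^ (2 / (2 - α)) * h ^ (2 * C.β) +
        (A + peelConst α κ * (C.Vlo * C.Mom * C.Ent) ^ (2 / (2 - α)) * (2 * K 0 / K (1 / 2))) *
          ((2 * Real.sqrt p + 2) ^ p * ((n : ℝ) * h ^ p)⁻¹)) := by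
  have hμ : ∀ x ∈ cube p, ∫⁻ y, edist y (S.m x) ^ 2 ∂S.μ ≤ ENNReal.ofReal C.Bom ^ 2 :=
    fun x hx => Setting.lintegral_edist_sq_le_Bom hκ.le hB hx
  have hk₀ : 0 < K (1 / 2) := hK.pos _ (by norm_num) (by norm_num)
  have hk₁ : 0 < K 0 := hK.pos _ (by norm_num) (by norm_num)
  have hpc := peelConst_ge hα' (by linarith) hκα
  have hT0 : 0 ≤ (C.Vlo * C.Mom * C.Ent) ^ (2 / (2 - α)) := by
    have := C.one_le_Vlo; have := C.one_le_Mom; have := C.one_le_Ent; positivity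
  have hW0 : 0 ≤ (C.Vlo * C.SmD * C.Bom) ^ (2 / (2 - α)) := by
    have := C.one_le_Vlo; have := C.one_le_SmD; have := C.one_le_Bom; positivity
  set b₁ := peelConst α κ * (C.Vlo * C.SmD * C.Bom) ^ (2 / (2 - α)) * h ^ (2 * C.β) with hb₁
  set b₂ := A + peelConst α κ * (C.Vlo * C.Mom * C.Ent) ^ (2 / (2 - α)) *
    (2 * K 0 / K (1 / 2)) with hb₂
  have hb₁0 : 0 ≤ b₁ := by positivity
  have hb₂0 : 0 ≤ b₂ := by positivity
  set M : ℕ := ⌈2 * Real.sqrt p / h⌉₊ with hMdef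
  have hM1 : 2 * Real.sqrt p / h ≤ M := Nat.le_ceil _
  have hM : Real.sqrt p / (M + 1) ≤ h / 2 := by
    rw [div_le_iff₀ (by positivity)]
    rw [div_le_iff₀ hh] at hM1
    nlinarith
  -- Here `h < 1` absorbs the additive constants into a multiple of `1 / h`.
  have hM2 : (M : ℝ) + 1 ≤ (2 * Real.sqrt p + 2) / h := by
    have h1 := (Nat.ceil_lt_add_one (a := 2 * Real.sqrt p / h) (by positivity)).le
    have h2 : 1 ≤ 1 / h := (one_le_div hh).2 hh1.le
    calc (M : ℝ) + 1 ≤ 2 * Real.sqrt p / h + 1 + 1 := by linarith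
      _ ≤ 2 * Real.sqrt p / h + 2 * (1 / h) := by linarith
      _ = _ := by ring
  have hpoint : ∀ x ∈ cube p, ∀ᵐ xs ∂(Measure.pi fun _ : Fin n => S.νX),
      ∫⁻ ys, edist (mhat (fun i => (xs i, ys i)) x) (S.m x) ^ 2
        ∂(Measure.pi fun i => S.η (xs i)) ≤
      ENNReal.ofReal b₁ + ENNReal.ofReal b₂ * (1 + cellCount (cubeCell M) xs x)⁻¹ := by
    intro x hx
    filter_upwards [S.ae_forall_mem_cube (n := n), S.ae_ae_of_ae_sampleLaw (hNW.2 x hx), hB x hx,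
      hempty x hx] with xs hxs hmin hH he
    refine nw_conditional_le hA hα hα' hκ hκα hμ hK hh hM hx hxs
      (Setting.measurable_responses hNW.1 xs x) ?_ hH hA0 he
    filter_upwards [hmin] with ys hys
    exact sum_kernel_le_of_isMinOn hh hn hys _
  refine (Setting.risk_le_lintegral hNW.1 hpoint).trans ?_
  have hmeas : Measurable fun q : Euc p × (Fin n → Euc p) =>
      (1 + cellCount (cubeCell M) q.2 q.1)⁻¹ :=
    ((measurable_cellCount (measurable_cubeCell M)).const_add 1).inv
  have h1 : ∀ x : Euc p, ∫⁻ xs, (ENNReal.ofReal b₁ + ENNReal.ofReal b₂ *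
      (1 + cellCount (cubeCell M) xs x)⁻¹) ∂(Measure.pi fun _ : Fin n => S.νX) =
      ENNReal.ofReal b₁ + ENNReal.ofReal b₂ * ∫⁻ xs, (1 + cellCount (cubeCell M) xs x)⁻¹
        ∂(Measure.pi fun _ : Fin n => S.νX) := by
    intro x
    rw [lintegral_add_left measurable_const, lintegral_const, measure_univ, mul_one,
      lintegral_const_mul' _ _ ENNReal.ofReal_ne_top]
  simp_rw [h1]
  rw [lintegral_add_left measurable_const, lintegral_const, measure_univ, mul_one,
      lintegral_const_mul' _ _ ENNReal.ofReal_ne_top]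
  have h2 := lintegral_inv_one_add_cellCount_le S.νX (measurable_cubeCell M) n
  have hn0 : (0 : ℝ) < n := by exact_mod_cast hn
  have h3 : (Fintype.card (Fin p → Fin (M + 1)) : ℝ≥0∞) * ((n : ℝ≥0∞) + 1)⁻¹ ≤
      ENNReal.ofReal ((2 * Real.sqrt p + 2) ^ p * ((n : ℝ) * h ^ p)⁻¹) := by
    have e1 : (Fintype.card (Fin p → Fin (M + 1)) : ℝ≥0∞) = ENNReal.ofReal (((M : ℝ) + 1) ^ p) := by
      rw [ENNReal.ofReal_pow (by positivity), ENNReal.ofReal_add (by positivity) zero_le_one]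
      simp
    have e2 : ((n : ℝ≥0∞) + 1)⁻¹ = ENNReal.ofReal (((n : ℝ) + 1)⁻¹) := by
      rw [ENNReal.ofReal_inv_of_pos (by positivity), ENNReal.ofReal_add (by positivity) zero_le_one]
      simp
    rw [e1, e2, ← ENNReal.ofReal_mul (by positivity)]
    apply ENNReal.ofReal_le_ofReal
    calc ((M : ℝ) + 1) ^ p * ((n : ℝ) + 1)⁻¹ ≤ ((2 * Real.sqrt p + 2) / h) ^ p * (n : ℝ)⁻¹ := by
          gcongr
          linarith
      _ = _ := by rw [div_pow, mul_inv]; ring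
  refine (add_le_add_right (mul_le_mul_right (h2.trans h3) _) _).trans (le_of_eq ?_)
  rw [← ENNReal.ofReal_mul hb₂0, ← ENNReal.ofReal_add hb₁0 (by positivity)]

/-- For such a bandwidth `h ^ (2β) ≥ 1`, so the trivial bound `Bom²` fits into the bias term. -/
lemma nw_risk_le_of_one_le (hα' : α < 2) (hκ : 2 < κ) (hκα : 2 / (2 - α) < κ) (hα : 1 ≤ α)
    {h : ℝ} (hh1 : 1 ≤ h) {mhat : (Fin n → Euc p × Ω) → Euc p → Ω}
    (hm : Measurable fun q : (Fin n → Euc p × Ω) × Euc p => mhat q.1 q.2)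
    (hB : S.BiasMoment κ C mhat) :
    S.risk mhat ≤ ENNReal.ofReal
      (peelConst α κ * (C.Vlo * C.SmD * C.Bom) ^ (2 / (2 - α)) * h ^ (2 * C.β)) := by
  have hpc := peelConst_ge hα' (by linarith) hκα
  have hV := C.one_le_Vlo
  have hS := C.one_le_SmD
  have hBo := C.one_le_Bom
  have h1 : S.risk mhat ≤ ∫⁻ _, ∫⁻ _, ENNReal.ofReal (C.Bom ^ 2)
      ∂(Measure.pi fun _ : Fin n => S.νX) ∂S.νX := by
    refine Setting.risk_le_lintegral hm fun x hx => ?_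
    filter_upwards [hB x hx] with xs hH
    exact Setting.conditional_risk_le_Bom hκ.le (Setting.measurable_responses hm xs x) hH
  refine h1.trans ?_
  simp only [lintegral_const, measure_univ, mul_one]
  apply ENNReal.ofReal_le_ofReal
  have hVS : 1 ≤ C.Vlo * C.SmD := one_le_mul_of_one_le_of_one_le hV hS
  have h2 : C.Bom ^ 2 ≤ (C.Vlo * C.SmD * C.Bom) ^ (2 / (2 - α)) := by
    calc C.Bom ^ 2 ≤ (C.Vlo * C.SmD * C.Bom) ^ 2 := by
          gcongr
          nlinarith
      _ = (C.Vlo * C.SmD * C.Bom) ^ (2 : ℝ) := by norm_num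
      _ ≤ _ := by
          apply Real.rpow_le_rpow_of_exponent_le (one_le_mul_of_one_le_of_one_le hVS hBo)
          rw [le_div_iff₀ (by linarith)]; linarith
  have h3 : 1 ≤ h ^ (2 * C.β) := Real.one_le_rpow hh1 (by linarith [C.β_pos])
  have h4 : 0 ≤ C.Bom ^ 2 := by positivity
  calc C.Bom ^ 2 ≤ 1 * (C.Vlo * C.SmD * C.Bom) ^ (2 / (2 - α)) * 1 := by linarith
    _ ≤ _ := by
      gcongr
      linarith

end NadarayaWatson

/-! ### Moments of the distance to the nearest of `L` points. -/

section NearestDist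

variable {p : ℕ}

/-- The distance from `x` to the closest of the points `zs`. -/
noncomputable def nearestDist {L : ℕ} (x : Euc p) (zs : Fin L → Euc p) : ℝ≥0∞ :=
  ⨅ l, edist (zs l) x

lemma measurable_nearestDist (L : ℕ) :
    Measurable fun q : Euc p × (Fin L → Euc p) => nearestDist q.1 q.2 := by
  unfold nearestDist
  refine Measurable.iInf fun l => ?_
  exact ((measurable_pi_apply l).comp measurable_snd).edist measurable_fst

lemma nearestDist_ne_top {L : ℕ} (hL : 1 ≤ L) (x : Euc p) (zs : Fin L → Euc p) :
    nearestDist x zs ≠ ⊤ :=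
  ne_top_of_le_ne_top (edist_ne_top _ _) (iInf_le _ (⟨0, hL⟩ : Fin L))

lemma edist_le_ofReal_iff {x y : Euc p} {t : ℝ} (ht : 0 ≤ t) :
    edist x y ≤ ENNReal.ofReal t ↔ ‖x - y‖ ≤ t := by
  rw [edist_dist, ENNReal.ofReal_le_ofReal_iff ht, dist_eq_norm]

variable {ν : Measure (Euc p)} [IsProbabilityMeasure ν]

lemma ae_pi_mem_cube (hν : ∀ᵐ x ∂ν, x ∈ cube p) (L : ℕ) :
    ∀ᵐ zs ∂(Measure.pi fun _ : Fin L => ν), ∀ l, zs l ∈ cube p := by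
  rw [ae_all_iff]
  intro l
  exact (measurePreserving_eval (fun _ : Fin L => ν) l).quasiMeasurePreserving.ae hν

lemma rpow_neg_inv_pow (hp : 1 ≤ p) {L : ℝ} (hL : 0 < L) :
    (L ^ (-(1 / (p : ℝ)))) ^ p = L⁻¹ := by
  have hp0 : (p : ℝ) ≠ 0 := by positivity
  rw [← Real.rpow_natCast, ← Real.rpow_mul hL.le]
  rw [show -(1 / (p : ℝ)) * p = -1 by field_simp, Real.rpow_neg_one]

/-- Moments of the nearest neighbour distance in dimension at least three. -/
lemma lintegral_nearestDist_le (hν : ∀ᵐ x ∂ν, x ∈ cube p) (hp : 3 ≤ p) {L : ℕ} (hL : 1 ≤ L)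
    {β : ℝ} (hβ : 0 < β) (hβ1 : β ≤ 1) :
    ∫⁻ x, ∫⁻ zs, nearestDist x zs ^ (2 * β) ∂(Measure.pi fun _ : Fin L => ν) ∂ν ≤
      ENNReal.ofReal ((1 + 8 * (3 * Real.sqrt p) ^ p) / (L : ℝ) ^ (2 * β / p)) := by
  have hL0 : (0 : ℝ) < L := by exact_mod_cast hL
  have hp0 : (0 : ℝ) < p := by positivity
  have hsp : 0 < Real.sqrt p := Real.sqrt_pos.2 hp0
  set Q := ν.prod (Measure.pi fun _ : Fin L => ν) with hQ
  set ε : ℝ := (L : ℝ) ^ (-(1 / (p : ℝ))) with hε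
  have hε0 : 0 < ε := by positivity
  have hεp : ε ^ p = (L : ℝ)⁻¹ := rpow_neg_inv_pow (by omega) hL0
  have hcube : ∀ᵐ q ∂Q, q.1 ∈ cube p ∧ ∀ l, q.2 l ∈ cube p :=
    (Measure.quasiMeasurePreserving_fst.ae hν).and
      (Measure.quasiMeasurePreserving_snd.ae (ae_pi_mem_cube hν L))
  have htail : ∀ j : ℕ, Q {q | ENNReal.ofReal (2 ^ j * ε) < nearestDist q.1 q.2} ≤
      ENNReal.ofReal ((3 * Real.sqrt p) ^ p * (1 / 8) ^ j) := by
    intro j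
    set t : ℝ := 2 ^ j * ε with ht
    have ht0 : 0 < t := by positivity
    have hE : MeasurableSet {q : Euc p × (Fin L → Euc p) |
        ENNReal.ofReal t < nearestDist q.1 q.2} :=
      measurableSet_lt measurable_const (measurable_nearestDist L)
    rcases le_or_gt (Real.sqrt p) t with h | h
    -- The cube has diameter at most `√p`, so the tail vanishes from there on.
    · have : Q {q | ENNReal.ofReal t < nearestDist q.1 q.2} = 0 := by
        rw [measure_eq_zero_iff_ae_notMem]
        filter_upwards [hcube] with q hq
        simp only [not_lt]
        refine (iInf_le _ (⟨0, hL⟩ : Fin L)).trans ((edist_le_ofReal_iff ht0.le).2 ?_)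
        exact (norm_sub_le_sqrt (hq.2 _) hq.1).trans h
      rw [this]
      exact zero_le
    · set M : ℕ := ⌈Real.sqrt p / t⌉₊ with hM
      have hM1 : Real.sqrt p / t ≤ M := Nat.le_ceil _
      have hM2 : (M : ℝ) < Real.sqrt p / t + 1 := Nat.ceil_lt_add_one (by positivity)
      have h1 : 1 ≤ Real.sqrt p / t := (one_le_div ht0).2 h.le
      have hcell : Real.sqrt p / (M + 1) ≤ t := by
        rw [div_le_iff₀ (by positivity)]
        rw [div_le_iff₀ ht0] at hM1
        nlinarith
      have hcm := measurable_cubeCell (p := p) M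
      calc Q {q | ENNReal.ofReal t < nearestDist q.1 q.2}
          = ∫⁻ q, {q : Euc p × (Fin L → Euc p) |
              ENNReal.ofReal t < nearestDist q.1 q.2}.indicator 1 q ∂Q :=
            (lintegral_indicator_one hE).symm
        _ ≤ ∫⁻ q, (1 + cellCount (cubeCell M) q.2 q.1)⁻¹ ∂Q := by
            refine lintegral_mono_ae ?_
            filter_upwards [hcube] with q hq
            rw [Set.indicator_apply]
            split_ifs with hqE
            swap
            · exact zero_le
            -- If no sample point is within `t` of `x`, the cell of `x` is empty and `(1 + 0)⁻¹`
            -- dominates the indicator.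
            have : cellCount (cubeCell M) q.2 q.1 = 0 := by
              refine Finset.sum_eq_zero fun l _ => if_neg fun hl => ?_
              have h2 := (norm_sub_le_of_cubeCell_eq (hq.2 l) hq.1 hl).trans hcell
              have h3 : ENNReal.ofReal t < nearestDist q.1 q.2 := hqE
              exact absurd ((iInf_le _ l).trans ((edist_le_ofReal_iff ht0.le).2 h2)) (not_le.2 h3)
            simp [this]
        _ = ∫⁻ x, ∫⁻ zs, (1 + cellCount (cubeCell M) zs x)⁻¹
              ∂(Measure.pi fun _ : Fin L => ν) ∂ν :=
            lintegral_prod _ (((measurable_cellCount hcm).const_add 1).inv).aemeasurable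
        _ ≤ (Fintype.card (Fin p → Fin (M + 1)) : ℝ≥0∞) * ((L : ℝ≥0∞) + 1)⁻¹ :=
            lintegral_inv_one_add_cellCount_le ν hcm L
        _ = ENNReal.ofReal (((M : ℝ) + 1) ^ p * ((L : ℝ) + 1)⁻¹) := by
            rw [ENNReal.ofReal_mul (by positivity), ENNReal.ofReal_inv_of_pos (by positivity),
              ENNReal.ofReal_pow (by positivity), ENNReal.ofReal_add (by positivity) zero_le_one,
              ENNReal.ofReal_add (by positivity) zero_le_one]
            simp
        _ ≤ _ := by
            apply ENNReal.ofReal_le_ofReal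
            have h4 : (M : ℝ) + 1 ≤ 3 * Real.sqrt p / t := by
              rw [mul_div_assoc]; linarith
            -- This is where `p ≥ 3` enters: the cell count gives the tail decay `2^(-jp)`, and the
            -- second moment needs a decay faster than `4^(-j)`.
            have h5 : (2 ^ j : ℝ) ^ p ≥ 8 ^ j := by
              rw [← pow_mul, mul_comm, pow_mul]
              gcongr
              calc (8 : ℝ) = 2 ^ 3 := by norm_num
                _ ≤ _ := pow_le_pow_right₀ (by norm_num) hp
            calc ((M : ℝ) + 1) ^ p * ((L : ℝ) + 1)⁻¹ ≤ (3 * Real.sqrt p / t) ^ p * (L : ℝ)⁻¹ := by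
                  gcongr
                  linarith
              _ = (3 * Real.sqrt p) ^ p * ((2 ^ j : ℝ) ^ p)⁻¹ := by
                  rw [div_pow, ht, mul_pow (2 ^ j) ε, hεp, div_eq_mul_inv, mul_inv, inv_inv]
                  field_simp
              _ ≤ (3 * Real.sqrt p) ^ p * (8 ^ j : ℝ)⁻¹ := by gcongr
              _ = _ := by rw [one_div, inv_pow]
  have hmain := lintegral_rpow_le_of_dyadic_tail Q (measurable_nearestDist L)
    (fun q => nearestDist_ne_top hL q.1 q.2) hε0 hβ hβ1 (by positivity) htail
  rw [lintegral_prod _ ((measurable_nearestDist L).pow_const _).aemeasurable] at hmain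
  refine hmain.trans (le_of_eq ?_)
  rw [hε, ← Real.rpow_mul hL0.le, show -(1 / (p : ℝ)) * (2 * β) = -(2 * β / p) by ring,
    Real.rpow_neg hL0.le, div_eq_mul_inv _ ((L : ℝ) ^ (2 * β / p))]

/-- Upper tail of the distance from a fixed point to the nearest of the `L` sample points. -/
lemma pi_nearestDist_gt_le_of_ball (hν : ∀ᵐ x ∂ν, x ∈ cube p) (hp : 1 ≤ p) {L : ℕ}
    (hL : 1 ≤ L) {x : Euc p} (hx : x ∈ cube p) {s g ε : ℝ} (hs1 : s ≤ 1)
    (hε0 : 0 < ε) (hεp : (s * ε) ^ p = ((L : ℝ) * g)⁻¹) (hg : 0 < g)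
    (hball : ∀ t : ℝ, 0 < t → t < Real.sqrt p →
      ENNReal.ofReal (g * (s * t) ^ p) < ν (Metric.closedBall x (s * t))) (j : ℕ) :
    (Measure.pi fun _ : Fin L => ν) {zs | ENNReal.ofReal (2 ^ j * ε) < nearestDist x zs} ≤
      ENNReal.ofReal (6 * (1 / 8) ^ j) := by
  have hL0 : (0 : ℝ) < L := by exact_mod_cast hL
  set Q := Measure.pi fun _ : Fin L => ν with hQ
  set t : ℝ := 2 ^ j * ε with ht
  have ht0 : 0 < t := by positivity
  rcases le_or_gt (Real.sqrt p) t with h | h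
  · have : Q {zs | ENNReal.ofReal t < nearestDist x zs} = 0 := by
      rw [measure_eq_zero_iff_ae_notMem]
      filter_upwards [ae_pi_mem_cube hν L] with zs hz
      simp only [not_lt]
      refine (iInf_le _ (⟨0, hL⟩ : Fin L)).trans ((edist_le_ofReal_iff ht0.le).2 ?_)
      exact (norm_sub_le_sqrt (hz _) hx).trans h
    rw [this]
    exact zero_le
  · set m : ℝ := ν.real (Metric.closedBall x t) with hm
    have hmt : g * (s * t) ^ p ≤ m := by
      have h1 := (hball t ht0 h).le.trans
        (measure_mono (Metric.closedBall_subset_closedBall (by nlinarith : s * t ≤ t)))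
      exact (ENNReal.ofReal_le_iff_le_toReal (by finiteness)).1 h1
    have hm1 : m ≤ 1 := measureReal_le_one
    -- All `L` independent points miss the ball, which has probability `(1 - m) ^ L`.
    have hsub : {zs : Fin L → Euc p | ENNReal.ofReal t < nearestDist x zs} ⊆
        Set.univ.pi fun _ => (Metric.closedBall x t)ᶜ := by
      intro zs hz l _ hl
      rw [Metric.mem_closedBall, dist_eq_norm] at hl
      have hz' : ENNReal.ofReal t < nearestDist x zs := hz
      exact absurd ((iInf_le _ l).trans ((edist_le_ofReal_iff ht0.le).2 hl)) (not_le.2 hz')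
    refine (measure_mono hsub).trans ?_
    rw [hQ, Measure.pi_pi, Finset.prod_const, Finset.card_univ, Fintype.card_fin]
    have h2 : ν (Metric.closedBall x t)ᶜ = ENNReal.ofReal (1 - m) := by
      rw [← ofReal_measureReal, probReal_compl_eq_one_sub Metric.isClosed_closedBall.measurableSet]
    rw [h2, ← ENNReal.ofReal_pow (by linarith)]
    apply ENNReal.ofReal_le_ofReal
    have h3 : (2 : ℝ) ^ j ≤ L * m := by
      calc (2 : ℝ) ^ j ≤ (2 ^ j) ^ p := le_self_pow₀ (one_le_pow₀ (by norm_num)) (by omega)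
        _ = L * (g * (s * t) ^ p) := by
            rw [show s * t = 2 ^ j * (s * ε) by rw [ht]; ring, mul_pow, hεp]
            field_simp
        _ ≤ L * m := by gcongr
    calc (1 - m) ^ L ≤ Real.exp (-m) ^ L :=
          pow_le_pow_left₀ (by linarith) (Real.one_sub_le_exp_neg m) L
      _ = Real.exp (-(L * m)) := by rw [← Real.exp_nat_mul]; congr 1; ring
      _ ≤ Real.exp (-(2 ^ j)) := by gcongr
      _ ≤ 6 * (1 / 8) ^ j := by
          -- `exp (-u) ≤ 6 / u³` at `u = 2 ^ j`: the exponential tail supplies the factor `1 / 8` in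
          -- any dimension `p ≥ 1`.
          have h4 := Real.pow_div_factorial_le_exp (2 ^ j : ℝ) (by positivity) 3
          rw [Real.exp_neg, inv_le_iff_one_le_mul₀ (Real.exp_pos _)]
          have h5 : ((2 : ℝ) ^ j) ^ 3 = 8 ^ j := by
            rw [← pow_mul, mul_comm, pow_mul]; norm_num
          rw [h5] at h4
          norm_num [Nat.factorial] at h4
          calc (1 : ℝ) = 6 * (1 / 8) ^ j * (8 ^ j / 6) := by
                rw [one_div, inv_pow]; field_simp
            _ ≤ _ := by
                gcongr

/-- Moments of the distance from a fixed point to the nearest of the `L` sample points. -/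
lemma lintegral_nearestDist_le_of_ball (hν : ∀ᵐ x ∂ν, x ∈ cube p) (hp : 1 ≤ p) {L : ℕ}
    (hL : 1 ≤ L) {β : ℝ} (hβ : 0 < β) (hβ1 : β ≤ 1) {x : Euc p} (hx : x ∈ cube p) {ξ₀ g : ℝ}
    (hξ : 0 < ξ₀) (hg : 0 < g) (hball : ∀ ξ : ℝ, 0 < ξ → ξ ≤ ξ₀ →
      ENNReal.ofReal (g * ξ ^ p) < ν (Metric.closedBall x ξ)) :
    ∫⁻ zs, nearestDist x zs ^ (2 * β) ∂(Measure.pi fun _ : Fin L => ν) ≤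
      ENNReal.ofReal (49 * (min 1 (ξ₀ / Real.sqrt p))⁻¹ ^ 2 * (1 + (g ^ (2 / (p : ℝ)))⁻¹) /
        (L : ℝ) ^ (2 * β / p)) := by
  have hL0 : (0 : ℝ) < L := by exact_mod_cast hL
  have hp0 : (0 : ℝ) < p := by positivity
  have hsp : 0 < Real.sqrt p := Real.sqrt_pos.2 hp0
  -- The mass condition holds only up to radius `ξ₀`, while distances range up to `√p`; radii are
  -- therefore shrunk by `s`.
  set s : ℝ := min 1 (ξ₀ / Real.sqrt p) with hs
  have hs0 : 0 < s := lt_min one_pos (by positivity)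
  have hs1 : s ≤ 1 := min_le_left _ _
  have hsξ : s * Real.sqrt p ≤ ξ₀ := (le_div_iff₀ hsp).1 (min_le_right _ _)
  set Q := Measure.pi fun _ : Fin L => ν with hQ
  set ε : ℝ := s⁻¹ * ((L : ℝ) * g) ^ (-(1 / (p : ℝ))) with hε
  have hLg : 0 < (L : ℝ) * g := by positivity
  have hε0 : 0 < ε := by positivity
  have hεp : (s * ε) ^ p = ((L : ℝ) * g)⁻¹ := by
    rw [hε, mul_inv_cancel_left₀ hs0.ne']
    exact rpow_neg_inv_pow hp hLg
  have hball' : ∀ t : ℝ, 0 < t → t < Real.sqrt p →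
      ENNReal.ofReal (g * (s * t) ^ p) < ν (Metric.closedBall x (s * t)) := fun t ht0 ht =>
    hball _ (by positivity) ((mul_le_mul_of_nonneg_left ht.le hs0.le).trans hsξ)
  have htail : ∀ j : ℕ, Q {zs | ENNReal.ofReal (2 ^ j * ε) < nearestDist x zs} ≤
      ENNReal.ofReal (6 * (1 / 8) ^ j) := fun j =>
    pi_nearestDist_gt_le_of_ball hν hp hL hx hs1 hε0 hεp hg hball' j
  have hmeas : Measurable fun zs : Fin L → Euc p => nearestDist x zs :=
    Measurable.iInf fun l => (measurable_pi_apply l).edist measurable_const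
  refine (lintegral_rpow_le_of_dyadic_tail Q hmeas (fun zs => nearestDist_ne_top hL x zs) hε0 hβ
    hβ1 (by norm_num) htail).trans (ENNReal.ofReal_le_ofReal ?_)
  have h1 : ε ^ (2 * β) = s⁻¹ ^ (2 * β) * ((g ^ (2 / (p : ℝ)))⁻¹) ^ β / (L : ℝ) ^ (2 * β / p) := by
    rw [hε, Real.mul_rpow (by positivity) (by positivity), ← Real.rpow_mul hLg.le,
      Real.mul_rpow hL0.le hg.le, ← Real.rpow_neg hg.le, ← Real.rpow_mul hg.le,
      show -(1 / (p : ℝ)) * (2 * β) = -(2 * β / p) by ring,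
      show -(2 / (p : ℝ)) * β = -(2 * β / p) by ring, Real.rpow_neg hL0.le]
    field_simp
  have h2 : s⁻¹ ^ (2 * β) ≤ s⁻¹ ^ 2 := by
    rw [← Real.rpow_natCast]
    apply Real.rpow_le_rpow_of_exponent_le ((one_le_inv₀ hs0).2 hs1)
    push_cast; linarith
  -- As `β ≤ 1`, integrability of `g^(-2/p)` suffices for every exponent.
  have h3 : ((g ^ (2 / (p : ℝ)))⁻¹) ^ β ≤ 1 + (g ^ (2 / (p : ℝ)))⁻¹ := by
    set v := (g ^ (2 / (p : ℝ)))⁻¹ with hv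
    have hv0 : 0 < v := by positivity
    rcases le_total v 1 with h | h
    · linarith [Real.rpow_le_one hv0.le h hβ.le]
    · have := Real.rpow_le_rpow_of_exponent_le h hβ1
      rw [Real.rpow_one] at this
      linarith
  rw [h1]
  calc (1 + 8 * 6) * (s⁻¹ ^ (2 * β) * ((g ^ (2 / (p : ℝ)))⁻¹) ^ β / (L : ℝ) ^ (2 * β / p))
      ≤ (1 + 8 * 6) * (s⁻¹ ^ 2 * (1 + (g ^ (2 / (p : ℝ)))⁻¹) / (L : ℝ) ^ (2 * β / p)) := by gcongr
    _ = _ := by ring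

end NearestDist

/-- The pointwise bound is integrated over `x`; where `g` vanishes its right side is infinite and
there is nothing to prove. `max G 0` keeps the constant meaningful for every real `G`. -/
lemma Setting.lintegral_nearestDist_le_of_ballMass {p : ℕ} {Ω : Type u} [MetricSpace Ω]
    [MeasurableSpace Ω] (S : Setting p Ω) (hp : 1 ≤ p) {ξ₀ G : ℝ} (hξ : 0 < ξ₀)
    (hB : S.BallMass ξ₀ G) {L : ℕ} (hL : 1 ≤ L) {β : ℝ} (hβ : 0 < β) (hβ1 : β ≤ 1) :
    ∫⁻ x, ∫⁻ zs, nearestDist x zs ^ (2 * β) ∂(Measure.pi fun _ : Fin L => S.νX) ∂S.νX ≤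
      ENNReal.ofReal (49 * (min 1 (ξ₀ / Real.sqrt p))⁻¹ ^ 2 * (1 + max G 0) /
        (L : ℝ) ^ (2 * β / p)) := by
  obtain ⟨g, hgm, hg0, hball, hG⟩ := hB
  have hL0 : (0 : ℝ) < L := by exact_mod_cast hL
  have hp0 : (0 : ℝ) < p := by positivity
  have hs0 : 0 < min 1 (ξ₀ / Real.sqrt p) := lt_min one_pos (by positivity)
  set a : ℝ := 49 * (min 1 (ξ₀ / Real.sqrt p))⁻¹ ^ 2 / (L : ℝ) ^ (2 * β / p) with ha
  have ha0 : 0 < a := by positivity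
  have hpoint : ∀ᵐ x ∂S.νX,
      ∫⁻ zs, nearestDist x zs ^ (2 * β) ∂(Measure.pi fun _ : Fin L => S.νX) ≤
        ENNReal.ofReal a * (1 + (ENNReal.ofReal (g x) ^ (2 / (p : ℝ)))⁻¹) := by
    filter_upwards [S.νX_cube] with x hx
    rcases (hg0 x).eq_or_lt with h | h
    · rw [← h, ENNReal.ofReal_zero, ENNReal.zero_rpow_of_pos (by positivity), ENNReal.inv_zero,
        add_top, ENNReal.mul_top (by simpa using ha0)]
      exact le_top
    · refine (lintegral_nearestDist_le_of_ball S.νX_cube hp hL hβ hβ1 hx hξ h (hball x hx)).trans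
        (le_of_eq ?_)
      rw [ENNReal.ofReal_rpow_of_pos h, ← ENNReal.ofReal_inv_of_pos (by positivity),
        ← ENNReal.ofReal_one, ← ENNReal.ofReal_add zero_le_one (by positivity),
        ← ENNReal.ofReal_mul ha0.le]
      congr 1
      rw [ha]; ring
  refine (lintegral_mono_ae hpoint).trans ?_
  rw [lintegral_const_mul' _ _ ENNReal.ofReal_ne_top, lintegral_add_left measurable_const,
    lintegral_const, measure_univ, mul_one]
  have hG' := hG.trans (ENNReal.ofReal_le_ofReal (le_max_left G 0))
  refine (mul_le_mul_right (add_le_add_right hG' 1) _).trans ?_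
  rw [← ENNReal.ofReal_one, ← ENNReal.ofReal_add zero_le_one (le_max_right _ _),
    ← ENNReal.ofReal_mul ha0.le]
  apply ENNReal.ofReal_le_ofReal
  rw [ha]
  apply le_of_eq
  ring

/-! ### The nearest neighbour estimator. -/

section NearestNeighbours

/-- An exchange argument: `T` and the range of `g` have equally many indices outside each other, and
those of `T` are at least as close to `x`. -/
lemma IsNearest.sum_le {p n k : ℕ} {xs : Fin n → Euc p} {x : Euc p} {T : Finset (Fin n)}
    (hT : IsNearest k xs x T) {g : Fin k → Fin n} (hg : Function.Injective g) {f : ℝ → ℝ≥0∞}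
    (hf : Monotone f) : ∑ i ∈ T, f ‖xs i - x‖ ≤ ∑ j, f ‖xs (g j) - x‖ := by
  classical
  set T' : Finset (Fin n) := Finset.univ.map ⟨g, hg⟩ with hT'
  have hcard : (T \ T').card = (T' \ T).card := by
    apply Finset.card_sdiff_comm
    rw [hT.1, hT', Finset.card_map, Finset.card_univ, Fintype.card_fin]
  have h1 : ∑ j, f ‖xs (g j) - x‖ = ∑ i ∈ T', f ‖xs i - x‖ := by
    rw [hT', Finset.sum_map]; rfl
  rw [h1, ← Finset.sum_inter_add_sum_sdiff T T', ← Finset.sum_inter_add_sum_sdiff T' T,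
    Finset.inter_comm T' T]
  refine add_le_add_right ?_ _
  set b := (T \ T').sup fun i => f ‖xs i - x‖ with hb
  calc ∑ i ∈ T \ T', f ‖xs i - x‖ ≤ (T \ T').card • b :=
        Finset.sum_le_card_nsmul _ _ _ fun i hi => Finset.le_sup (f := fun i => f ‖xs i - x‖) hi
    _ = (T' \ T).card • b := by rw [hcard]
    _ ≤ _ := by
        refine Finset.card_nsmul_le_sum _ _ _ fun j hj => Finset.sup_le fun i hi => ?_
        exact hf (hT.2 i (Finset.mem_sdiff.1 hi).1 j (Finset.mem_sdiff.1 hj).2)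

/-- The `l`-th index of the `j`-th of `k` consecutive blocks of length `n / k`. -/
def blockIndex (n k : ℕ) (j : Fin k) (l : Fin (n / k)) : Fin n :=
  Fin.castLE (Nat.mul_div_le n k) (finProdFinEquiv (j, l))

lemma blockIndex_injective (n k : ℕ) :
    Function.Injective fun q : Fin k × Fin (n / k) => blockIndex n k q.1 q.2 :=
  (Fin.castLE_injective _).comp finProdFinEquiv.injective

/-- The nearest neighbours are at least as close as the closest points of disjoint blocks. -/
lemma IsNearest.sum_rpow_le {p n k : ℕ} {xs : Fin n → Euc p} {x : Euc p} {T : Finset (Fin n)}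
    (hT : IsNearest k xs x T) (hL : 1 ≤ n / k) {s : ℝ} (hs : 0 ≤ s) :
    ∑ i ∈ T, ENNReal.ofReal ‖xs i - x‖ ^ s ≤
      ∑ j, nearestDist x (fun l => xs (blockIndex n k j l)) ^ s := by
  have : Nonempty (Fin (n / k)) := ⟨⟨0, hL⟩⟩
  -- The closest point of each block; the blocks are disjoint, so these are `k` distinct indices.
  choose l hl using fun j : Fin k =>
    exists_eq_ciInf_of_finite (f := fun l => edist (xs (blockIndex n k j l)) x)
  have hg : Function.Injective fun j => blockIndex n k j (l j) := by
    intro a b hab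
    exact congrArg Prod.fst (@blockIndex_injective n k (a, l a) (b, l b) hab)
  refine (hT.sum_le hg (f := fun t => ENNReal.ofReal t ^ s) fun a b hab => by
    dsimp only; gcongr).trans (le_of_eq ?_)
  refine Finset.sum_congr rfl fun j _ => ?_
  rw [nearestDist, ← hl j, edist_dist, dist_eq_norm]

variable {p : ℕ} {Ω : Type u} [MetricSpace Ω] [MeasurableSpace Ω] [BorelSpace Ω] {S : Setting p Ω}
  {α κ : ℝ} {C : Params} {n k : ℕ}

/-- Conditional mean squared error of the nearest neighbour estimator. -/
lemma knn_conditional_le (hA : Assumptions S α κ C) (hα : 1 ≤ α) (hα' : α < 2)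
    (hκ : 2 < κ) (hκα : 2 / (2 - α) < κ)
    (hμ : ∀ x ∈ cube p, ∫⁻ y, edist y (S.m x) ^ 2 ∂S.μ ≤ ENNReal.ofReal C.Bom ^ 2)
    (hk : 1 ≤ k) {x : Euc p} (hx : x ∈ cube p) {xs : Fin n → Euc p} (hxs : ∀ i, xs i ∈ cube p)
    {T : Finset (Fin n)} (hT : T.card = k) {F : (Fin n → Ω) → Ω} (hFm : Measurable F)
    (hF : ∀ᵐ ys ∂(Measure.pi fun i => S.η (xs i)),
      ∑ i ∈ T, dist (ys i) (F ys) ^ 2 ≤ ∑ i ∈ T, dist (ys i) (S.m x) ^ 2)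
    (hH : (∫⁻ ys, S.H (F ys) (S.m x) ^ κ ∂(Measure.pi fun i => S.η (xs i))) ^ (1 / κ) ≤
      ENNReal.ofReal C.Bom) :
    ∫⁻ ys, edist (F ys) (S.m x) ^ 2 ∂(Measure.pi fun i => S.η (xs i)) ≤
      ENNReal.ofReal (peelConst α κ * (C.Vlo * C.SmD * C.Bom) ^ (2 / (2 - α)) *
        ((k : ℝ)⁻¹ * ∑ i ∈ T, ‖xs i - x‖ ^ (2 * C.β)) +
        peelConst α κ * (C.Vlo * C.Mom * C.Ent) ^ (2 / (2 - α)) * (k : ℝ)⁻¹) := by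
  have hk0 : (0 : ℝ) < k := by exact_mod_cast hk
  have hsum : ∀ f : Fin n → ℝ, ∑ i, (if i ∈ T then (k : ℝ)⁻¹ else 0) * f i =
      (k : ℝ)⁻¹ * ∑ i ∈ T, f i := by
    intro f
    simp only [ite_mul, zero_mul, Finset.sum_ite_mem, Finset.univ_inter, Finset.mul_sum]
  have hw1 : ∑ i, (if i ∈ T then (k : ℝ)⁻¹ else 0) = 1 := by
    have := hsum fun _ => 1
    simp only [mul_one, Finset.sum_const, hT, nsmul_eq_mul] at this
    rw [this, inv_mul_cancel₀ hk0.ne']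
  -- The weights are uniform on `T`, so squaring only multiplies by `k⁻¹` and `∑ w i ^ 2 = k⁻¹`.
  have hsq : ∀ i, (if i ∈ T then (k : ℝ)⁻¹ else 0) ^ 2 =
      (k : ℝ)⁻¹ * (if i ∈ T then (k : ℝ)⁻¹ else 0) := by
    intro i
    split_ifs <;> ring
  have hq : ∑ i, (if i ∈ T then (k : ℝ)⁻¹ else 0) ^ 2 = (k : ℝ)⁻¹ := by
    simp_rw [hsq]
    rw [← Finset.mul_sum, hw1, mul_one]
  have hmain := Setting.conditional_risk_le hA hα hα' hκ hκα hμ hx hxs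
    (w := fun i => if i ∈ T then (k : ℝ)⁻¹ else 0)
    (r := (k : ℝ)⁻¹ * ∑ i ∈ T, ‖xs i - x‖ ^ (2 * C.β))
    (fun i => by split_ifs <;> positivity) hw1 (by positivity) (hsum _).le ?_ hFm ?_ hH
  · rwa [hq] at hmain
  · rw [hq]
    simp_rw [hsq, mul_assoc]
    rw [← Finset.mul_sum, hsum]
    apply le_of_eq
    ring
  · filter_upwards [hF] with ys hys
    rw [hsum, hsum]
    gcongr

/-- Risk of the nearest neighbour estimator in terms of nearest neighbour distances. -/
lemma knn_risk_le (hA : Assumptions S α κ C) (hα : 1 ≤ α) (hα' : α < 2)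
    (hκ : 2 < κ) (hκα : 2 / (2 - α) < κ) (hk : 1 ≤ k) (hkn : k ≤ n)
    {mhat : (Fin n → Euc p × Ω) → Euc p → Ω} (hNN : IsKNN S k mhat) (hB : S.BiasMoment κ C mhat)
    {ψ : ℝ} (hψ0 : 0 ≤ ψ) (hψ : ∫⁻ x, ∫⁻ zs, nearestDist x zs ^ (2 * C.β)
      ∂(Measure.pi fun _ : Fin (n / k) => S.νX) ∂S.νX ≤ ENNReal.ofReal ψ) :
    S.risk mhat ≤ ENNReal.ofReal
      (peelConst α κ * (C.Vlo * C.SmD * C.Bom) ^ (2 / (2 - α)) * ψ +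
        peelConst α κ * (C.Vlo * C.Mom * C.Ent) ^ (2 / (2 - α)) * (k : ℝ)⁻¹) := by
  obtain ⟨hm, N, hN, hmin⟩ := hNN
  have hμ : ∀ x ∈ cube p, ∫⁻ y, edist y (S.m x) ^ 2 ∂S.μ ≤ ENNReal.ofReal C.Bom ^ 2 :=
    fun x hx => Setting.lintegral_edist_sq_le_Bom hκ.le hB hx
  have hpc := peelConst_ge hα' (by linarith) hκα
  have hpc0 : 0 < peelConst α κ := by linarith
  have hk0 : (0 : ℝ) < k := by exact_mod_cast hk
  have hL : 1 ≤ n / k := (Nat.one_le_div_iff hk).2 hkn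
  have hβ2 : 0 ≤ 2 * C.β := by linarith [C.β_pos]
  set b₁ : ℝ := peelConst α κ * (C.Vlo * C.SmD * C.Bom) ^ (2 / (2 - α)) with hb₁
  set b₂ : ℝ := peelConst α κ * (C.Vlo * C.Mom * C.Ent) ^ (2 / (2 - α)) * (k : ℝ)⁻¹ with hb₂
  have hb₁0 : 0 ≤ b₁ := by
    have := C.one_le_Vlo; have := C.one_le_SmD; have := C.one_le_Bom; positivity
  have hb₂0 : 0 ≤ b₂ := by
    have := C.one_le_Vlo; have := C.one_le_Mom; have := C.one_le_Ent; positivity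
  have hpoint : ∀ x ∈ cube p, ∀ᵐ xs ∂(Measure.pi fun _ : Fin n => S.νX),
      ∫⁻ ys, edist (mhat (fun i => (xs i, ys i)) x) (S.m x) ^ 2
        ∂(Measure.pi fun i => S.η (xs i)) ≤
      ENNReal.ofReal (b₁ * (k : ℝ)⁻¹) *
        ∑ j, nearestDist x (fun l => xs (blockIndex n k j l)) ^ (2 * C.β) + ENNReal.ofReal b₂ := by
    intro x hx
    filter_upwards [S.ae_forall_mem_cube (n := n), S.ae_ae_of_ae_sampleLaw (hmin x hx),
      hB x hx] with xs hxs hmin' hH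
    refine (knn_conditional_le hA hα hα' hκ hκα hμ hk hx hxs (hN xs x).1
      (Setting.measurable_responses hm xs x) ?_ hH).trans ?_
    · filter_upwards [hmin'] with ys hys
      exact hys (Set.mem_univ (S.m x))
    · rw [ENNReal.ofReal_add (by positivity) hb₂0, ← hb₁, ← mul_assoc,
        ENNReal.ofReal_mul (by positivity)]
      gcongr
      rw [ENNReal.ofReal_sum_of_nonneg fun i _ => by positivity]
      refine le_trans (le_of_eq (Finset.sum_congr rfl fun i _ => ?_))
        ((hN xs x).sum_rpow_le hL hβ2)
      rw [ENNReal.ofReal_rpow_of_nonneg (norm_nonneg _) hβ2]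
  refine (Setting.risk_le_lintegral hm hpoint).trans ?_
  have hblock : ∀ j, Function.Injective (blockIndex n k j) := fun j a b hab =>
    congrArg Prod.snd (@blockIndex_injective n k (j, a) (j, b) hab)
  have hnd : ∀ x : Euc p, Measurable fun zs : Fin (n / k) → Euc p =>
      nearestDist x zs ^ (2 * C.β) := fun x =>
    (Measurable.iInf fun l => (measurable_pi_apply l).edist measurable_const).pow_const _
  have hinner : ∀ x : Euc p, ∫⁻ xs, (ENNReal.ofReal (b₁ * (k : ℝ)⁻¹) *
        ∑ j, nearestDist x (fun l => xs (blockIndex n k j l)) ^ (2 * C.β) + ENNReal.ofReal b₂)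
        ∂(Measure.pi fun _ : Fin n => S.νX) =
      ENNReal.ofReal b₁ * ∫⁻ zs, nearestDist x zs ^ (2 * C.β)
        ∂(Measure.pi fun _ : Fin (n / k) => S.νX) + ENNReal.ofReal b₂ := by
    intro x
    -- Each block is an i.i.d. sample of size `n / k`, so the `k` terms have equal means and cancel
    -- the factor `k⁻¹`.
    have hmp := fun j => measurePreserving_comp_injective S.νX (hblock j)
    have h0 : ∀ j, Measurable fun xs : Fin n → Euc p =>
        nearestDist x (fun l => xs (blockIndex n k j l)) ^ (2 * C.β) :=
      fun j => (hnd x).comp (hmp j).measurable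
    rw [lintegral_add_right _ measurable_const, lintegral_const, measure_univ, mul_one,
      lintegral_const_mul' _ _ ENNReal.ofReal_ne_top,
      lintegral_finsetSum _ fun j _ => h0 j]
    have h1 : ∀ j, ∫⁻ xs, nearestDist x (fun l => xs (blockIndex n k j l)) ^ (2 * C.β)
        ∂(Measure.pi fun _ : Fin n => S.νX) = ∫⁻ zs, nearestDist x zs ^ (2 * C.β)
        ∂(Measure.pi fun _ : Fin (n / k) => S.νX) := fun j => (hmp j).lintegral_comp (hnd x)
    simp_rw [h1]
    rw [Finset.sum_const, Finset.card_univ, Fintype.card_fin, nsmul_eq_mul, ← mul_assoc,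
      ← ENNReal.ofReal_natCast k, ← ENNReal.ofReal_mul (by positivity),
      inv_mul_cancel_right₀ hk0.ne']
  simp_rw [hinner]
  rw [lintegral_add_right _ measurable_const, lintegral_const, measure_univ, mul_one,
    lintegral_const_mul' _ _ ENNReal.ofReal_ne_top, ENNReal.ofReal_add (by positivity) hb₂0,
    ENNReal.ofReal_mul hb₁0]
  gcongr

end NearestNeighbours

/-! ### Balancing bias and variance. -/

section Rates

variable {β : ℝ} {p n : ℕ}

lemma inv_mul_pow_le_of_le (hβ : 0 < β) (hn : 1 ≤ n) {a h : ℝ} (ha : 0 < a)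
    (hh : a * (n : ℝ) ^ (-(1 / (2 * β + p))) ≤ h) :
    ((n : ℝ) * h ^ p)⁻¹ ≤ (a ^ p)⁻¹ * (n : ℝ) ^ (-(2 * β / (2 * β + p))) := by
  have hn0 : (0 : ℝ) < n := by exact_mod_cast hn
  have hD : 0 < 2 * β + p := by positivity
  rw [Real.rpow_neg hn0.le, ← mul_inv]
  apply inv_anti₀ (by positivity)
  have h1 : (a * (n : ℝ) ^ (-(1 / (2 * β + p)))) ^ p ≤ h ^ p :=
    pow_le_pow_left₀ (by positivity) hh p
  have h2 : (n : ℝ) * ((n : ℝ) ^ (-(1 / (2 * β + p)))) ^ p = (n : ℝ) ^ (2 * β / (2 * β + p)) := by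
    rw [← Real.rpow_natCast, ← Real.rpow_mul hn0.le]
    nth_rewrite 1 [← Real.rpow_one (n : ℝ)]
    rw [← Real.rpow_add hn0]
    congr 1
    field_simp
    ring
  calc a ^ p * (n : ℝ) ^ (2 * β / (2 * β + p))
      = n * (a * (n : ℝ) ^ (-(1 / (2 * β + p)))) ^ p := by rw [← h2, mul_pow]; ring
    _ ≤ n * h ^ p := by gcongr

lemma rpow_le_of_le (hβ : 0 < β) {b h : ℝ} (hb : 0 ≤ b) (hh0 : 0 ≤ h)
    (hh : h ≤ b * (n : ℝ) ^ (-(1 / (2 * β + p)))) :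
    h ^ (2 * β) ≤ b ^ (2 * β) * (n : ℝ) ^ (-(2 * β / (2 * β + p))) := by
  have hn0 : (0 : ℝ) ≤ n := Nat.cast_nonneg n
  refine (Real.rpow_le_rpow hh0 hh (by positivity)).trans (le_of_eq ?_)
  rw [Real.mul_rpow hb (by positivity), ← Real.rpow_mul hn0]
  congr 2
  ring

lemma inv_le_of_le (hn : 1 ≤ n) {a k : ℝ} (ha : 0 < a)
    (hk : a * (n : ℝ) ^ (2 * β / (2 * β + p)) ≤ k) :
    k⁻¹ ≤ a⁻¹ * (n : ℝ) ^ (-(2 * β / (2 * β + p))) := by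
  have hn0 : (0 : ℝ) < n := by exact_mod_cast hn
  rw [Real.rpow_neg hn0.le, ← mul_inv]
  exact inv_anti₀ (by positivity) hk

lemma div_rpow_le_of_le (hβ : 0 < β) (hp : 1 ≤ p) {k : ℕ} (hk : 1 ≤ k) (hkn : k ≤ n) {b c : ℝ}
    (hb : 0 < b) (hc : 0 ≤ c) (hkb : (k : ℝ) ≤ b * (n : ℝ) ^ (2 * β / (2 * β + p))) :
    c / ((n / k : ℕ) : ℝ) ^ (2 * β / p) ≤
      c * (2 * b) ^ (2 * β / p) * (n : ℝ) ^ (-(2 * β / (2 * β + p))) := by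
  have hn0 : (0 : ℝ) < n := by exact_mod_cast hk.trans hkn
  have hk0 : (0 : ℝ) < k := by exact_mod_cast hk
  have hp0 : (0 : ℝ) < p := by exact_mod_cast hp
  -- Rounding down costs at most a factor `2`, because `n / k ≥ 1`.
  have hL : (n : ℝ) / (2 * k) ≤ ((n / k : ℕ) : ℝ) := by
    have h1 : 1 ≤ n / k := (Nat.one_le_div_iff hk).2 hkn
    have h2 : n ≤ 2 * k * (n / k) := by
      have h3 := Nat.div_add_mod n k
      have h4 := Nat.mod_lt n hk
      have h5 : k * 1 ≤ k * (n / k) := Nat.mul_le_mul_left k h1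
      linarith
    rw [div_le_iff₀ (by positivity)]
    have h3 : (n : ℝ) ≤ 2 * k * ((n / k : ℕ) : ℝ) := by exact_mod_cast h2
    linarith
  have hLb : (n : ℝ) ^ ((p : ℝ) / (2 * β + p)) / (2 * b) ≤ ((n / k : ℕ) : ℝ) := by
    refine le_trans ?_ hL
    rw [div_le_div_iff₀ (by positivity) (by positivity)]
    have h1 : (n : ℝ) = (n : ℝ) ^ ((p : ℝ) / (2 * β + p)) * (n : ℝ) ^ (2 * β / (2 * β + p)) := by
      rw [← Real.rpow_add hn0, ← add_div, add_comm (p : ℝ), div_self (by positivity),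
        Real.rpow_one]
    calc (n : ℝ) ^ ((p : ℝ) / (2 * β + p)) * (2 * k)
        ≤ (n : ℝ) ^ ((p : ℝ) / (2 * β + p)) * (2 * (b * (n : ℝ) ^ (2 * β / (2 * β + p)))) := by
          gcongr
      _ = ((n : ℝ) ^ ((p : ℝ) / (2 * β + p)) * (n : ℝ) ^ (2 * β / (2 * β + p))) * (2 * b) := by
          ring
      _ = _ := by rw [← h1]
  have h1 : (n : ℝ) ^ (2 * β / (2 * β + p)) / (2 * b) ^ (2 * β / p) ≤
      ((n / k : ℕ) : ℝ) ^ (2 * β / p) := by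
    refine le_trans (le_of_eq ?_) (Real.rpow_le_rpow (by positivity) hLb (by positivity))
    rw [Real.div_rpow (by positivity) (by positivity), ← Real.rpow_mul hn0.le]
    congr 2
    field_simp
  calc c / ((n / k : ℕ) : ℝ) ^ (2 * β / p)
      ≤ c / ((n : ℝ) ^ (2 * β / (2 * β + p)) / (2 * b) ^ (2 * β / p)) := by gcongr
    _ = _ := by rw [Real.rpow_neg hn0.le]; field_simp

end Rates

/-! ### Risk bounds with explicit constants, and the theorem. -/

variable {p : ℕ} {Ω : Type u} [MetricSpace Ω] [MeasurableSpace Ω] [BorelSpace Ω] {S : Setting p Ω}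
  {α κ : ℝ} {C : Params} {n k : ℕ}

/-- The constant of the variance terms for the Nadaraya–Watson estimator. -/
noncomputable def nwConst (α κ : ℝ) (p : ℕ) (K : ℝ → ℝ) : ℝ :=
  (2 * Real.sqrt p + 2) ^ p * (peelConst α κ * (2 * K 0 / K (1 / 2)) + 16 * Real.exp 1)

lemma nwConst_pos (hα : α < 2) (hκ : 0 < κ) (hκα : 2 / (2 - α) < κ) {K : ℝ → ℝ}
    (hK : IsSmoothingKernel K) : 0 < nwConst α κ p K := by
  have hpc := peelConst_ge hα hκ hκα
  have hpc0 : 0 < peelConst α κ := by linarith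
  have hk₀ : 0 < K (1 / 2) := hK.pos _ (by norm_num) (by norm_num)
  have hk₁ : 0 < K 0 := hK.pos _ (by norm_num) (by norm_num)
  unfold nwConst
  positivity

/-- Risk of the Nadaraya–Watson estimator for an arbitrary bandwidth. -/
lemma nw_risk_le_of_empty_window (hA : Assumptions S α κ C) (hα : 1 ≤ α) (hα' : α < 2)
    (hκ : 2 < κ) (hκα : 2 / (2 - α) < κ) {K : ℝ → ℝ} (hK : IsSmoothingKernel K) {h : ℝ}
    (hh : 0 < h) (hn : 1 ≤ n) {mhat : (Fin n → Euc p × Ω) → Euc p → Ω}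
    (hNW : IsNW S K h mhat) (hB : S.BiasMoment κ C mhat) {A B : ℝ} (hA0 : 0 ≤ A)
    (hAB : A ≤ 16 * B)
    (hempty : ∀ x ∈ cube p, ∀ᵐ xs ∂(Measure.pi fun _ : Fin n => S.νX),
      (∀ i, K (‖xs i - x‖ / h) = 0) →
      ∫⁻ ys, edist (mhat (fun i => (xs i, ys i)) x) (S.m x) ^ 2
        ∂(Measure.pi fun i => S.η (xs i)) ≤ ENNReal.ofReal A) :
    S.risk mhat ≤ ENNReal.ofReal
      (peelConst α κ * (C.Vlo * C.SmD * C.Bom) ^ (2 / (2 - α)) * h ^ (2 * C.β)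
        + nwConst α κ p K * B * Real.exp (-1) * ((n : ℝ) * h ^ p)⁻¹
        + nwConst α κ p K * (C.Vlo * C.Mom * C.Ent) ^ (2 / (2 - α)) * ((n : ℝ) * h ^ p)⁻¹) := by
  have hκ0 : 0 < κ := by linarith
  have hpc := peelConst_ge hα' hκ0 hκα
  have hpc0 : 0 < peelConst α κ := by linarith
  have hc := nwConst_pos (p := p) hα' hκ0 hκα hK
  have hB0 : 0 ≤ B := by linarith
  have hT0 : 0 ≤ (C.Vlo * C.Mom * C.Ent) ^ (2 / (2 - α)) := by
    have := C.one_le_Vlo; have := C.one_le_Mom; have := C.one_le_Ent; positivity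
  rcases lt_or_ge h 1 with hh1 | hh1
  · refine (nw_risk_le hA hα hα' hκ hκα hK hh hh1 hn hNW hB hA0 hempty).trans
      (ENNReal.ofReal_le_ofReal ?_)
    have hk₀ : 0 < K (1 / 2) := hK.pos _ (by norm_num) (by norm_num)
    have hk₁ : 0 < K 0 := hK.pos _ (by norm_num) (by norm_num)
    set q : ℝ := ((n : ℝ) * h ^ p)⁻¹ with hq
    have hq0 : 0 ≤ q := by positivity
    set D : ℝ := (2 * Real.sqrt p + 2) ^ p with hD
    have hD0 : 0 ≤ D := by positivity
    -- The summand `16 * exp 1` of `nwConst` absorbs the `16` of `hAB` and compensates the factor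
    -- `exp (-1)`.
    have h1 : D * A ≤ nwConst α κ p K * B * Real.exp (-1) := by
      have he : Real.exp 1 * Real.exp (-1) = 1 := by rw [← Real.exp_add]; simp
      calc D * A ≤ D * (16 * B) := by gcongr
        _ = D * (16 * Real.exp 1) * B * Real.exp (-1) := by linear_combination (-16 * D * B) * he
        _ ≤ _ := by
          unfold nwConst
          gcongr
          exact le_add_of_nonneg_left (by positivity)
    have h2 : D * (peelConst α κ * (2 * K 0 / K (1 / 2))) ≤ nwConst α κ p K := by
      unfold nwConst
      gcongr
      exact le_add_of_nonneg_right (by positivity)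
    have h3 := mul_le_mul_of_nonneg_right h1 hq0
    have h4 := mul_le_mul_of_nonneg_right (mul_le_mul_of_nonneg_right h2 hT0) hq0
    linarith
  · refine (nw_risk_le_of_one_le hα' hκ hκα hα hh1 hNW.1 hB).trans (ENNReal.ofReal_le_ofReal ?_)
    have h1 : 0 ≤ nwConst α κ p K * B * Real.exp (-1) * ((n : ℝ) * h ^ p)⁻¹ := by positivity
    have h2 : 0 ≤ nwConst α κ p K * (C.Vlo * C.Mom * C.Ent) ^ (2 / (2 - α)) *
      ((n : ℝ) * h ^ p)⁻¹ := by positivity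
    linarith

lemma sq_le_rpow {t : ℝ} (ht : 1 ≤ t) (hα : 1 ≤ α) (hα' : α < 2) : t ^ 2 ≤ t ^ (2 / (2 - α)) := by
  rw [← Real.rpow_two]
  apply Real.rpow_le_rpow_of_exponent_le ht
  rw [le_div_iff₀ (by linarith)]
  linarith

/-- Risk of the Nadaraya–Watson estimator for any choice of the minimizer. -/
lemma nw_risk_le_any (hA : Assumptions S α κ C) (hα : 1 ≤ α) (hα' : α < 2)
    (hκ : 2 < κ) (hκα : 2 / (2 - α) < κ) {K : ℝ → ℝ} (hK : IsSmoothingKernel K) {h : ℝ}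
    (hh : 0 < h) (hn : 1 ≤ n) {mhat : (Fin n → Euc p × Ω) → Euc p → Ω}
    (hNW : IsNW S K h mhat) (hB : S.BiasMoment κ C mhat) :
    S.risk mhat ≤ ENNReal.ofReal
      (peelConst α κ * (C.Vlo * C.SmD * C.Bom) ^ (2 / (2 - α)) * h ^ (2 * C.β)
        + nwConst α κ p K * (C.Vlo * C.Bom) ^ (2 / (2 - α)) * Real.exp (-1) * ((n : ℝ) * h ^ p)⁻¹
        + nwConst α κ p K * (C.Vlo * C.Mom * C.Ent) ^ (2 / (2 - α)) * ((n : ℝ) * h ^ p)⁻¹) := by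
  have hV := C.one_le_Vlo
  have hBo := C.one_le_Bom
  refine nw_risk_le_of_empty_window hA hα hα' hκ hκα hK hh hn hNW hB (A := C.Bom ^ 2)
    (by positivity) ?_ fun x hx => ?_
  · have h1 := sq_le_rpow (one_le_mul_of_one_le_of_one_le hV hBo) hα hα'
    have h2 : C.Bom ^ 2 ≤ (C.Vlo * C.Bom) ^ 2 := by
      gcongr; nlinarith
    have h3 : 0 ≤ C.Bom ^ 2 := by positivity
    linarith
  · filter_upwards [hB x hx] with xs hH _
    exact Setting.conditional_risk_le_Bom hκ.le (Setting.measurable_responses hNW.1 xs x) hH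

/-- Risk of the Nadaraya–Watson estimator with the global mean on empty windows. -/
lemma nw_risk_le_emptyWindowRule (hA : Assumptions S α κ C) (hα : 1 ≤ α) (hα' : α < 2)
    (hκ : 2 < κ) (hκα : 2 / (2 - α) < κ) {K : ℝ → ℝ} (hK : IsSmoothingKernel K) {h : ℝ}
    (hh : 0 < h) (hn : 1 ≤ n) {mhat : (Fin n → Euc p × Ω) → Euc p → Ω}
    (hNW : IsNW S K h mhat) (hB : S.BiasMoment κ C mhat) (hE : EmptyWindowRule S K h mhat) :
    S.risk mhat ≤ ENNReal.ofReal
      (peelConst α κ * (C.Vlo * C.SmD * C.Bom) ^ (2 / (2 - α)) * h ^ (2 * C.β)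
        + nwConst α κ p K * (C.Vlo * C.Mom * C.Len) ^ (2 / (2 - α)) * Real.exp (-1)
            * ((n : ℝ) * h ^ p)⁻¹
        + nwConst α κ p K * (C.Vlo * C.Mom * C.Ent) ^ (2 / (2 - α)) * ((n : ℝ) * h ^ p)⁻¹) := by
  have hV := C.one_le_Vlo
  have hM := C.one_le_Mom
  have hL := C.one_le_Len
  refine nw_risk_le_of_empty_window hA hα hα' hκ hκα hK hh hn hNW hB
    (A := 16 * (C.Mom * C.Len) ^ 2) (by positivity) ?_ fun x hx => ?_
  · have h0 := one_le_mul_of_one_le_of_one_le hM hL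
    have h1 := sq_le_rpow (one_le_mul_of_one_le_of_one_le
      (one_le_mul_of_one_le_of_one_le hV hM) hL) hα hα'
    have h2 : (C.Mom * C.Len) ^ 2 ≤ (C.Vlo * C.Mom * C.Len) ^ 2 := by
      gcongr; nlinarith
    linarith
  · filter_upwards [S.ae_forall_mem_cube (n := n), S.ae_ae_of_ae_sampleLaw (hE x hx)]
      with xs hxs hmin hz
    refine Setting.conditional_risk_mean_le hA hκ hn hx hxs ?_
    filter_upwards [hmin] with ys hys
    exact hys (fun i => by simp [scaledKernel, hz i]) (Set.mem_univ (S.m x))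

/-- Risk of the nearest neighbour estimator in dimension at least three. -/
lemma knn_risk_le_of_three_le (hA : Assumptions S α κ C) (hα : 1 ≤ α) (hα' : α < 2)
    (hκ : 2 < κ) (hκα : 2 / (2 - α) < κ) (hp : 3 ≤ p) (hk : 1 ≤ k) (hkn : k ≤ n)
    {mhat : (Fin n → Euc p × Ω) → Euc p → Ω} (hNN : IsKNN S k mhat)
    (hB : S.BiasMoment κ C mhat) :
    S.risk mhat ≤ ENNReal.ofReal
      (peelConst α κ * (C.Vlo * C.SmD * C.Bom) ^ (2 / (2 - α)) *
          ((1 + 8 * (3 * Real.sqrt p) ^ p) / ((n / k : ℕ) : ℝ) ^ (2 * C.β / p)) +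
        peelConst α κ * (C.Vlo * C.Mom * C.Ent) ^ (2 / (2 - α)) * (k : ℝ)⁻¹) :=
  knn_risk_le hA hα hα' hκ hκα hk hkn hNN hB (by positivity)
    (lintegral_nearestDist_le S.νX_cube hp ((Nat.one_le_div_iff hk).2 hkn) C.β_pos C.β_le)

/-- Risk of the nearest neighbour estimator under the ball mass condition. -/
lemma knn_risk_le_of_ballMass (hA : Assumptions S α κ C) (hα : 1 ≤ α) (hα' : α < 2)
    (hκ : 2 < κ) (hκα : 2 / (2 - α) < κ) (hp : 1 ≤ p) (hk : 1 ≤ k) (hkn : k ≤ n) {ξ₀ G : ℝ}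
    (hξ : 0 < ξ₀) (hG : S.BallMass ξ₀ G)
    {mhat : (Fin n → Euc p × Ω) → Euc p → Ω} (hNN : IsKNN S k mhat)
    (hB : S.BiasMoment κ C mhat) :
    S.risk mhat ≤ ENNReal.ofReal
      (peelConst α κ * (C.Vlo * C.SmD * C.Bom) ^ (2 / (2 - α)) *
          (49 * (min 1 (ξ₀ / Real.sqrt p))⁻¹ ^ 2 * (1 + max G 0) /
            ((n / k : ℕ) : ℝ) ^ (2 * C.β / p)) +
        peelConst α κ * (C.Vlo * C.Mom * C.Ent) ^ (2 / (2 - α)) * (k : ℝ)⁻¹) :=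
  knn_risk_le hA hα hα' hκ hκα hk hkn hNN hB
    (div_nonneg (mul_nonneg (by positivity) (by positivity)) (by positivity))
    (S.lintegral_nearestDist_le_of_ballMass hp hξ hG ((Nat.one_le_div_iff hk).2 hkn)
      C.β_pos C.β_le)

/-- Balance of the two terms of the nearest neighbour bound. -/
lemma knn_bound_le (hp : 1 ≤ p) (hk : 1 ≤ k) (hkn : k ≤ n) {a b U V c : ℝ} {β : ℝ} (hβ : 0 < β)
    (ha : 0 < a) (hb : 0 < b) (hU : 0 ≤ U) (hV : 0 ≤ V) (hc : 0 ≤ c)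
    (hka : a * (n : ℝ) ^ (2 * β / (2 * β + p)) ≤ k)
    (hkb : (k : ℝ) ≤ b * (n : ℝ) ^ (2 * β / (2 * β + p))) :
    U * (c / ((n / k : ℕ) : ℝ) ^ (2 * β / p)) + V * (k : ℝ)⁻¹ ≤
      (U * (c * (2 * b) ^ (2 * β / p)) + V * a⁻¹) * (n : ℝ) ^ (-(2 * β / (2 * β + p))) := by
  have h1 := mul_le_mul_of_nonneg_left (div_rpow_le_of_le hβ hp hk hkn hb hc hkb) hU
  have h2 := mul_le_mul_of_nonneg_left (inv_le_of_le (hk.trans hkn) ha hka) hV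
  linarith

end FrechetReg

open FrechetReg in
theorem theorem2 (α κ : ℝ) (hα₁ : 1 ≤ α) (hα₂ : α < 2) (hκ : 2 / (2 - α) < κ) :
    -- `c` depends on `α` and `κ` only
    ∃ c : ℝ, 0 < c ∧
      -- Nadaraya–Watson: `c'` depends on the dimension and the kernel (and on `α`, `κ`) only
      (∀ (p : ℕ) (K : ℝ → ℝ), 1 ≤ p → IsSmoothingKernel K →
        (∃ c' : ℝ, 0 < c' ∧
          ∀ (C : Params) (Ω : Type u) [MetricSpace Ω] [MeasurableSpace Ω] [BorelSpace Ω]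
            (S : Setting p Ω) (n : ℕ) (h : ℝ) (mhat : (Fin n → Euc p × Ω) → Euc p → Ω),
            1 ≤ n → 0 < h → Assumptions S α κ C → IsNW S K h mhat → S.BiasMoment κ C mhat →
            -- any minimizer
            S.risk mhat ≤ ENNReal.ofReal
              (c * (C.Vlo * C.SmD * C.Bom) ^ (2 / (2 - α)) * h ^ (2 * C.β)
                + c' * (C.Vlo * C.Bom) ^ (2 / (2 - α)) * Real.exp (-1) * ((n : ℝ) * h ^ p)⁻¹
                + c' * (C.Vlo * C.Mom * C.Ent) ^ (2 / (2 - α)) * ((n : ℝ) * h ^ p)⁻¹) ∧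
            -- with the data-driven value on empty windows
            (EmptyWindowRule S K h mhat →
              S.risk mhat ≤ ENNReal.ofReal
                (c * (C.Vlo * C.SmD * C.Bom) ^ (2 / (2 - α)) * h ^ (2 * C.β)
                  + c' * (C.Vlo * C.Mom * C.Len) ^ (2 / (2 - α)) * Real.exp (-1)
                      * ((n : ℝ) * h ^ p)⁻¹
                  + c' * (C.Vlo * C.Mom * C.Ent) ^ (2 / (2 - α)) * ((n : ℝ) * h ^ p)⁻¹))) ∧
        -- tuned bandwidth
        (∀ (C : Params) (a b : ℝ), 0 < a → a ≤ b → ∃ c' : ℝ, 0 < c' ∧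
          ∀ (Ω : Type u) [MetricSpace Ω] [MeasurableSpace Ω] [BorelSpace Ω]
            (S : Setting p Ω) (n : ℕ) (h : ℝ) (mhat : (Fin n → Euc p × Ω) → Euc p → Ω),
            1 ≤ n →
            a * (n : ℝ) ^ (-(1 / (2 * C.β + p))) ≤ h →
            h ≤ b * (n : ℝ) ^ (-(1 / (2 * C.β + p))) →
            Assumptions S α κ C → IsNW S K h mhat → S.BiasMoment κ C mhat →
            S.risk mhat ≤ ENNReal.ofReal (c' * (n : ℝ) ^ (-(2 * C.β / (2 * C.β + p)))))) ∧
      -- nearest neighbours, `p ≥ 3`: `c'` depends on the dimension only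
      (∀ p : ℕ, 3 ≤ p →
        (∃ c' : ℝ, 0 < c' ∧
          ∀ (C : Params) (Ω : Type u) [MetricSpace Ω] [MeasurableSpace Ω] [BorelSpace Ω]
            (S : Setting p Ω) (n k : ℕ) (mhat : (Fin n → Euc p × Ω) → Euc p → Ω),
            1 ≤ k → k ≤ n → Assumptions S α κ C → IsKNN S k mhat → S.BiasMoment κ C mhat →
            S.risk mhat ≤ ENNReal.ofReal
              (c * (C.Vlo * C.SmD * C.Bom) ^ (2 / (2 - α))
                  * (c' / ((n / k : ℕ) : ℝ) ^ (2 * C.β / p))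
                + c * (C.Vlo * C.Mom * C.Ent) ^ (2 / (2 - α)) * (k : ℝ)⁻¹)) ∧
        (∀ (C : Params) (a b : ℝ), 0 < a → a ≤ b → ∃ c' : ℝ, 0 < c' ∧
          ∀ (Ω : Type u) [MetricSpace Ω] [MeasurableSpace Ω] [BorelSpace Ω]
            (S : Setting p Ω) (n k : ℕ) (mhat : (Fin n → Euc p × Ω) → Euc p → Ω),
            1 ≤ k → k ≤ n →
            a * (n : ℝ) ^ (2 * C.β / (2 * C.β + p)) ≤ k →
            (k : ℝ) ≤ b * (n : ℝ) ^ (2 * C.β / (2 * C.β + p)) →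
            Assumptions S α κ C → IsKNN S k mhat → S.BiasMoment κ C mhat →
            S.risk mhat ≤ ENNReal.ofReal (c' * (n : ℝ) ^ (-(2 * C.β / (2 * C.β + p)))))) ∧
      -- nearest neighbours, `p < 3`: `c'` depends also on the constants of the ball-mass condition
      (∀ (p : ℕ) (ξ₀ G : ℝ), 1 ≤ p → p < 3 → 0 < ξ₀ →
        (∃ c' : ℝ, 0 < c' ∧
          ∀ (C : Params) (Ω : Type u) [MetricSpace Ω] [MeasurableSpace Ω] [BorelSpace Ω]
            (S : Setting p Ω) (n k : ℕ) (mhat : (Fin n → Euc p × Ω) → Euc p → Ω),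
            1 ≤ k → k ≤ n → S.BallMass ξ₀ G →
            Assumptions S α κ C → IsKNN S k mhat → S.BiasMoment κ C mhat →
            S.risk mhat ≤ ENNReal.ofReal
              (c * (C.Vlo * C.SmD * C.Bom) ^ (2 / (2 - α))
                  * (c' / ((n / k : ℕ) : ℝ) ^ (2 * C.β / p))
                + c * (C.Vlo * C.Mom * C.Ent) ^ (2 / (2 - α)) * (k : ℝ)⁻¹)) ∧
        (∀ (C : Params) (a b : ℝ), 0 < a → a ≤ b → ∃ c' : ℝ, 0 < c' ∧
          ∀ (Ω : Type u) [MetricSpace Ω] [MeasurableSpace Ω] [BorelSpace Ω]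
            (S : Setting p Ω) (n k : ℕ) (mhat : (Fin n → Euc p × Ω) → Euc p → Ω),
            1 ≤ k → k ≤ n → S.BallMass ξ₀ G →
            a * (n : ℝ) ^ (2 * C.β / (2 * C.β + p)) ≤ k →
            (k : ℝ) ≤ b * (n : ℝ) ^ (2 * C.β / (2 * C.β + p)) →
            Assumptions S α κ C → IsKNN S k mhat → S.BiasMoment κ C mhat →
            S.risk mhat ≤ ENNReal.ofReal (c' * (n : ℝ) ^ (-(2 * C.β / (2 * C.β + p)))))) := by
  have hα0 : 0 < 2 - α := by linarith
  -- Since `α ≥ 1`, the threshold `2 / (2 - α)` is at least `2`; second moments are therefore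
  -- available throughout.
  have hκ2 : 2 < κ := lt_of_le_of_lt (by rw [le_div_iff₀ hα0]; linarith) hκ
  have hκ0 : 0 < κ := by linarith
  have hpc : 0 < peelConst α κ := by linarith [peelConst_ge hα₂ hκ0 hκ]
  have hU : ∀ C : Params, 0 < peelConst α κ * (C.Vlo * C.SmD * C.Bom) ^ (2 / (2 - α)) := by
    intro C
    have := C.one_le_Vlo; have := C.one_le_SmD; have := C.one_le_Bom; positivity
  have hT : ∀ C : Params, 0 < (C.Vlo * C.Mom * C.Ent) ^ (2 / (2 - α)) := by
    intro C
    have := C.one_le_Vlo; have := C.one_le_Mom; have := C.one_le_Ent; positivity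
  refine ⟨peelConst α κ, hpc, fun p K hp hK => ⟨⟨nwConst α κ p K, nwConst_pos hα₂ hκ0 hκ hK, ?_⟩,
    ?_⟩, fun p hp => ⟨⟨1 + 8 * (3 * Real.sqrt p) ^ p, by positivity, ?_⟩, ?_⟩,
    fun p ξ₀ G hp _ hξ => ?_⟩
  · intro C Ω _ _ _ S n h mhat hn hh hA hNW hB
    exact ⟨nw_risk_le_any hA hα₁ hα₂ hκ2 hκ hK hh hn hNW hB,
      nw_risk_le_emptyWindowRule hA hα₁ hα₂ hκ2 hκ hK hh hn hNW hB⟩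
  · intro C a b ha hab
    have hc := nwConst_pos (p := p) hα₂ hκ0 hκ hK
    have hb : 0 < b := ha.trans_le hab
    have hU0 := hU C
    have hT0 := hT C
    have hW0 : 0 < (C.Vlo * C.Bom) ^ (2 / (2 - α)) := by
      have := C.one_le_Vlo; have := C.one_le_Bom; positivity
    refine ⟨peelConst α κ * (C.Vlo * C.SmD * C.Bom) ^ (2 / (2 - α)) * b ^ (2 * C.β) +
      (nwConst α κ p K * (C.Vlo * C.Bom) ^ (2 / (2 - α)) * Real.exp (-1) +
        nwConst α κ p K * (C.Vlo * C.Mom * C.Ent) ^ (2 / (2 - α))) * (a ^ p)⁻¹,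
      by positivity, ?_⟩
    intro Ω _ _ _ S n h mhat hn hah hhb hA hNW hB
    have hn0 : (0 : ℝ) < n := by exact_mod_cast hn
    have hh : 0 < h := lt_of_lt_of_le (by positivity) hah
    refine (nw_risk_le_any hA hα₁ hα₂ hκ2 hκ hK hh hn hNW hB).trans (ENNReal.ofReal_le_ofReal ?_)
    have h1 := mul_le_mul_of_nonneg_left (rpow_le_of_le C.β_pos hb.le hh.le hhb) hU0.le
    have h2 := mul_le_mul_of_nonneg_left (inv_mul_pow_le_of_le C.β_pos hn ha hah)
      (by positivity : 0 ≤ nwConst α κ p K * (C.Vlo * C.Bom) ^ (2 / (2 - α)) * Real.exp (-1) +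
        nwConst α κ p K * (C.Vlo * C.Mom * C.Ent) ^ (2 / (2 - α)))
    linarith
  · intro C Ω _ _ _ S n k mhat hk hkn hA hNN hB
    exact knn_risk_le_of_three_le hA hα₁ hα₂ hκ2 hκ hp hk hkn hNN hB
  · intro C a b ha hab
    have hb : 0 < b := ha.trans_le hab
    have hU0 := hU C
    have hT0 := hT C
    refine ⟨peelConst α κ * (C.Vlo * C.SmD * C.Bom) ^ (2 / (2 - α)) *
      ((1 + 8 * (3 * Real.sqrt p) ^ p) * (2 * b) ^ (2 * C.β / p)) +
      peelConst α κ * (C.Vlo * C.Mom * C.Ent) ^ (2 / (2 - α)) * a⁻¹, by positivity, ?_⟩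
    intro Ω _ _ _ S n k mhat hk hkn hka hkb hA hNN hB
    exact (knn_risk_le_of_three_le hA hα₁ hα₂ hκ2 hκ hp hk hkn hNN hB).trans
      (ENNReal.ofReal_le_ofReal (knn_bound_le (by omega) hk hkn C.β_pos ha hb hU0.le
        (by positivity) (by positivity) hka hkb))
  · have hp0 : (0 : ℝ) < p := by exact_mod_cast hp
    have hs : 0 < min 1 (ξ₀ / Real.sqrt p) := lt_min one_pos (by positivity)
    have hG0 : 0 < 1 + max G 0 := by linarith [le_max_right G 0]
    have hc : 0 < 49 * (min 1 (ξ₀ / Real.sqrt p))⁻¹ ^ 2 * (1 + max G 0) := by positivity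
    refine ⟨⟨_, hc, ?_⟩, ?_⟩
    · intro C Ω _ _ _ S n k mhat hk hkn hG hA hNN hB
      exact knn_risk_le_of_ballMass hA hα₁ hα₂ hκ2 hκ hp hk hkn hξ hG hNN hB
    · intro C a b ha hab
      have hb : 0 < b := ha.trans_le hab
      have hU0 := hU C
      have hT0 := hT C
      refine ⟨peelConst α κ * (C.Vlo * C.SmD * C.Bom) ^ (2 / (2 - α)) *
        (49 * (min 1 (ξ₀ / Real.sqrt p))⁻¹ ^ 2 * (1 + max G 0) * (2 * b) ^ (2 * C.β / p)) +
        peelConst α κ * (C.Vlo * C.Mom * C.Ent) ^ (2 / (2 - α)) * a⁻¹, by positivity, ?_⟩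
      intro Ω _ _ _ S n k mhat hk hkn hG hka hkb hA hNN hB
      exact (knn_risk_le_of_ballMass hA hα₁ hα₂ hκ2 hκ hp hk hkn hξ hG hNN hB).trans
        (ENNReal.ofReal_le_ofReal (knn_bound_le hp hk hkn C.β_pos ha hb hU0.le
          (by positivity) hc.le hka hkb))
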